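/- Let $p$ be a prime, $K/\mathbb{Q}_p$ a finite extension with valuation ring $\mathcal{O}$, and $\overline{K}$ an algebraic closure of $K$; write $\mathcal{O}_F$ for the valuation ring of an algebraic extension $F$ of $K$. Let $\mathfrak{g}$ be a finite-dimensional nilpotent $K$-Lie algebra of nilpotency class $c$ (the least $c$ with $\mathrm{ad}(\mathfrak{g})^c=0$), and let $\mathcal{L}$ be an $\mathcal{O}$-Lie lattice in $\mathfrak{g}$, i.e. a separated $\mathcal{O}$-submodule, closed under the bracket, with $\mathcal{L}\otimes_{\mathcal{O}}K=\mathfrak{g}$. For a Lie lattice $\mathcal{M}$ in a Lie algebra $\mathfrak{h}$ over a finite extension $F$ of $K$, let $\widehat{U(\mathcal{M})}_F$ be the completion of $U(\mathfrak{h})$ for the $p$-adic topology defined by the lattice $U(\mathcal{M})$. A polarisation of $\mathfrak{h}$ at a linear form $\lambda:\mathfrak{h}\to F$ is a solvable subalgebra $\mathfrak{b}$ such that, for all $u\in\mathfrak{h}$, $\lambda([u,\mathfrak{b}])=0$ if and only if $u\in\mathfrak{b}$. If $\lambda(\mathcal{M})\subseteq\mathcal{O}_F$ and $\mathcal{B}=\mathfrak{b}\cap\mathcal{M}$,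 the affinoid Dixmier module is $\widehat{D(\lambda)}_{\mathfrak{b}}=\widehat{U(\mathcal{M})}_F\otimes_{\widehat{U(\mathcal{B})}_F}F_\lambda$, where $F_\lambda=F$ with $\widehat{U(\mathcal{B})}_F$ acting through the continuous character extending $\lambda|_{\mathfrak{b}}$. For a $K$-linear map $\lambda:\mathfrak{g}\to\overline{K}$ with $\lambda(\mathcal{L})\subseteq\mathcal{O}_{\overline{K}}$, the Dixmier annihilator $I(\lambda)$ is the ideal of those elements of $\widehat{U(\mathcal{L})}_K$ which, via $\widehat{U(\mathcal{L})}_K\to\widehat{U(\mathcal{L}\otimes_{\mathcal{O}}\mathcal{O}_F)}_F$, annihilate $\widehat{D(\lambda)}_{\mathfrak{b}}$, where $F\subseteq\overline{K}$ is a finite extension of $K$ containing the values of $\lambda$ and $\mathfrak{b}$ is a polarisation of $\mathfrak{g}\otimes_KF$ at the $F$-linear extension of $\lambda$. Theorem. Let $\lambda,\mu:\mathfrak{g}\to\overline{K}$ be $K$-linear maps with $\lambda(\mathcal{L})\subseteq\mathcal{O}_{\overline{K}}$ and $\mu(\mathcal{L})\subseteq\mathcal{O}_{\overline{K}}$. Suppose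 that $\mu=\exp(\mathrm{ad}(u))\cdot\lambda$, for the coadjoint action $(\sigma\cdot\lambda)(x)=\lambda(\sigma^{-1}x)$ on $\overline{K}$-linear forms on $\mathfrak{g}\otimes_K\overline{K}$, for some $N\in\mathbb{N}$ and some $u\in p^{-N}(\mathcal{L}\otimes_{\mathcal{O}}\mathcal{O}_{\overline{K}})$. Then for every $n\in\mathbb{N}$ with $n\ge Nc+v_p(c!)$, $$I(\lambda)\cap\widehat{U(p^{2n}\mathcal{L})}_K=I(\mu)\cap\widehat{U(p^{2n}\mathcal{L})}_K$$ inside $\widehat{U(\mathcal{L})}_K$, whichever fields $F$ and polarisations are used to compute $I(\lambda)$ and $I(\mu)$. -/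

import Mathlib

open scoped TensorProduct

noncomputable section

namespace AffinoidDixmier

/-! ### The valuation ring of an algebraic extension of `ℚ_p` -/

section Integers

variable (p : ℕ) [Fact p.Prime]

/-- The valuation ring `𝒪_k = {x : |x| ≤ 1}` of an algebraic extension `k` of `ℚ_p`, where `|·|` is
the unique extension to `k` of the `p`-adic absolute value. -/
def valuationRing (k : Type*) [Field k] [Algebra ℚ_[p] k] [Algebra.IsAlgebraic ℚ_[p] k] :
    Subring k where
  carrier := {x | spectralNorm ℚ_[p] k x ≤ 1}
  mul_mem' {x y} hx hy := by
    let := spectralNorm.normedField ℚ_[p] k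
    have h : ‖x * y‖ = ‖x‖ * ‖y‖ := norm_mul x y
    have hx' : ‖x‖ ≤ 1 := hx
    have hy' : ‖y‖ ≤ 1 := hy
    change ‖x * y‖ ≤ 1
    rw [h]
    exact mul_le_one₀ hx' (norm_nonneg y) hy'
  one_mem' := by
    let := spectralNorm.normedField ℚ_[p] k
    change ‖(1 : k)‖ ≤ 1
    rw [norm_one]
  add_mem' {x y} hx hy :=
    (isNonarchimedean_spectralNorm (K := ℚ_[p]) (L := k) x y).trans (max_le hx hy)
  zero_mem' := by
    let := spectralNorm.normedField ℚ_[p] k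
    change ‖(0 : k)‖ ≤ 1
    rw [norm_zero]
    exact zero_le_one
  neg_mem' {x} hx := by
    let := spectralNorm.normedField ℚ_[p] k
    have hx' : ‖x‖ ≤ 1 := hx
    change ‖-x‖ ≤ 1
    rwa [norm_neg]

variable {k : Type*} [Field k] [Algebra ℚ_[p] k] [Algebra.IsAlgebraic ℚ_[p] k]

theorem spectralNorm_p_pow (n : ℕ) :
    spectralNorm ℚ_[p] k ((p : k) ^ n) = ((p : ℝ)⁻¹) ^ n := by
  have h : ((p : k) ^ n) = algebraMap ℚ_[p] k ((p : ℚ_[p]) ^ n) := by simp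
  rw [h, spectralNorm_extends, norm_pow, Padic.norm_p]

theorem p_ne_zero (k : Type*) [Field k] [Algebra ℚ_[p] k] : (p : k) ≠ 0 := by
  have h : (p : k) = algebraMap ℚ_[p] k (p : ℚ_[p]) := by simp
  rw [h, Ne, map_eq_zero]
  exact_mod_cast (Fact.out : p.Prime).ne_zero

theorem inv_p_lt_one : ((p : ℝ)⁻¹) < 1 :=
  inv_lt_one_of_one_lt₀ (by exact_mod_cast (Fact.out : p.Prime).one_lt)

theorem p_pow_mem (n : ℕ) : ((p : k) ^ n) ∈ valuationRing p k := by
  change spectralNorm ℚ_[p] k _ ≤ 1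
  rw [spectralNorm_p_pow]
  exact pow_le_one₀ (by positivity) (inv_p_lt_one p).le

theorem exists_p_pow_mul_mem (a : k) : ∃ n : ℕ, (p : k) ^ n * a ∈ valuationRing p k := by
  let := spectralNorm.normedField ℚ_[p] k
  have hlim : Filter.Tendsto (fun n : ℕ => ((p : ℝ)⁻¹) ^ n * ‖a‖) Filter.atTop (nhds (0 * ‖a‖)) :=
    (tendsto_pow_atTop_nhds_zero_of_lt_one (by positivity) (inv_p_lt_one p)).mul_const _
  rw [zero_mul] at hlim
  obtain ⟨n, hn⟩ := (hlim.eventually (gt_mem_nhds (zero_lt_one (α := ℝ)))).exists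
  refine ⟨n, ?_⟩
  have h1 : ‖(p : k) ^ n * a‖ = ‖(p : k) ^ n‖ * ‖a‖ := norm_mul _ _
  have h2 : ‖(p : k) ^ n‖ = ((p : ℝ)⁻¹) ^ n := spectralNorm_p_pow p n
  change ‖(p : k) ^ n * a‖ ≤ 1
  rw [h1, h2]
  exact hn.le

end Integers

/-! ### Lattices -/

section Lattices

variable (p : ℕ) [Fact p.Prime]
variable (k : Type*) [Field k] [Algebra ℚ_[p] k] [Algebra.IsAlgebraic ℚ_[p] k]
variable (h : Type*) [LieRing h] [LieAlgebra k h]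

/-- An `𝒪_k`-submodule of the `k`-Lie algebra `h` that is closed under the bracket and generates `h`
over `k`, i.e. the canonical (automatically injective) map from its scalar extension to `h` is
onto.  Together with `LieSpan.IsSeparated` below this is an `𝒪_k`-Lie lattice in `h`. -/
structure LieSpan where
  toSubmodule : Submodule (valuationRing p k) h
  lie_mem : ∀ x ∈ toSubmodule, ∀ y ∈ toSubmodule, ⁅x, y⁆ ∈ toSubmodule
  span_eq_top : Submodule.span k (toSubmodule : Set h) = ⊤

variable {p k h}

namespace LieSpan

/-- `⋂ₙ pⁿ L = 0`.  As `p` is a unit times a power of a uniformiser `π` (when `k / ℚ_p` is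
finite), this is the same as `⋂ₙ πⁿ L = 0`. -/
def IsSeparated (L : LieSpan p k h) : Prop :=
  ∀ x : h, (∀ n : ℕ, ∃ y ∈ L.toSubmodule, (p : k) ^ n • y = x) → x = 0

theorem smul_mem (L : LieSpan p k h) {a : k} (ha : a ∈ valuationRing p k) {x : h}
    (hx : x ∈ L.toSubmodule) : a • x ∈ L.toSubmodule :=
  L.toSubmodule.smul_mem (⟨a, ha⟩ : valuationRing p k) hx

theorem exists_p_pow_smul_mem (L : LieSpan p k h) (x : h) :
    ∃ n : ℕ, (p : k) ^ n • x ∈ L.toSubmodule := by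
  have hx : x ∈ Submodule.span k (L.toSubmodule : Set h) := by
    rw [L.span_eq_top]; exact Submodule.mem_top
  induction hx using Submodule.span_induction with
  | mem x hx => exact ⟨0, by simpa using hx⟩
  | zero => exact ⟨0, by simp⟩
  | add x y _ _ hx hy =>
    obtain ⟨m, hm⟩ := hx
    obtain ⟨n, hn⟩ := hy
    refine ⟨m + n, ?_⟩
    rw [smul_add]
    refine add_mem ?_ ?_
    · rw [add_comm m n, pow_add, mul_smul]
      exact L.smul_mem (p_pow_mem p n) hm
    · rw [pow_add, mul_smul]
      exact L.smul_mem (p_pow_mem p m) hn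
  | smul a x _ hx =>
    obtain ⟨m, hm⟩ := hx
    obtain ⟨n, hn⟩ := exists_p_pow_mul_mem p a
    refine ⟨n + m, ?_⟩
    have e : (p : k) ^ (n + m) • a • x = ((p : k) ^ n * a) • (p : k) ^ m • x := by
      rw [smul_smul, smul_smul]; congr 1; ring
    rw [e]
    exact L.smul_mem hn hm

/-- The rescaled lattice `pᵐ L`. -/
def scale (L : LieSpan p k h) (m : ℕ) : LieSpan p k h where
  toSubmodule :=
    { carrier := {x | ∃ y ∈ L.toSubmodule, (p : k) ^ m • y = x}
      add_mem' := by
        rintro _ _ ⟨x, hx, rfl⟩ ⟨y, hy, rfl⟩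
        exact ⟨x + y, add_mem hx hy, smul_add _ _ _⟩
      zero_mem' := ⟨0, zero_mem _, smul_zero _⟩
      smul_mem' := by
        rintro a _ ⟨x, hx, rfl⟩
        exact ⟨a • x, L.toSubmodule.smul_mem a hx, smul_comm _ _ _⟩ }
  lie_mem := by
    rintro _ ⟨x, hx, rfl⟩ _ ⟨y, hy, rfl⟩
    refine ⟨(p : k) ^ m • ⁅x, y⁆, L.smul_mem (p_pow_mem p m) (L.lie_mem x hx y hy), ?_⟩
    rw [smul_lie, lie_smul]
  span_eq_top := by
    rw [eq_top_iff, ← L.span_eq_top, Submodule.span_le]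
    intro x hx
    have e : x = ((p : k) ^ m)⁻¹ • ((p : k) ^ m • x) :=
      (inv_smul_smul₀ (pow_ne_zero m (p_ne_zero p k)) x).symm
    rw [e]
    exact Submodule.smul_mem _ _ (Submodule.subset_span ⟨x, hx, rfl⟩)

/-- The lattice `B = b ∩ L` in a Lie subalgebra `b` of `h`. -/
def restrict (L : LieSpan p k h) (b : LieSubalgebra k h) : LieSpan p k b where
  toSubmodule :=
    { carrier := {x | (x : h) ∈ L.toSubmodule}
      add_mem' := fun hx hy => add_mem (S := Submodule (valuationRing p k) h) hx hy
      zero_mem' := zero_mem L.toSubmodule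
      smul_mem' := fun a _ hx => L.toSubmodule.smul_mem a hx }
  lie_mem x hx y hy := L.lie_mem x hx y hy
  span_eq_top := by
    rw [eq_top_iff]
    intro x _
    obtain ⟨n, hn⟩ := L.exists_p_pow_smul_mem (x : h)
    have e : x = ((p : k) ^ n)⁻¹ • ((p : k) ^ n • x) :=
      (inv_smul_smul₀ (pow_ne_zero n (p_ne_zero p k)) x).symm
    rw [e]
    exact Submodule.smul_mem _ _ (Submodule.subset_span hn)

variable (F : Type*) [Field F] [Algebra ℚ_[p] F] [Algebra.IsAlgebraic ℚ_[p] F] [Algebra k F]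

/-- The `𝒪_F`-submodule `L ⊗ 𝒪_F` of `F ⊗ h`, for a field extension `F` of `k`. -/
def extendSubmodule (L : LieSpan p k h) : Submodule (valuationRing p F) (F ⊗[k] h) :=
  Submodule.span (valuationRing p F) {z | ∃ x ∈ L.toSubmodule, (1 : F) ⊗ₜ[k] x = z}

/-- The lattice `L_F = L ⊗ 𝒪_F` in the `F`-Lie algebra `h_F = F ⊗ h`. -/
def extend (L : LieSpan p k h) : LieSpan p F (F ⊗[k] h) where
  toSubmodule := L.extendSubmodule F
  lie_mem x hx y hy := by
    induction hx using Submodule.span_induction with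
    | zero => rw [zero_lie]; exact zero_mem _
    | add a b _ _ ha hb => rw [add_lie]; exact add_mem ha hb
    | smul a x _ hx =>
      have e : ⁅a • x, y⁆ = a • ⁅x, y⁆ := smul_lie (a : F) x y
      rw [e]; exact Submodule.smul_mem _ _ hx
    | mem x hx =>
      obtain ⟨x, hx, rfl⟩ := hx
      induction hy using Submodule.span_induction with
      | zero => rw [lie_zero]; exact zero_mem _
      | add a b _ _ ha hb => rw [lie_add]; exact add_mem ha hb
      | smul a y _ hy =>
        have e : ⁅(1 : F) ⊗ₜ[k] x, a • y⁆ = a • ⁅(1 : F) ⊗ₜ[k] x, y⁆ := lie_smul (a : F) _ y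
        rw [e]; exact Submodule.smul_mem _ _ hy
      | mem y hy =>
        obtain ⟨y, hy, rfl⟩ := hy
        rw [LieAlgebra.ExtendScalars.bracket_tmul, one_mul]
        exact Submodule.subset_span ⟨_, L.lie_mem x hx y hy, rfl⟩
  span_eq_top := by
    rw [eq_top_iff]
    intro z _
    induction z using TensorProduct.induction_on with
    | zero => exact zero_mem _
    | add a b ha hb => exact add_mem (ha trivial) (hb trivial)
    | tmul a x =>
      obtain ⟨n, hn⟩ := L.exists_p_pow_smul_mem x
      have hp : algebraMap k F ((p : k) ^ n) = (p : F) ^ n := by simp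
      have e : a ⊗ₜ[k] x = (a * ((p : F) ^ n)⁻¹) • ((1 : F) ⊗ₜ[k] ((p : k) ^ n • x)) := by
        rw [← TensorProduct.smul_tmul, TensorProduct.smul_tmul', smul_eq_mul, Algebra.smul_def, hp,
          mul_one, inv_mul_cancel_right₀ (pow_ne_zero n (p_ne_zero p F))]
      rw [e]
      exact Submodule.smul_mem _ _ (Submodule.subset_span (Submodule.subset_span ⟨_, hn, rfl⟩))

end LieSpan

end Lattices

/-! ### The affinoid enveloping algebra -/

section Envelope

attribute [local instance 100] LieRing.ofAssociativeRing

variable {p : ℕ} [Fact p.Prime]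
variable {k : Type*} [Field k] [Algebra ℚ_[p] k] [Algebra.IsAlgebraic ℚ_[p] k]
variable {h : Type*} [LieRing h] [LieAlgebra k h]

/-- The lattice `U(L)` in `U(h)`: the `𝒪_k`-subalgebra generated by `L` (the image of the enveloping
algebra of the `𝒪_k`-Lie algebra `L` in `U(h)`). -/
def envLattice (L : LieSpan p k h) :
    Subalgebra (valuationRing p k) (UniversalEnvelopingAlgebra k h) :=
  Algebra.adjoin (valuationRing p k) (UniversalEnvelopingAlgebra.ι k '' (L.toSubmodule : Set h))

/-- The additive subgroup `pⁿ U(L)` of `U(h)`. -/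
def envBall (L : LieSpan p k h) (n : ℕ) : AddSubgroup (UniversalEnvelopingAlgebra k h) :=
  (envLattice L).toSubring.toAddSubgroup.map (nsmulAddMonoidHom (p ^ n))

theorem mem_envBall {L : LieSpan p k h} {n : ℕ} {x : UniversalEnvelopingAlgebra k h} :
    x ∈ envBall L n ↔ ∃ y ∈ envLattice L, (p ^ n) • y = x := Iff.rfl

theorem envBall_anti (L : LieSpan p k h) {m n : ℕ} (hmn : m ≤ n) : envBall L n ≤ envBall L m := by
  rintro _ ⟨y, hy, rfl⟩
  refine ⟨(p ^ (n - m)) • y, (envLattice L).toSubring.nsmul_mem hy _, ?_⟩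
  change p ^ m • p ^ (n - m) • y = p ^ n • y
  rw [smul_smul, ← pow_add, Nat.add_sub_cancel' hmn]

theorem exists_p_pow_nsmul_mem_envLattice (L : LieSpan p k h)
    (x : UniversalEnvelopingAlgebra k h) : ∃ n : ℕ, (p ^ n) • x ∈ envLattice L := by
  have hx : x ∈ Algebra.adjoin k
      (Set.range (UniversalEnvelopingAlgebra.ι k : h → UniversalEnvelopingAlgebra k h)) := by
    let S := Algebra.adjoin k
      (Set.range (UniversalEnvelopingAlgebra.ι k : h → UniversalEnvelopingAlgebra k h))
    let f : h →ₗ⁅k⁆ S :=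
      { toFun := fun y => ⟨UniversalEnvelopingAlgebra.ι k y, Algebra.subset_adjoin ⟨y, rfl⟩⟩
        map_add' := fun a b => Subtype.ext (map_add _ a b)
        map_smul' := fun c a => Subtype.ext (map_smul _ c a)
        map_lie' := fun {a b} => Subtype.ext (LieHom.map_lie _ a b) }
    have e : S.val.comp (UniversalEnvelopingAlgebra.lift k f) = AlgHom.id k _ := by
      apply UniversalEnvelopingAlgebra.hom_ext
      ext y
      simp [f]
    have e' := DFunLike.congr_fun e x
    rw [AlgHom.id_apply] at e'
    rw [← e']
    exact (UniversalEnvelopingAlgebra.lift k f x).2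
  have key : ∀ (n : ℕ) (a : k) (y : UniversalEnvelopingAlgebra k h),
      (p ^ n) • (a • y) = ((p : k) ^ n * a) • y := by
    intro n a y
    rw [mul_smul, ← Nat.cast_pow, Nat.cast_smul_eq_nsmul]
  induction hx using Algebra.adjoin_induction with
  | mem x hx =>
    obtain ⟨y, rfl⟩ := hx
    obtain ⟨n, hn⟩ := L.exists_p_pow_smul_mem y
    refine ⟨n, ?_⟩
    have e : (p ^ n) • UniversalEnvelopingAlgebra.ι k y
        = UniversalEnvelopingAlgebra.ι k ((p : k) ^ n • y) := by
      rw [← Nat.cast_pow, Nat.cast_smul_eq_nsmul, map_nsmul]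
    rw [e]
    exact Algebra.subset_adjoin ⟨_, hn, rfl⟩
  | algebraMap a =>
    obtain ⟨n, hn⟩ := exists_p_pow_mul_mem p a
    refine ⟨n, ?_⟩
    rw [Algebra.algebraMap_eq_smul_one, key]
    rw [← Algebra.algebraMap_eq_smul_one]
    exact (envLattice L).algebraMap_mem ⟨_, hn⟩
  | add x y _ _ hx hy =>
    obtain ⟨m, hm⟩ := hx
    obtain ⟨n, hn⟩ := hy
    refine ⟨m + n, ?_⟩
    rw [smul_add]
    refine add_mem ?_ ?_
    · rw [add_comm m n, pow_add, mul_smul]; exact nsmul_mem hm _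
    · rw [pow_add, mul_smul]; exact nsmul_mem hn _
  | mul x y _ _ hx hy =>
    obtain ⟨m, hm⟩ := hx
    obtain ⟨n, hn⟩ := hy
    refine ⟨m + n, ?_⟩
    have e : (p ^ (m + n)) • (x * y) = ((p ^ m) • x) * ((p ^ n) • y) := by
      rw [smul_mul_smul_comm, ← pow_add]
    rw [e]
    exact mul_mem hm hn

theorem envBall_basis (L : LieSpan p k h) : RingSubgroupsBasis (envBall L) where
  inter i j := ⟨max i j, le_inf (envBall_anti L (le_max_left i j)) (envBall_anti L (le_max_right i j))⟩
  mul i := by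
    refine ⟨i, ?_⟩
    rintro _ ⟨_, ⟨x, hx, rfl⟩, _, ⟨y, hy, rfl⟩, rfl⟩
    refine ⟨x * ((p ^ i) • y),
      (envLattice L).mul_mem hx ((envLattice L).toSubring.nsmul_mem hy _), ?_⟩
    change (p ^ i) • (x * (p ^ i) • y) = ((p ^ i) • x) * ((p ^ i) • y)
    rw [smul_mul_assoc]
  leftMul x i := by
    obtain ⟨m, hm⟩ := exists_p_pow_nsmul_mem_envLattice L x
    refine ⟨i + m, ?_⟩
    rintro _ ⟨y, hy, rfl⟩
    refine ⟨((p ^ m) • x) * y, (envLattice L).mul_mem hm hy, ?_⟩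
    change (p ^ i) • (((p ^ m) • x) * y) = x * ((p ^ (i + m)) • y)
    rw [smul_mul_assoc, smul_smul, mul_smul_comm, pow_add]
  rightMul x i := by
    obtain ⟨m, hm⟩ := exists_p_pow_nsmul_mem_envLattice L x
    refine ⟨i + m, ?_⟩
    rintro _ ⟨y, hy, rfl⟩
    refine ⟨y * ((p ^ m) • x), (envLattice L).mul_mem hy hm, ?_⟩
    change (p ^ i) • (y * ((p ^ m) • x)) = ((p ^ (i + m)) • y) * x
    rw [mul_smul_comm, smul_smul, smul_mul_assoc, pow_add]

/-- The algebra `U(h)`, as a topological ring whose neighbourhoods of zero are the `pⁿ U(L)`.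
Since `p` is a unit times a power of a uniformiser `π` (when `k / ℚ_p` is finite), this is the
`π`-adic filtration topology associated to the lattice `U(L)`. -/
def EnvTop (_L : LieSpan p k h) : Type _ := UniversalEnvelopingAlgebra k h

instance (L : LieSpan p k h) : Ring (EnvTop L) :=
  inferInstanceAs (Ring (UniversalEnvelopingAlgebra k h))

instance (L : LieSpan p k h) : TopologicalSpace (EnvTop L) := (envBall_basis L).topology

instance (L : LieSpan p k h) : IsTopologicalRing (EnvTop L) :=
  (envBall_basis L).toRingFilterBasis.isTopologicalRing

instance (L : LieSpan p k h) : UniformSpace (EnvTop L) :=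
  IsTopologicalAddGroup.rightUniformSpace (EnvTop L)

instance (L : LieSpan p k h) : IsUniformAddGroup (EnvTop L) :=
  isUniformAddGroup_of_addCommGroup

/-- The affinoid enveloping algebra of `L` with coefficients in `k`: the completion of `U(h)` with
respect to the `π`-adic filtration associated to `U(L)`. -/
abbrev AffinoidEnvelope (L : LieSpan p k h) : Type _ := UniformSpace.Completion (EnvTop L)

/-- A ring homomorphism from `U(h)` is continuous for the topology given by `L` as soon as every
neighbourhood of zero contains the image of some `pⁿ U(L)`. -/
theorem continuous_of_envBall (L : LieSpan p k h) {R : Type*} [Ring R] [TopologicalSpace R]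
    [IsTopologicalRing R] (f : EnvTop L →+* R)
    (hf : ∀ V ∈ nhds (0 : R), ∃ n : ℕ, ∀ x ∈ envBall L n, f x ∈ V) : Continuous f := by
  refine continuous_of_continuousAt_zero f ?_
  intro V hV
  rw [map_zero] at hV
  obtain ⟨n, hn⟩ := hf V hV
  exact Filter.mem_map.2 (((envBall_basis L).hasBasis_nhds_zero.mem_iff).2 ⟨n, trivial, hn⟩)

theorem continuous_of_envLattice {k' : Type*} [Field k'] [Algebra ℚ_[p] k']
    [Algebra.IsAlgebraic ℚ_[p] k'] {h' : Type*} [LieRing h'] [LieAlgebra k' h']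
    (L : LieSpan p k h) (L' : LieSpan p k' h') (f : EnvTop L →+* EnvTop L')
    (hf : ∀ x : UniversalEnvelopingAlgebra k h, x ∈ envLattice L →
      (f x : UniversalEnvelopingAlgebra k' h') ∈ envLattice L') : Continuous f := by
  refine continuous_of_envBall L f ?_
  intro V hV
  obtain ⟨n, -, hn⟩ := ((envBall_basis L').hasBasis_nhds_zero.mem_iff).1 hV
  refine ⟨n, ?_⟩
  rintro _ ⟨y, hy, rfl⟩
  refine hn ⟨f y, hf y hy, ?_⟩
  exact (map_nsmul f (p ^ n) y).symm

/-- The canonical map from the affinoid envelope of `pᵐ L` to that of `L`, the continuous extension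
of the identity of `U(h)`. -/
def deformationMap (L : LieSpan p k h) (m : ℕ) :
    AffinoidEnvelope (L.scale m) →+* AffinoidEnvelope L :=
  UniformSpace.Completion.mapRingHom
    (α := EnvTop (L.scale m)) (β := EnvTop L) (RingHom.id (UniversalEnvelopingAlgebra k h))
    (continuous_of_envLattice (L.scale m) L _ (by
      intro x hx
      have hle : envLattice (L.scale m) ≤ envLattice L := by
        refine Algebra.adjoin_mono ?_
        rintro _ ⟨_, ⟨y, hy, rfl⟩, rfl⟩
        exact ⟨_, L.smul_mem (p_pow_mem p m) hy, rfl⟩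
      exact hle hx))

/-- The map `U(b) → U(h)` induced by the inclusion of a Lie subalgebra `b` of `h`. -/
def envIncl (b : LieSubalgebra k h) :
    UniversalEnvelopingAlgebra k b →ₐ[k] UniversalEnvelopingAlgebra k h :=
  UniversalEnvelopingAlgebra.lift k ((UniversalEnvelopingAlgebra.ι k).comp b.incl)

theorem envIncl_mem (L : LieSpan p k h) (b : LieSubalgebra k h)
    (x : UniversalEnvelopingAlgebra k b) (hx : x ∈ envLattice (L.restrict b)) :
    envIncl b x ∈ envLattice L := by
  induction hx using Algebra.adjoin_induction with
  | mem x hx =>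
    obtain ⟨y, hy, rfl⟩ := hx
    have e : envIncl b (UniversalEnvelopingAlgebra.ι k y)
        = UniversalEnvelopingAlgebra.ι k (y : h) := by simp [envIncl]
    rw [e]
    exact Algebra.subset_adjoin ⟨_, hy, rfl⟩
  | algebraMap a =>
    have e : envIncl b (algebraMap (valuationRing p k) _ a)
        = algebraMap (valuationRing p k) _ a := (envIncl b).commutes (a : k)
    rw [e]
    exact (envLattice L).algebraMap_mem a
  | add x y _ _ hx hy => rw [map_add]; exact add_mem hx hy
  | mul x y _ _ hx hy => rw [map_mul]; exact mul_mem hx hy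

/-- For a Lie subalgebra `b` of `h` and `B = b ∩ L`, the canonical map from the affinoid envelope of
`B` to that of `L`. -/
def subalgebraMap (L : LieSpan p k h) (b : LieSubalgebra k h) :
    AffinoidEnvelope (L.restrict b) →+* AffinoidEnvelope L :=
  UniformSpace.Completion.mapRingHom
    (α := EnvTop (L.restrict b)) (β := EnvTop L) (envIncl b).toRingHom
    (continuous_of_envLattice (L.restrict b) L _ (envIncl_mem L b))

section BaseChange

variable (F : Type*) [Field F] [Algebra ℚ_[p] F] [Algebra.IsAlgebraic ℚ_[p] F] [Algebra k F]

/-- `U(F ⊗ h)` as a `k`-algebra. -/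
abbrev extendAlgebra (k F h : Type*) [Field k] [Field F] [Algebra k F] [LieRing h]
    [LieAlgebra k h] : Algebra k (UniversalEnvelopingAlgebra F (F ⊗[k] h)) :=
  ((algebraMap F (UniversalEnvelopingAlgebra F (F ⊗[k] h))).comp (algebraMap k F)).toAlgebra'
    (fun c x => Algebra.commutes (algebraMap k F c) x)

/-- The `k`-algebra homomorphism `U(h) → U(F ⊗ h)` sending `x ∈ h` to `1 ⊗ x`. -/
def envExtendAlgHom (k F h : Type*) [Field k] [Field F] [Algebra k F] [LieRing h]
    [LieAlgebra k h] :
    letI := extendAlgebra k F h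
    UniversalEnvelopingAlgebra k h →ₐ[k] UniversalEnvelopingAlgebra F (F ⊗[k] h) :=
  letI := extendAlgebra k F h
  UniversalEnvelopingAlgebra.lift k
    { toFun := fun x => UniversalEnvelopingAlgebra.ι F ((1 : F) ⊗ₜ[k] x)
      map_add' := fun x y => by rw [TensorProduct.tmul_add, map_add]
      map_smul' := fun c x => by
        rw [TensorProduct.tmul_smul, ← algebraMap_smul F c ((1 : F) ⊗ₜ[k] x), map_smul,
          Algebra.smul_def]
        exact (Algebra.smul_def c _).symm
      map_lie' := fun {x y} => by
        rw [← LieHom.map_lie, LieAlgebra.ExtendScalars.bracket_tmul, one_mul] }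

/-- The homomorphism `envExtendAlgHom`, as a ring homomorphism. -/
def envExtend (h : Type*) [LieRing h] [LieAlgebra k h] :
    UniversalEnvelopingAlgebra k h →+* UniversalEnvelopingAlgebra F (F ⊗[k] h) :=
  letI := extendAlgebra k F h
  (envExtendAlgHom k F h).toRingHom

theorem envExtend_ι (x : h) :
    envExtend F h (UniversalEnvelopingAlgebra.ι k x)
      = UniversalEnvelopingAlgebra.ι F ((1 : F) ⊗ₜ[k] x) := by
  let := extendAlgebra k F h
  exact UniversalEnvelopingAlgebra.lift_ι_apply' k _ x

theorem envExtend_algebraMap (a : k) :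
    envExtend F h (algebraMap k (UniversalEnvelopingAlgebra k h) a)
      = algebraMap F _ (algebraMap k F a) := by
  let := extendAlgebra k F h
  exact AlgHom.commutes (envExtendAlgHom k F h) a

variable [IsScalarTower ℚ_[p] k F]

theorem algebraMap_mem_valuationRing {a : k} (ha : a ∈ valuationRing p k) :
    algebraMap k F a ∈ valuationRing p F := by
  change spectralNorm ℚ_[p] F (algebraMap k F a) ≤ 1
  rw [← spectralNorm.eq_of_tower]
  exact ha

theorem envExtend_mem (L : LieSpan p k h) (x : UniversalEnvelopingAlgebra k h)
    (hx : x ∈ envLattice L) : envExtend F h x ∈ envLattice (L.extend F) := by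
  induction hx using Algebra.adjoin_induction with
  | mem x hx =>
    obtain ⟨y, hy, rfl⟩ := hx
    rw [envExtend_ι]
    exact Algebra.subset_adjoin ⟨_, Submodule.subset_span ⟨y, hy, rfl⟩, rfl⟩
  | algebraMap a =>
    have e : envExtend F h (algebraMap (valuationRing p k) _ a)
        = algebraMap (valuationRing p F) _ ⟨_, algebraMap_mem_valuationRing F a.2⟩ :=
      envExtend_algebraMap F (a : k)
    rw [e]
    exact (envLattice (L.extend F)).algebraMap_mem _
  | add x y _ _ hx hy => rw [map_add]; exact add_mem hx hy
  | mul x y _ _ hx hy => rw [map_mul]; exact mul_mem hx hy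

/-- The canonical map from the affinoid envelope of `L` (with coefficients in `k`) to the affinoid
envelope of `L_F = L ⊗ 𝒪_F` (with coefficients in `F`). -/
def extendMap (L : LieSpan p k h) : AffinoidEnvelope L →+* AffinoidEnvelope (L.extend F) :=
  UniformSpace.Completion.mapRingHom
    (α := EnvTop L) (β := EnvTop (L.extend F)) (envExtend F h)
    (continuous_of_envLattice L (L.extend F) _ (envExtend_mem F L))

end BaseChange

end Envelope

/-! ### Induced modules -/

section Induced

variable {A B : Type*} [Ring A] [Ring B]

/-- The submodule of `A ⊗_ℤ M` generated by all `(a φ(b)) ⊗ m - a ⊗ (b m)`. -/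
def balancing (φ : B →+* A) (M : Type*) [AddCommGroup M] [Module B M] : Submodule A (A ⊗[ℤ] M) :=
  Submodule.span A {z | ∃ (a : A) (b : B) (m : M),
    z = (a * φ b) ⊗ₜ[ℤ] m - a ⊗ₜ[ℤ] (b • m)}

/-- The induced left `A`-module `A ⊗_B M`, for a homomorphism `φ : B → A` of (not necessarily
commutative) rings, by which `A` is a right `B`-module, and a left `B`-module `M`. -/
abbrev Induced (φ : B →+* A) (M : Type*) [AddCommGroup M] [Module B M] : Type _ :=
  (A ⊗[ℤ] M) ⧸ balancing φ M

/-- The one-dimensional module on which the ring `B` acts through a homomorphism `χ` to a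
field `k`. -/
def CharModule {k : Type*} [Field k] (_χ : B →+* k) : Type _ := k

instance {k : Type*} [Field k] (χ : B →+* k) : AddCommGroup (CharModule χ) :=
  inferInstanceAs (AddCommGroup k)

instance {k : Type*} [Field k] (χ : B →+* k) : Module B (CharModule χ) :=
  Module.compHom k χ

end Induced

/-! ### Polarisations and affinoid Dixmier modules -/

section Dixmier

/-- `b` is a polarisation of `h` at the linear form `f`: it is a solvable subalgebra, and
`f [u, b] = 0` if and only if `u ∈ b`. -/
def IsPolarisation {k h : Type*} [Field k] [LieRing h] [LieAlgebra k h] (f : h →ₗ[k] k)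
    (b : LieSubalgebra k h) : Prop :=
  LieAlgebra.IsSolvable b ∧ ∀ u : h, (∀ v ∈ b, f ⁅u, v⁆ = 0) ↔ u ∈ b

attribute [local instance 100] LieRing.ofAssociativeRing

variable {p : ℕ} [Fact p.Prime]
variable {k : Type*} [Field k] [Algebra ℚ_[p] k]
variable {h : Type*} [LieRing h] [LieAlgebra k h]

/-- The character `U(b) → k` that extends the restriction of `f` to a polarisation `b` at `f`. -/
def envChar {f : h →ₗ[k] k} {b : LieSubalgebra k h} (hb : IsPolarisation f b) :
    UniversalEnvelopingAlgebra k b →ₐ[k] k :=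
  UniversalEnvelopingAlgebra.lift k
    { f.comp b.toSubmodule.subtype with
      map_lie' := fun {x y} => by
        have h1 : f ⁅(x : h), (y : h)⁆ = 0 := (hb.2 x).2 x.2 y y.2
        have h2 : ⁅f (x : h), f (y : h)⁆ = 0 := by
          rw [LieRing.of_associative_ring_bracket, mul_comm, sub_self]
        exact h1.trans h2.symm }

theorem envChar_ι {f : h →ₗ[k] k} {b : LieSubalgebra k h} (hb : IsPolarisation f b) (x : b) :
    envChar hb (UniversalEnvelopingAlgebra.ι k x) = f x :=
  UniversalEnvelopingAlgebra.lift_ι_apply' k _ x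

theorem envChar_mem [Algebra.IsAlgebraic ℚ_[p] k] (L : LieSpan p k h) {f : h →ₗ[k] k}
    (hf : ∀ x ∈ L.toSubmodule, f x ∈ valuationRing p k) {b : LieSubalgebra k h}
    (hb : IsPolarisation f b) (x : UniversalEnvelopingAlgebra k b)
    (hx : x ∈ envLattice (L.restrict b)) : envChar hb x ∈ valuationRing p k := by
  induction hx using Algebra.adjoin_induction with
  | mem x hx =>
    obtain ⟨y, hy, rfl⟩ := hx
    rw [envChar_ι]
    exact hf _ hy
  | algebraMap a =>
    have e : envChar hb (algebraMap (valuationRing p k) _ a) = (a : k) :=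
      (envChar hb).commutes (a : k)
    rw [e]
    exact a.2
  | add x y _ _ hx hy => rw [map_add]; exact add_mem hx hy
  | mul x y _ _ hx hy => rw [map_mul]; exact mul_mem hx hy

variable [FiniteDimensional ℚ_[p] k]

/-- The continuous extension to the affinoid envelope of `B = b ∩ L` of the character of `U(b)`
given by `f`, where `f(L) ⊆ 𝒪_k` and `b` is a polarisation at `f`. -/
def affinoidChar (L : LieSpan p k h) {f : h →ₗ[k] k}
    (hf : ∀ x ∈ L.toSubmodule, f x ∈ valuationRing p k) {b : LieSubalgebra k h}
    (hb : IsPolarisation f b) : AffinoidEnvelope (L.restrict b) →+* k :=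
  letI := spectralNorm.normedField ℚ_[p] k
  haveI : CompleteSpace k := spectralNorm.completeSpace ℚ_[p] k
  UniformSpace.Completion.extensionHom (α := EnvTop (L.restrict b)) (β := k)
    (envChar hb : UniversalEnvelopingAlgebra k b →+* k)
    (continuous_of_envBall (L.restrict b) _ (by
      intro V hV
      obtain ⟨ε, hε, hV⟩ := Metric.mem_nhds_iff.1 hV
      obtain ⟨n, hn⟩ := exists_pow_lt_of_lt_one hε (inv_p_lt_one p)
      refine ⟨n, ?_⟩
      rintro _ ⟨y, hy, rfl⟩
      refine hV ?_
      have e : (envChar hb : UniversalEnvelopingAlgebra k b →+* k) ((p ^ n) • y)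
          = (p : k) ^ n * envChar hb y := by
        change envChar hb ((p ^ n) • y) = _
        rw [map_nsmul, nsmul_eq_mul, Nat.cast_pow]
      have h1 : ‖envChar hb y‖ ≤ 1 := envChar_mem L hf hb y hy
      have h2 : ‖(p : k) ^ n‖ = ((p : ℝ)⁻¹) ^ n := spectralNorm_p_pow p n
      have h3 : ‖(p : k) ^ n * envChar hb y‖ < ε := by
        rw [norm_mul, h2]
        exact (mul_le_of_le_one_right (by positivity) h1).trans_lt hn
      rw [mem_ball_zero_iff]
      change ‖(envChar hb : UniversalEnvelopingAlgebra k b →+* k) ((p ^ n) • y)‖ < ε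
      rw [e]
      exact h3))

/-- The affinoid Dixmier module of `L` at `f` with respect to the polarisation `b`: with
`B = b ∩ L`, it is induced from the affinoid envelope of `B` to that of `L`, from the
one-dimensional module `k_f`. -/
abbrev DixmierModule (L : LieSpan p k h) {f : h →ₗ[k] k}
    (hf : ∀ x ∈ L.toSubmodule, f x ∈ valuationRing p k) {b : LieSubalgebra k h}
    (hb : IsPolarisation f b) : Type _ :=
  Induced (subalgebraMap L b) (CharModule (affinoidChar L hf hb))

end Dixmier

/-! ### Dixmier annihilators -/

section Annihilator

variable {p : ℕ} [Fact p.Prime]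
variable {K : Type*} [Field K] [Algebra ℚ_[p] K] [FiniteDimensional ℚ_[p] K]
variable {g : Type*} [LieRing g] [LieAlgebra K g]

instance : Algebra.IsAlgebraic ℚ_[p] (AlgebraicClosure K) :=
  Algebra.IsAlgebraic.trans ℚ_[p] K (AlgebraicClosure K)

/-- `I` is the Dixmier annihilator `I(lam)` in the affinoid envelope of `L` with coefficients in `K`,
computed over some finite extension `F` of `K` (inside the algebraic closure) in which the linear
form `lam` takes its values, and with some polarisation `b` of `g_F` at the `F`-linear extension of
`lam`: the elements that act as zero on the affinoid Dixmier module over `F`. -/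
def IsDixmierAnnihilator (L : LieSpan p K g) (lam : g →ₗ[K] AlgebraicClosure K)
    (I : Ideal (AffinoidEnvelope L)) : Prop :=
  ∃ (F : IntermediateField K (AlgebraicClosure K)) (_ : FiniteDimensional K F),
    haveI : FiniteDimensional ℚ_[p] F := FiniteDimensional.trans ℚ_[p] K F
    ∃ (f : g →ₗ[K] F) (_ : ∀ x : g, (f x : AlgebraicClosure K) = lam x)
      (hf : ∀ x ∈ (L.extend F).toSubmodule, f.liftBaseChange F x ∈ valuationRing p F)
      (b : LieSubalgebra F (F ⊗[K] g)) (hb : IsPolarisation (f.liftBaseChange F) b),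
      I = (Module.annihilator (AffinoidEnvelope (L.extend F))
        (DixmierModule (L.extend F) hf hb)).comap (extendMap F L)

end Annihilator

/-! ### The coadjoint action -/

section Coadjoint

/-- `exp(ad u) = ∑ (1 / i!) ad(u)ⁱ`, for `u` such that `ad u` is nilpotent (the omitted terms of the
series vanish). -/
def expAd (k : Type*) {h : Type*} [Field k] [LieRing h] [LieAlgebra k h] (u : h) : Module.End k h :=
  ∑ i ∈ Finset.range (nilpotencyClass (LieAlgebra.ad k h u)),
    ((i.factorial : k)⁻¹) • (LieAlgebra.ad k h u) ^ i

/-- `f' = exp(ad u) · f` for the coadjoint action `(σ · f)(x) = f (σ⁻¹ x)`: as `σ = exp(ad u)` is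
bijective, this says that `f' (σ x) = f x` for all `x`. -/
def IsCoadjointConj (k : Type*) {h : Type*} [Field k] [LieRing h] [LieAlgebra k h] (u : h) (f f' : h →ₗ[k] k) : Prop :=
  ∀ x : h, f' (expAd k u x) = f x

end Coadjoint

end AffinoidDixmier

end

open AffinoidDixmier

open scoped TensorProduct

noncomputable section

namespace AffinoidDixmier

/-! ### Enveloping algebras: functoriality, derivations, one-step PBW -/

section EnvelopingAlgebra

attribute [local instance 100] LieRing.ofAssociativeRing

open UniversalEnvelopingAlgebra (ι lift)

variable {k : Type*} [Field k]
variable {s h h' : Type*} [LieRing s] [LieAlgebra k s] [LieRing h] [LieAlgebra k h]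
  [LieRing h'] [LieAlgebra k h']

/-! Put `σ = exp(ad u)`, so that `μ ∘ σ = λ` over the algebraic closure. If `b` is a polarisation at
`λ`, then `σ(b)` is one at `μ`, and `σ` identifies the two induced modules up to a twist by `σ`. In
`U` itself `σ(w) = ∑ ad(u)ⁱ(w) / i!` is a sum of combinations of the `uʳ w uˢ`, so a two-sided ideal
is stable under `σ`, and the annihilators would agree outright. The obstruction is analytic: `σ`
does not preserve `U(L)`. But with `q = pⁿ` and `n ≥ Nc + v_p(c!)` every `q ad(u)ⁱ / i!` maps the
lattice to itself, hence `σ` and `σ⁻¹` map `U(q q' L)` into `U(q' L)`. The argument applies this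
twice, once to `σ⁻¹` of the given element and once to a functional composed with `σ`; this is why
the deformation `p²ⁿ L` occurs.

Annihilation is tested by functionals. An element is represented by a Cauchy filter on `U(h)`, and
`Kill` says that for every functional `φ` which factors through the induced module and is bounded on
the lattice, the values `φ(x a)` tend to zero for all `a`. This makes sense over the algebraic
closure, which is not complete. Over a finite extension of `ℚ_p`, `Kill` is the same as annihilating
the affinoid Dixmier module (`mem_annihilator_iff_kill`), and it is insensitive to extension of
scalars (`LieBaseChange.kill_extendSub_iff`), so `λ`, `μ` and `u` can be compared over one field.

The main tool is a basis of `U(h)` over `U(b)` made of ordered monomials `tᵢ`, adapted to all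
lattices `U(q M)` at the same time (`exists_relBasis`). It is built through a chain of subalgebras,
each an ideal of codimension one in the next, which exists because `h` is nilpotent. The dual
functionals satisfy `φᵢ(U(q M)) ⊆ q^deg(i) O`, while `q^deg(i) tᵢ ∈ U(q M)`. So in `φ(w) = ∑ φᵢ(w)
φ(tᵢ)` the powers of `q` cancel, and the terms are bounded uniformly in `i` as soon as `φ` is
bounded on `U(q M)`. Consequently it is enough to test the `φᵢ`, even for functionals bounded only
on a smaller lattice (`DualBasis.null`).

Independence of the polarisation (`IsPolIn.kill_imp`) follows by induction on dimension from the
case of two polarisations `d + k x` and `d + k y` with `f [x, y] ≠ 0`. There `x - f(x)` and `y` act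
like a Weyl algebra, and functionals on the module induced from `d` are reduced to those induced
from `d + k x` by an explicit triangular correction (`Kill.of_codimOne`).

`Kill.conj` combines these facts. The finiteness needed throughout comes from `fg_of_separated`: a
separated lattice is finitely generated. After that only the valuation property of `O` is used to
produce adapted bases, so the valuation ring of the algebraic closure is allowed although it is not
noetherian. -/

variable (k) in
theorem env_adjoin_ι (h : Type*) [LieRing h] [LieAlgebra k h] :
    Algebra.adjoin k (Set.range (ι k : h → UniversalEnvelopingAlgebra k h)) = ⊤ := by
  let S := Algebra.adjoin k (Set.range (ι k : h → UniversalEnvelopingAlgebra k h))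
  let f : h →ₗ⁅k⁆ S :=
    { toFun := fun y => ⟨ι k y, Algebra.subset_adjoin ⟨y, rfl⟩⟩
      map_add' := fun a b => Subtype.ext (map_add _ a b)
      map_smul' := fun c a => Subtype.ext (map_smul _ c a)
      map_lie' := fun {a b} => Subtype.ext (LieHom.map_lie _ a b) }
  have e : S.val.comp (lift k f) = AlgHom.id k _ := by
    apply UniversalEnvelopingAlgebra.hom_ext
    ext y
    simp [f]
  rw [eq_top_iff]
  intro x _
  have e' := DFunLike.congr_fun e x
  rw [AlgHom.id_apply] at e'
  rw [← e']
  exact (lift k f x).2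

theorem lift_ι {A : Type*} [Ring A] [Algebra k A] (f : h →ₗ⁅k⁆ A) (y : h) :
    lift k f (ι k y) = f y :=
  UniversalEnvelopingAlgebra.lift_ι_apply k f y

theorem env_induction {P : UniversalEnvelopingAlgebra k h → Prop}
    (hι : ∀ y, P (ι k y)) (hc : ∀ c, P (algebraMap k _ c))
    (hadd : ∀ v w, P v → P w → P (v + w)) (hmul : ∀ v w, P v → P w → P (v * w))
    (v : UniversalEnvelopingAlgebra k h) : P v := by
  have hv : v ∈ Algebra.adjoin k (Set.range (ι k : h → UniversalEnvelopingAlgebra k h)) := by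
    rw [env_adjoin_ι]; exact Algebra.mem_top
  induction hv using Algebra.adjoin_induction with
  | mem x hx => obtain ⟨y, rfl⟩ := hx; exact hι y
  | algebraMap r => exact hc r
  | add x y _ _ hx hy => exact hadd _ _ hx hy
  | mul x y _ _ hx hy => exact hmul _ _ hx hy

/-- The homomorphism of enveloping algebras induced by a homomorphism of Lie algebras. -/
def envMap (j : s →ₗ⁅k⁆ h) : UniversalEnvelopingAlgebra k s →ₐ[k] UniversalEnvelopingAlgebra k h :=
  lift k ((ι k).comp j)

@[simp]
theorem envMap_ι (j : s →ₗ⁅k⁆ h) (a : s) : envMap j (ι k a) = ι k (j a) :=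
  lift_ι _ a

theorem envMap_comp (i : h →ₗ⁅k⁆ h') (j : s →ₗ⁅k⁆ h) (v : UniversalEnvelopingAlgebra k s) :
    envMap (i.comp j) v = envMap i (envMap j v) := by
  have e : envMap (i.comp j) = (envMap i).comp (envMap j) := by
    apply UniversalEnvelopingAlgebra.hom_ext
    ext a
    change envMap (i.comp j) (ι k a) = envMap i (envMap j (ι k a))
    rw [envMap_ι, envMap_ι, envMap_ι]; rfl
  rw [e]; rfl

/-- The Lie algebra homomorphism `a ↦ a + D(a) ε` to the dual numbers. -/
def dualNumberHom (D : LieDerivation k s s) :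
    s →ₗ⁅k⁆ DualNumber (UniversalEnvelopingAlgebra k s) where
  toFun a := TrivSqZeroExt.inl (ι k a) + TrivSqZeroExt.inr (ι k (D a))
  map_add' a b := by ext <;> simp
  map_smul' c a := by ext <;> simp
  map_lie' {a b} := by
    ext
    · simp [LieRing.of_associative_ring_bracket]
    · simp only [LieDerivation.apply_lie_eq_sub, map_sub, LieHom.map_lie,
        LieRing.of_associative_ring_bracket, TrivSqZeroExt.snd_add, TrivSqZeroExt.snd_inl,
        TrivSqZeroExt.snd_inr, TrivSqZeroExt.snd_sub, TrivSqZeroExt.snd_mul, TrivSqZeroExt.fst_add,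
        TrivSqZeroExt.fst_inl, TrivSqZeroExt.fst_inr, smul_eq_mul, MulOpposite.smul_eq_mul_unop,
        MulOpposite.unop_op]
      noncomm_ring

/-- The derivation of `U(s)` that extends a derivation of `s`. -/
def envDer (D : LieDerivation k s s) :
    UniversalEnvelopingAlgebra k s →ₗ[k] UniversalEnvelopingAlgebra k s :=
  (TrivSqZeroExt.sndHom _ _).restrictScalars k ∘ₗ (lift k (dualNumberHom D)).toLinearMap

/-- The extended homomorphism has the form `v ↦ v + D(v) ε`; once its first component is known to be
`v`, multiplicativity of the second component is the Leibniz rule. -/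
theorem fst_lift_dualNumberHom (D : LieDerivation k s s) (v : UniversalEnvelopingAlgebra k s) :
    (lift k (dualNumberHom D) v).fst = v := by
  induction v using env_induction with
  | hι y => rw [lift_ι]; simp [dualNumberHom]
  | hc c => rw [AlgHom.commutes]; rfl
  | hadd v w hv hw => rw [map_add, TrivSqZeroExt.fst_add, hv, hw]
  | hmul v w hv hw => rw [map_mul, TrivSqZeroExt.fst_mul, hv, hw]

theorem envDer_ι (D : LieDerivation k s s) (a : s) : envDer D (ι k a) = ι k (D a) := by
  change (lift k (dualNumberHom D) (ι k a)).snd = _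
  rw [lift_ι]; simp [dualNumberHom]

theorem envDer_algebraMap (D : LieDerivation k s s) (c : k) :
    envDer D (algebraMap k _ c) = 0 := by
  change (lift k (dualNumberHom D) (algebraMap k _ c)).snd = _
  rw [AlgHom.commutes]; rfl

theorem envDer_mul (D : LieDerivation k s s) (v w : UniversalEnvelopingAlgebra k s) :
    envDer D (v * w) = v * envDer D w + envDer D v * w := by
  change (lift k (dualNumberHom D) (v * w)).snd = _
  rw [map_mul, TrivSqZeroExt.snd_mul, fst_lift_dualNumberHom, fst_lift_dualNumberHom]
  rfl

/-- The situation `h = s ⊕ k x` of a Lie algebra with an ideal `s` of codimension one. -/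
structure CodimOne (j : s →ₗ⁅k⁆ h) where
  x : h
  π : h →ₗ[k] s
  ℓ : h →ₗ[k] k
  D : LieDerivation k s s
  decomp : ∀ v, j (π v) + ℓ v • x = v
  π_j : ∀ a, π (j a) = a
  ℓ_j : ∀ a, ℓ (j a) = 0
  π_x : π x = 0
  ℓ_x : ℓ x = 1
  j_D : ∀ a, j (D a) = ⁅x, j a⁆

namespace CodimOne

variable {j : s →ₗ⁅k⁆ h} (S : CodimOne j) (c : k)

theorem π_lie (v w : h) : S.π ⁅v, w⁆ = ⁅S.π v, S.π w⁆ + S.ℓ v • S.D (S.π w) - S.ℓ w • S.D (S.π v) := by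
  have e : ⁅v, w⁆ = j (⁅S.π v, S.π w⁆ + S.ℓ v • S.D (S.π w) - S.ℓ w • S.D (S.π v)) := by
    conv_lhs => rw [← S.decomp v, ← S.decomp w]
    simp only [map_add, map_sub, map_smul, LieHom.map_lie, S.j_D, add_lie, lie_add, smul_lie,
      lie_smul, lie_self, smul_zero, add_zero]
    rw [← lie_skew S.x (j (S.π v))]
    simp only [smul_neg]
    abel
  rw [e, S.π_j]

theorem ℓ_lie (v w : h) : S.ℓ ⁅v, w⁆ = 0 := by
  have e : ⁅v, w⁆ = j (⁅S.π v, S.π w⁆ + S.ℓ v • S.D (S.π w) - S.ℓ w • S.D (S.π v)) := by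
    conv_lhs => rw [← S.decomp v, ← S.decomp w]
    simp only [map_add, map_sub, map_smul, LieHom.map_lie, S.j_D, add_lie, lie_add, smul_lie,
      lie_smul, lie_self, smul_zero, add_zero]
    rw [← lie_skew S.x (j (S.π v))]
    simp only [smul_neg]
    abel
  rw [e, S.ℓ_j]

/-- Right multiplication by `a ∈ s` on `⨁ᵢ Xⁱ U(s)`. -/
def rmul (a : s) : Module.End k (ℕ →₀ UniversalEnvelopingAlgebra k s) :=
  Finsupp.mapRange.linearMap (LinearMap.mulRight k (ι k a))

/-- Right multiplication by `x` on `⨁ᵢ Xⁱ U(s)`, where `X = x - c`. -/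
def rmulX : Module.End k (ℕ →₀ UniversalEnvelopingAlgebra k s) :=
  Finsupp.lmapDomain _ k Nat.succ + c • LinearMap.id
    - Finsupp.mapRange.linearMap (envDer S.D)

theorem rmul_single (a : s) (i : ℕ) (u : UniversalEnvelopingAlgebra k s) :
    rmul (k := k) a (Finsupp.single i u) = Finsupp.single i (u * ι k a) := by
  simp [rmul]

theorem rmulX_single (i : ℕ) (u : UniversalEnvelopingAlgebra k s) :
    S.rmulX c (Finsupp.single i u)
      = Finsupp.single (i + 1) u + c • Finsupp.single i u - Finsupp.single i (envDer S.D u) := by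
  simp [rmulX, Finsupp.mapDomain_single]

/-- This is `(p x) a - (p a) x = p D(a)`, the essential relation for a right action of `h`. The
operators appear in reversed order because the action is on the right. -/
theorem rmul_mul_rmulX (a : s) :
    rmul a * S.rmulX c - S.rmulX c * rmul a = rmul (S.D a) := by
  refine Finsupp.lhom_ext fun i u => ?_
  simp only [LinearMap.sub_apply, Module.End.mul_apply, rmul_single, rmulX_single, map_add,
    map_sub, map_smul, envDer_mul, envDer_ι, Finsupp.single_add]
  abel

theorem rmul_lie (a b : s) :
    rmul (k := k) ⁅a, b⁆ = rmul b * rmul a - rmul a * rmul b := by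
  refine Finsupp.lhom_ext fun i u => ?_
  simp only [LinearMap.sub_apply, Module.End.mul_apply, rmul_single, LieHom.map_lie,
    LieRing.of_associative_ring_bracket, mul_sub, mul_assoc, Finsupp.single_sub]

theorem rmul_add (a b : s) : rmul (k := k) (a + b) = rmul a + rmul b := by
  refine Finsupp.lhom_ext fun i u => ?_
  simp only [LinearMap.add_apply, rmul_single, map_add, mul_add, Finsupp.single_add]

theorem rmul_smul (r : k) (a : s) : rmul (k := k) (r • a) = r • rmul a := by
  refine Finsupp.lhom_ext fun i u => ?_
  simp only [LinearMap.smul_apply, rmul_single, map_smul, mul_smul_comm, Finsupp.smul_single]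

theorem rmul_π_lie (v w : h) :
    rmul (k := k) (S.π ⁅v, w⁆) = (rmul (S.π w) + S.ℓ w • S.rmulX c) * (rmul (S.π v) + S.ℓ v • S.rmulX c)
      - (rmul (S.π v) + S.ℓ v • S.rmulX c) * (rmul (S.π w) + S.ℓ w • S.rmulX c) := by
  rw [π_lie, sub_eq_add_neg, rmul_add, rmul_add, rmul_lie, ← neg_smul, rmul_smul, rmul_smul,
    ← S.rmul_mul_rmulX c, ← S.rmul_mul_rmulX c]
  refine LinearMap.ext fun p => ?_
  simp only [LinearMap.add_apply, LinearMap.sub_apply, LinearMap.smul_apply, Module.End.mul_apply,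
    map_add, map_smul]
  module

/-- The right action of `h` on `⨁ᵢ Xⁱ U(s)`. -/
def rep : h →ₗ⁅k⁆ (Module.End k (ℕ →₀ UniversalEnvelopingAlgebra k s))ᵐᵒᵖ where
  toFun v := MulOpposite.op (rmul (S.π v) + S.ℓ v • S.rmulX c)
  map_add' v w := by
    rw [← MulOpposite.op_add, map_add, map_add, rmul_add, add_smul]
    congr 1; abel
  map_smul' r v := by
    rw [RingHom.id_apply, ← MulOpposite.op_smul, map_smul, map_smul, rmul_smul, smul_add,
      smul_eq_mul, mul_smul]
  map_lie' {v w} := by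
    rw [ℓ_lie, zero_smul, add_zero, S.rmul_π_lie c]
    rfl

/-- The action of `w ∈ U(h)` from the right on `⨁ᵢ Xⁱ U(s)`. -/
def act (w : UniversalEnvelopingAlgebra k h) :
    Module.End k (ℕ →₀ UniversalEnvelopingAlgebra k s) :=
  MulOpposite.unop (lift k (S.rep c) w)

theorem act_ι (v : h) : S.act c (ι k v) = rmul (S.π v) + S.ℓ v • S.rmulX c := by
  rw [act, lift_ι]; rfl

theorem act_mul (v w : UniversalEnvelopingAlgebra k h) :
    S.act c (v * w) = S.act c w * S.act c v := by
  rw [act, map_mul]; rfl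

theorem act_add (v w : UniversalEnvelopingAlgebra k h) :
    S.act c (v + w) = S.act c v + S.act c w := by
  rw [act, map_add]; rfl

theorem act_smul (r : k) (w : UniversalEnvelopingAlgebra k h) :
    S.act c (r • w) = r • S.act c w := by
  rw [act, map_smul]; rfl

theorem act_algebraMap (r : k) : S.act c (algebraMap k _ r) = r • LinearMap.id := by
  rw [act, AlgHom.commutes]; rfl

/-- Elements of `U(s)` act coordinatewise, so the coordinates are right `U(s)`-linear. -/
theorem act_envMap (u : UniversalEnvelopingAlgebra k s) (p : ℕ →₀ UniversalEnvelopingAlgebra k s)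
    (i : ℕ) : S.act c (envMap j u) p i = p i * u := by
  induction u using env_induction generalizing p with
  | hι y => rw [envMap_ι, act_ι, S.π_j, S.ℓ_j, zero_smul, add_zero]; simp [rmul]
  | hc r =>
    rw [AlgHom.commutes, act_algebraMap, LinearMap.smul_apply, LinearMap.id_apply,
      Finsupp.smul_apply, ← Algebra.commutes, Algebra.smul_def]
  | hadd v w hv hw => rw [map_add, act_add, LinearMap.add_apply, Finsupp.add_apply, hv, hw, mul_add]
  | hmul v w hv hw => rw [map_mul, act_mul, Module.End.mul_apply, hw, hv, mul_assoc]

/-- The coordinates of `w = ∑ᵢ (x - c)ⁱ wᵢ`. -/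
def coords : UniversalEnvelopingAlgebra k h →ₗ[k] ℕ →₀ UniversalEnvelopingAlgebra k s where
  toFun w := S.act c w (Finsupp.single 0 1)
  map_add' v w := by rw [act_add]; rfl
  map_smul' r w := by rw [act_smul]; rfl

theorem coords_mul (v w : UniversalEnvelopingAlgebra k h) :
    S.coords c (v * w) = S.act c w (S.coords c v) := by
  change S.act c (v * w) _ = _
  rw [act_mul]; rfl

theorem coords_mul_envMap (v : UniversalEnvelopingAlgebra k h) (u : UniversalEnvelopingAlgebra k s)
    (i : ℕ) : S.coords c (v * envMap j u) i = S.coords c v i * u := by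
  rw [coords_mul, act_envMap]

theorem coords_mul_x (v : UniversalEnvelopingAlgebra k h) :
    S.coords c (v * ι k S.x) = S.rmulX c (S.coords c v) := by
  rw [coords_mul, act_ι, S.π_x, S.ℓ_x, one_smul]
  congr 1
  have e : rmul (k := k) (0 : s) = 0 := by simpa using rmul_smul (k := k) 0 (0 : s)
  rw [e, zero_add]

theorem rmulX_apply_zero (p : ℕ →₀ UniversalEnvelopingAlgebra k s) :
    S.rmulX c p 0 = c • p 0 - envDer S.D (p 0) := by
  have e : Finsupp.mapDomain Nat.succ p 0 = 0 :=
    Finsupp.mapDomain_of_notMem_range _ _ (by simp)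
  simp [rmulX, e]

theorem rmulX_apply_succ (p : ℕ →₀ UniversalEnvelopingAlgebra k s) (i : ℕ) :
    S.rmulX c p (i + 1) = p i + c • p (i + 1) - envDer S.D (p (i + 1)) := by
  have e : Finsupp.mapDomain Nat.succ p (i + 1) = p i :=
    Finsupp.mapDomain_apply Nat.succ_injective _ _
  simp [rmulX, e]

/-- The element `∑ᵢ (x - c)ⁱ pᵢ`. -/
def recomb : (ℕ →₀ UniversalEnvelopingAlgebra k s) →ₗ[k] UniversalEnvelopingAlgebra k h :=
  Finsupp.lsum k fun i =>
    LinearMap.mulLeft k ((ι k S.x - algebraMap k _ c) ^ i) ∘ₗ (envMap j).toLinearMap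

theorem recomb_apply (p : ℕ →₀ UniversalEnvelopingAlgebra k s) :
    S.recomb c p = p.sum fun i u => (ι k S.x - algebraMap k _ c) ^ i * envMap j u := rfl

theorem recomb_single (i : ℕ) (u : UniversalEnvelopingAlgebra k s) :
    S.recomb c (Finsupp.single i u) = (ι k S.x - algebraMap k _ c) ^ i * envMap j u := by
  rw [recomb_apply, Finsupp.sum_single_index]
  simp

theorem envMap_envDer (u : UniversalEnvelopingAlgebra k s) :
    envMap j (envDer S.D u) = ι k S.x * envMap j u - envMap j u * ι k S.x := by
  induction u using env_induction with
  | hι y =>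
    rw [envDer_ι, envMap_ι, envMap_ι, S.j_D, LieHom.map_lie, LieRing.of_associative_ring_bracket]
  | hc r => rw [envDer_algebraMap, map_zero, AlgHom.commutes, Algebra.commutes, sub_self]
  | hadd v w hv hw => rw [map_add, map_add, hv, hw, map_add]; noncomm_ring
  | hmul v w hv hw => rw [envDer_mul, map_add, map_mul, map_mul, map_mul, hv, hw]; noncomm_ring

/-- On the generator `x` this is `u x = x u - D(u)` inside `U(h)`, which is exactly how `rmulX` was
defined; on `s` it is associativity. -/
theorem recomb_act (w : UniversalEnvelopingAlgebra k h) (p : ℕ →₀ UniversalEnvelopingAlgebra k s) :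
    S.recomb c (S.act c w p) = S.recomb c p * w := by
  induction w using env_induction generalizing p with
  | hι v =>
    have e1 : S.recomb c ∘ₗ S.rmulX c = LinearMap.mulRight k (ι k S.x) ∘ₗ S.recomb c := by
      refine Finsupp.lhom_ext fun i u => ?_
      simp only [LinearMap.comp_apply, rmulX_single, map_add, map_sub, map_smul, recomb_single,
        envMap_envDer, LinearMap.mulRight_apply]
      rw [pow_succ, mul_assoc _ (_ - _) (envMap j u), sub_mul, mul_sub, mul_sub,
        ← Algebra.smul_def, mul_smul_comm, mul_assoc]
      abel
    have e2 : S.recomb c ∘ₗ rmul (S.π v) = LinearMap.mulRight k (ι k (j (S.π v))) ∘ₗ S.recomb c := by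
      refine Finsupp.lhom_ext fun i u => ?_
      simp only [LinearMap.comp_apply, rmul_single, recomb_single, LinearMap.mulRight_apply, map_mul,
        envMap_ι, mul_assoc]
    have e1' := LinearMap.congr_fun e1 p
    have e2' := LinearMap.congr_fun e2 p
    simp only [LinearMap.comp_apply, LinearMap.mulRight_apply] at e1' e2'
    rw [act_ι, LinearMap.add_apply, map_add, LinearMap.smul_apply, map_smul, e1', e2']
    conv_rhs => rw [← S.decomp v, map_add, map_smul, mul_add, mul_smul_comm]
  | hc r =>
    rw [act_algebraMap, LinearMap.smul_apply, LinearMap.id_apply, map_smul, ← Algebra.commutes,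
      Algebra.smul_def]
  | hadd v w hv hw => rw [act_add, LinearMap.add_apply, map_add, hv, hw, mul_add]
  | hmul v w hv hw => rw [act_mul, Module.End.mul_apply, hw, hv, mul_assoc]

/-- This half of the one-step PBW theorem suffices: coordinates are defined by acting on the vector
`1`, and `w` is recovered from them. Linear independence of the powers is never invoked. -/
theorem recomb_coords (w : UniversalEnvelopingAlgebra k h) : S.recomb c (S.coords c w) = w := by
  change S.recomb c (S.act c w _) = w
  rw [recomb_act, recomb_single, pow_zero, map_one, one_mul, one_mul]

end CodimOne

end EnvelopingAlgebra

/-! ### Lattices in enveloping algebras and relative PBW bases -/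

section RelativeBasis

attribute [local instance 100] LieRing.ofAssociativeRing

open UniversalEnvelopingAlgebra (ι lift)

variable {k : Type*} [Field k] (O : Subring k)
variable {r s h : Type*} [LieRing r] [LieAlgebra k r] [LieRing s] [LieAlgebra k s]
  [LieRing h] [LieAlgebra k h]

/-- The `O`-subalgebra of `U(h)` generated by `q M`. -/
def lat (q : k) (M : Submodule O h) : Subalgebra O (UniversalEnvelopingAlgebra k h) :=
  Algebra.adjoin O ((fun y => ι k (q • y)) '' (M : Set h))

/-- The preimage of a lattice under a homomorphism of Lie algebras. -/
def comapLat (j : s →ₗ⁅k⁆ h) (M : Submodule O h) : Submodule O s where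
  carrier := {a | j a ∈ M}
  add_mem' {a b} ha hb := by
    change j (a + b) ∈ M
    rw [map_add]; exact add_mem ha hb
  zero_mem' := by
    change j 0 ∈ M
    rw [map_zero]; exact zero_mem M
  smul_mem' c a ha := by
    change j ((c : k) • a) ∈ M
    rw [map_smul]; exact M.smul_mem c ha

variable {O}

theorem ι_smul_mem_lat {q : k} {M : Submodule O h} {y : h} (hy : y ∈ M) :
    ι k (q • y) ∈ lat O q M :=
  Algebra.subset_adjoin ⟨y, hy, rfl⟩

theorem smul_mem_lat {q c : k} {M : Submodule O h} (hc : c ∈ O)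
    {v : UniversalEnvelopingAlgebra k h} (hv : v ∈ lat O q M) : c • v ∈ lat O q M :=
  (lat O q M).smul_mem hv (⟨c, hc⟩ : O)

theorem algebraMap_mem_lat {q c : k} {M : Submodule O h} (hc : c ∈ O) :
    algebraMap k (UniversalEnvelopingAlgebra k h) c ∈ lat O q M :=
  (lat O q M).algebraMap_mem (⟨c, hc⟩ : O)

theorem lat_induction {q : k} {M : Submodule O h}
    {P : (v : UniversalEnvelopingAlgebra k h) → v ∈ lat O q M → Prop}
    (hι : ∀ y (hy : y ∈ M), P (ι k (q • y)) (ι_smul_mem_lat hy))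
    (hc : ∀ c (hc : c ∈ O), P (algebraMap k _ c) (algebraMap_mem_lat hc))
    (hadd : ∀ v w hv hw, P v hv → P w hw → P (v + w) (add_mem hv hw))
    (hmul : ∀ v w hv hw, P v hv → P w hw → P (v * w) (mul_mem hv hw))
    {v : UniversalEnvelopingAlgebra k h} (hv : v ∈ lat O q M) : P v hv := by
  induction hv using Algebra.adjoin_induction with
  | mem x hx => obtain ⟨y, hy, rfl⟩ := hx; exact hι y hy
  | algebraMap c => exact hc c c.2
  | add x y _ _ hx hy => exact hadd _ _ _ _ hx hy
  | mul x y h1 h2 hx hy => exact hmul _ _ h1 h2 hx hy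

theorem lat_le_lat {q q' : k} {M : Submodule O h} (hq : ∃ c ∈ O, q = c * q') :
    lat O q M ≤ lat O q' M := by
  obtain ⟨c, hc, rfl⟩ := hq
  refine Algebra.adjoin_le ?_
  rintro _ ⟨y, hy, rfl⟩
  have := smul_mem_lat hc (ι_smul_mem_lat (q := q') hy)
  rwa [← map_smul, ← mul_smul] at this

theorem envMap_mem_lat {q q' : k} {j : s →ₗ⁅k⁆ h} {N : Submodule O s} {M : Submodule O h}
    (hj : ∀ a ∈ N, ∃ m ∈ M, j (q • a) = q' • m) {u : UniversalEnvelopingAlgebra k s}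
    (hu : u ∈ lat O q N) : envMap j u ∈ lat O q' M := by
  induction hu using lat_induction with
  | hι y hy =>
    obtain ⟨m, hm, e⟩ := hj y hy
    rw [envMap_ι, e]
    exact ι_smul_mem_lat hm
  | hc c hc => rw [AlgHom.commutes]; exact algebraMap_mem_lat hc
  | hadd v w _ _ hv hw => rw [map_add]; exact add_mem hv hw
  | hmul v w _ _ hv hw => rw [map_mul]; exact mul_mem hv hw

theorem envMap_mem_lat_of_comapLat {q : k} {j : s →ₗ⁅k⁆ h} {M : Submodule O h}
    {u : UniversalEnvelopingAlgebra k s} (hu : u ∈ lat O q (comapLat O j M)) :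
    envMap j u ∈ lat O q M :=
  envMap_mem_lat (fun a ha => ⟨j a, ha, by rw [map_smul]⟩) hu

theorem exists_smul_mem_lat {q : k} (hq : q ≠ 0) {M : Submodule O h}
    (hO : ∀ c : k, ∃ d ∈ O, d ≠ 0 ∧ d * c ∈ O) (hM : ∀ y : h, ∃ d ∈ O, d ≠ 0 ∧ d • y ∈ M)
    (v : UniversalEnvelopingAlgebra k h) : ∃ d ∈ O, d ≠ 0 ∧ d • v ∈ lat O q M := by
  induction v using env_induction with
  | hι y =>
    obtain ⟨d, hd, hd0, hy⟩ := hM y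
    obtain ⟨e', he', he0', hey'⟩ := hO q
    refine ⟨(e' * q) * d * e', mul_mem (mul_mem hey' hd) he', ?_, ?_⟩
    · exact mul_ne_zero (mul_ne_zero (mul_ne_zero he0' hq) hd0) he0'
    · have := smul_mem_lat (mul_mem he' he') (ι_smul_mem_lat (q := q) hy)
      have e2 : (e' * q * d * e') • ι k y = (e' * e') • ι k (q • d • y) := by
        rw [map_smul, map_smul, ← mul_smul, ← mul_smul]
        congr 1
        ring
      rw [e2]
      exact this
  | hc c =>
    obtain ⟨d, hd, hd0, h'⟩ := hO c
    refine ⟨d, hd, hd0, ?_⟩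
    rw [Algebra.algebraMap_eq_smul_one, ← mul_smul, ← Algebra.algebraMap_eq_smul_one]
    exact algebraMap_mem_lat h'
  | hadd v w hv hw =>
    obtain ⟨d, hd, hd0, h1⟩ := hv
    obtain ⟨e, he, he0, h2⟩ := hw
    refine ⟨d * e, mul_mem hd he, mul_ne_zero hd0 he0, ?_⟩
    rw [smul_add]
    refine add_mem ?_ ?_
    · rw [mul_comm, mul_smul]; exact smul_mem_lat he h1
    · rw [mul_smul]; exact smul_mem_lat hd h2
  | hmul v w hv hw =>
    obtain ⟨d, hd, hd0, h1⟩ := hv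
    obtain ⟨e, he, he0, h2⟩ := hw
    refine ⟨d * e, mul_mem hd he, mul_ne_zero hd0 he0, ?_⟩
    rw [← smul_mul_smul_comm]
    exact mul_mem h1 h2

variable (O) in
/-- A basis of `U(h)` as a right `U(s)`-module which is compatible with the lattices generated by
all multiples `q M` of a given lattice. -/
structure RelBasis (j : s →ₗ⁅k⁆ h) (M : Submodule O h) where
  I : Type
  deg : I → ℕ
  t : I → UniversalEnvelopingAlgebra k h
  coord : I → UniversalEnvelopingAlgebra k h →ₗ[k] UniversalEnvelopingAlgebra k s
  coord_mul : ∀ i v u, coord i (v * envMap j u) = coord i v * u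
  repr : ∀ v, ∃ S : Finset I, (∀ i ∉ S, coord i v = 0) ∧
    v = ∑ i ∈ S, t i * envMap j (coord i v)
  coord_mem : ∀ q ∈ O, ∀ v ∈ lat O q M, ∀ i, ∃ u ∈ lat O q (comapLat O j M),
    coord i v = q ^ deg i • u
  t_mem : ∀ q ∈ O, ∀ i, q ^ deg i • t i ∈ lat O q M

/-- Composition of relative bases. -/
def RelBasis.comp {i : r →ₗ⁅k⁆ s} {j : s →ₗ⁅k⁆ h} {M : Submodule O h}
    (B : RelBasis O j M) (C : RelBasis O i (comapLat O j M)) : RelBasis O (j.comp i) M where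
  I := B.I × C.I
  deg a := B.deg a.1 + C.deg a.2
  t a := B.t a.1 * envMap j (C.t a.2)
  coord a := C.coord a.2 ∘ₗ B.coord a.1
  coord_mul a v u := by
    rw [envMap_comp, LinearMap.comp_apply, B.coord_mul, C.coord_mul]; rfl
  repr v := by
    classical
    obtain ⟨S, hS, e⟩ := B.repr v
    choose T hT eT using fun a => C.repr (B.coord a v)
    -- The supports `T a` depend on `a`; enlarging all of them to one finite union only adds zero
    -- terms and makes the index set a product.
    refine ⟨S ×ˢ S.biUnion T, ?_, ?_⟩
    · rintro ⟨a, b⟩ hab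
      by_cases ha : a ∈ S
      · refine hT a b fun hb => hab ?_
        exact Finset.mk_mem_product ha (Finset.mem_biUnion.2 ⟨a, ha, hb⟩)
      · change C.coord b (B.coord a v) = 0
        rw [hS a ha, map_zero]
    · rw [Finset.sum_product]
      conv_lhs => rw [e]
      refine Finset.sum_congr rfl fun a ha => ?_
      have e' : B.coord a v = ∑ b ∈ S.biUnion T, C.t b * envMap i (C.coord b (B.coord a v)) := by
        conv_lhs => rw [eT a]
        refine Finset.sum_subset (Finset.subset_biUnion_of_mem T ha) fun b _ hb => ?_
        rw [hT a b hb, map_zero, mul_zero]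
      conv_lhs => rw [e', map_sum, Finset.mul_sum]
      refine Finset.sum_congr rfl fun b _ => ?_
      rw [map_mul, envMap_comp, mul_assoc]
      rfl
  coord_mem q hq v hv a := by
    obtain ⟨u, hu, e⟩ := B.coord_mem q hq v hv a.1
    obtain ⟨w, hw, e'⟩ := C.coord_mem q hq u hu a.2
    refine ⟨w, hw, ?_⟩
    rw [LinearMap.comp_apply, e, map_smul, e', ← mul_smul, pow_add]
  t_mem q hq a := by
    rw [pow_add, ← smul_mul_smul_comm, ← map_smul]
    exact mul_mem (B.t_mem q hq a.1) (envMap_mem_lat_of_comapLat (C.t_mem q hq a.2))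

/-- The relative basis given by an isomorphism of Lie algebras. -/
def RelBasis.ofEquiv (e : s ≃ₗ⁅k⁆ h) (M : Submodule O h) : RelBasis O (e : s →ₗ⁅k⁆ h) M where
  I := Unit
  deg _ := 0
  t _ := 1
  coord _ := (envMap (e.symm : h →ₗ⁅k⁆ s)).toLinearMap
  coord_mul _ v u := by
    have e' : (e.symm : h →ₗ⁅k⁆ s).comp (e : s →ₗ⁅k⁆ h) = LieHom.id := by ext a; simp
    have e'' : envMap (LieHom.id : s →ₗ⁅k⁆ s) = AlgHom.id k _ := by
      apply UniversalEnvelopingAlgebra.hom_ext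
      ext a
      change envMap LieHom.id (ι k a) = ι k a
      rw [envMap_ι]; rfl
    change envMap _ (v * _) = envMap _ v * u
    rw [map_mul, ← envMap_comp, e', e'', AlgHom.id_apply]
  repr v := by
    refine ⟨{()}, fun i hi => absurd (Finset.mem_singleton.2 rfl) hi, ?_⟩
    have e' : (e : s →ₗ⁅k⁆ h).comp (e.symm : h →ₗ⁅k⁆ s) = LieHom.id := by ext a; simp
    have e'' : envMap (LieHom.id : h →ₗ⁅k⁆ h) = AlgHom.id k _ := by
      apply UniversalEnvelopingAlgebra.hom_ext
      ext a
      change envMap LieHom.id (ι k a) = ι k a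
      rw [envMap_ι]; rfl
    rw [Finset.sum_singleton, one_mul, AlgHom.toLinearMap_apply, ← envMap_comp, e', e'',
      AlgHom.id_apply]
  coord_mem q hq v hv i := by
    refine ⟨_, envMap_mem_lat (fun a ha => ⟨e.symm a, ?_, map_smul _ _ _⟩) hv,
      by rw [pow_zero, one_smul]; rfl⟩
    change (e : s →ₗ⁅k⁆ h) (e.symm a) ∈ M
    simpa using ha
  t_mem q hq i := by rw [pow_zero, one_smul]; exact one_mem _

/-- The relative basis `(x - c)ⁱ` for an ideal of codimension one. -/
def CodimOne.relBasis {j : s →ₗ⁅k⁆ h} (S : CodimOne j) {M : Submodule O h} {c : k} (hc : c ∈ O)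
    (hx : S.x ∈ M) (hℓ : ∀ m ∈ M, S.ℓ m ∈ O)
    (hlie : ∀ a ∈ M, ∀ b ∈ M, ⁅a, b⁆ ∈ M) : RelBasis O j M where
  I := ℕ
  deg i := i
  t i := (ι k S.x - algebraMap k _ c) ^ i
  coord i := Finsupp.lapply i ∘ₗ S.coords c
  coord_mul i v u := S.coords_mul_envMap c v u i
  repr v := by
    refine ⟨(S.coords c v).support, fun i hi => Finsupp.notMem_support_iff.1 hi, ?_⟩
    conv_lhs => rw [← S.recomb_coords c v]
    rfl
  coord_mem q hq v hv i := by
    have hπ : ∀ m ∈ M, S.π m ∈ comapLat O j M := by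
      intro m hm
      have e : j (S.π m) = m - S.ℓ m • S.x := by
        rw [eq_sub_iff_add_eq, S.decomp]
      change j (S.π m) ∈ M
      rw [e]
      exact sub_mem hm (M.smul_mem (⟨_, hℓ m hm⟩ : O) hx)
    have hder : ∀ u ∈ lat O q (comapLat O j M),
        q • envDer S.D u ∈ lat O q (comapLat O j M) := by
      intro u hu
      induction hu using lat_induction with
      | hι y hy =>
        rw [envDer_ι, map_smul]
        refine smul_mem_lat hq (ι_smul_mem_lat ?_)
        change j (S.D y) ∈ M
        rw [S.j_D]
        exact hlie _ hx _ hy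
      | hc c hc => rw [envDer_algebraMap, smul_zero]; exact zero_mem _
      | hadd v w _ _ hv hw => rw [map_add, smul_add]; exact add_mem hv hw
      | hmul v w h1 h2 hv hw =>
        rw [envDer_mul, smul_add, ← mul_smul_comm, ← smul_mul_assoc]
        exact add_mem (mul_mem h1 hw) (mul_mem hv h2)
    -- The condition `pᵢ ∈ qⁱ U(q (s ∩ M))` is stable under the right action of `U(q M)`. A
    -- generator `q y` splits into `q π(y)`, which acts coordinatewise, and `q ℓ(y) x`, where the
    -- shift from degree `i` to `i + 1` comes with exactly one factor `q`.
    have key : ∀ p : ℕ →₀ UniversalEnvelopingAlgebra k s,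
        (∀ i, ∃ u ∈ lat O q (comapLat O j M), p i = q ^ i • u) →
        ∀ i, ∃ u ∈ lat O q (comapLat O j M), S.act c v p i = q ^ i • u := by
      induction hv using lat_induction with
      | hι y hy =>
        intro p hp i
        have e : S.act c (ι k (q • y)) p i
            = p i * ι k (q • S.π y) + S.ℓ y • q • S.rmulX c p i := by
          rw [S.act_ι, LinearMap.add_apply, LinearMap.smul_apply, Finsupp.add_apply,
            Finsupp.smul_apply, map_smul, map_smul, smul_eq_mul, mul_comm q, mul_smul]
          simp [CodimOne.rmul]
        have h1 : ∃ u ∈ lat O q (comapLat O j M), q • S.rmulX c p i = q ^ i • u := by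
          obtain ⟨u, hu, eu⟩ := hp i
          have h2 : ∃ u ∈ lat O q (comapLat O j M),
              q • (c • p i - envDer S.D (p i)) = q ^ i • u := by
            refine ⟨(q * c) • u - q • envDer S.D u,
              sub_mem (smul_mem_lat (mul_mem hq hc) hu) (hder u hu), ?_⟩
            rw [eu, map_smul]
            module
          cases i with
          | zero => rwa [S.rmulX_apply_zero]
          | succ i =>
            obtain ⟨u', hu', eu'⟩ := h2
            obtain ⟨w, hw, ew⟩ := hp i
            refine ⟨w + u', add_mem hw hu', ?_⟩
            rw [S.rmulX_apply_succ, add_sub_assoc, smul_add, eu', ew, smul_add, pow_succ', mul_smul,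
              mul_smul]
        obtain ⟨w, hw, ew⟩ := h1
        obtain ⟨u, hu, eu⟩ := hp i
        refine ⟨u * ι k (q • S.π y) + S.ℓ y • w,
          add_mem (mul_mem hu (ι_smul_mem_lat (hπ y hy))) (smul_mem_lat (hℓ y hy) hw), ?_⟩
        rw [e, ew, eu, smul_mul_assoc, smul_add, smul_comm (S.ℓ y)]
      | hc d hd =>
        intro p hp i
        obtain ⟨u, hu, eu⟩ := hp i
        refine ⟨d • u, smul_mem_lat hd hu, ?_⟩
        rw [S.act_algebraMap, LinearMap.smul_apply, LinearMap.id_apply, Finsupp.smul_apply, eu,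
          smul_comm]
      | hadd v w _ _ hv hw =>
        intro p hp i
        obtain ⟨u, hu, eu⟩ := hv p hp i
        obtain ⟨u', hu', eu'⟩ := hw p hp i
        refine ⟨u + u', add_mem hu hu', ?_⟩
        rw [S.act_add, LinearMap.add_apply, Finsupp.add_apply, eu, eu', smul_add]
      | hmul v w _ _ hv hw =>
        intro p hp
        rw [S.act_mul]
        exact hw _ (hv p hp)
    refine key _ (fun i => ?_) i
    by_cases hi : i = 0
    · subst hi
      exact ⟨1, one_mem _, by simp⟩
    · exact ⟨0, zero_mem _, by rw [Finsupp.single_eq_of_ne hi, smul_zero]⟩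
  t_mem q hq i := by
    rw [← smul_pow, smul_sub, ← map_smul, Algebra.algebraMap_eq_smul_one, ← mul_smul,
      ← Algebra.algebraMap_eq_smul_one]
    exact pow_mem (sub_mem (ι_smul_mem_lat hx) (algebraMap_mem_lat (mul_mem hq hc))) i

end RelativeBasis

/-! ### Existence of relative bases in nilpotent Lie algebras -/

section Existence

attribute [local instance 100] LieRing.ofAssociativeRing

variable {k : Type*} [Field k] {O : Subring k}

/-! ### Finitely generated modules over a valuation ring. -/

section FG

variable {V : Type*} [AddCommGroup V] [Module k V]

/-- Of two values of `ℓ` one divides the other, since `O` is a valuation ring; so among finitely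
many generators one has a value dividing all the others. -/
theorem exists_generator_of_fg (hO : ∀ a : k, a ∈ O ∨ a⁻¹ ∈ O) {M : Submodule O V} (hM : M.FG)
    (ℓ : V →ₗ[k] k) : ∃ x ∈ M, ∀ m ∈ M, ∃ c ∈ O, ℓ m = c * ℓ x := by
  induction M, hM using Submodule.fg_induction with
  | singleton x =>
    refine ⟨x, Submodule.mem_span_singleton_self x, fun m hm => ?_⟩
    obtain ⟨c, rfl⟩ := Submodule.mem_span_singleton.1 hm
    exact ⟨c, c.2, map_smul ℓ (c : k) x⟩
  | sup M₁ M₂ _ _ h₁ h₂ =>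
    obtain ⟨x₁, hx₁, H₁⟩ := h₁
    obtain ⟨x₂, hx₂, H₂⟩ := h₂
    have key : ∀ (N₁ N₂ : Submodule O V) (x₁ x₂ : V), x₂ ∈ N₂ → (∀ m ∈ N₁, ∃ c ∈ O, ℓ m = c * ℓ x₁) →
        (∀ m ∈ N₂, ∃ c ∈ O, ℓ m = c * ℓ x₂) → (∃ d ∈ O, ℓ x₁ = d * ℓ x₂) →
        ∃ x ∈ N₁ ⊔ N₂, ∀ m ∈ N₁ ⊔ N₂, ∃ c ∈ O, ℓ m = c * ℓ x := by
      rintro N₁ N₂ x₁ x₂ hx₂ H₁ H₂ ⟨d, hd, e⟩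
      refine ⟨x₂, Submodule.mem_sup_right hx₂, fun m hm => ?_⟩
      obtain ⟨m₁, hm₁, m₂, hm₂, rfl⟩ := Submodule.mem_sup.1 hm
      obtain ⟨c₁, hc₁, e₁⟩ := H₁ m₁ hm₁
      obtain ⟨c₂, hc₂, e₂⟩ := H₂ m₂ hm₂
      exact ⟨c₁ * d + c₂, add_mem (mul_mem hc₁ hd) hc₂, by rw [map_add, e₁, e₂, e]; ring⟩
    by_cases h0 : ℓ x₂ = 0
    · rw [sup_comm]
      exact key M₂ M₁ x₂ x₁ hx₁ H₂ H₁ ⟨0, zero_mem O, by rw [h0, zero_mul]⟩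
    · by_cases h1 : ℓ x₁ = 0
      · exact key M₁ M₂ x₁ x₂ hx₂ H₁ H₂ ⟨0, zero_mem O, by rw [h1, zero_mul]⟩
      · rcases hO (ℓ x₁ / ℓ x₂) with h | h
        · exact key M₁ M₂ x₁ x₂ hx₂ H₁ H₂ ⟨_, h, by field_simp⟩
        · rw [sup_comm]
          rw [inv_div] at h
          exact key M₂ M₁ x₂ x₁ hx₁ H₂ H₁ ⟨_, h, by field_simp⟩

/-- If `x ∈ M` has a value generating `ℓ(M)`, the projection to `ker ℓ` along `x` maps `M` into
itself, so `M ∩ ker ℓ` is a quotient of `M`. No noetherian hypothesis enters. -/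
theorem fg_inf_ker (hO : ∀ a : k, a ∈ O ∨ a⁻¹ ∈ O) {M : Submodule O V} (hM : M.FG)
    (ℓ : V →ₗ[k] k) : (M ⊓ (LinearMap.ker ℓ).restrictScalars O).FG := by
  obtain ⟨x, hx, H⟩ := exists_generator_of_fg hO hM ℓ
  by_cases h0 : ℓ x = 0
  · have e : M ⊓ (LinearMap.ker ℓ).restrictScalars O = M := by
      rw [inf_eq_left]
      intro m hm
      obtain ⟨c, -, e⟩ := H m hm
      change ℓ m = 0
      rw [e, h0, mul_zero]
    rwa [e]
  · let T : V →ₗ[k] V := LinearMap.id - (LinearMap.toSpanSingleton k V x) ∘ₗ ((ℓ x)⁻¹ • ℓ)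
    have hT : ∀ v, T v = v - ((ℓ x)⁻¹ * ℓ v) • x := fun v => rfl
    have e : M ⊓ (LinearMap.ker ℓ).restrictScalars O = M.map (T.restrictScalars O) := by
      ext v
      constructor
      · rintro ⟨hv, hv0⟩
        refine ⟨v, hv, ?_⟩
        change T v = v
        rw [hT, show ℓ v = 0 from hv0, mul_zero, zero_smul, sub_zero]
      · rintro ⟨m, hm, rfl⟩
        obtain ⟨c, hc, e⟩ := H m hm
        have e' : T m = m - c • x := by
          rw [hT, e, mul_comm c, inv_mul_cancel_left₀ h0]
        refine ⟨?_, ?_⟩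
        · change T m ∈ M
          rw [e']
          exact sub_mem hm (M.smul_mem (⟨c, hc⟩ : O) hx)
        · change ℓ (T m) = 0
          rw [e', map_sub, map_smul, e, smul_eq_mul, sub_self]
    rw [e]
    exact hM.map _

theorem fg_inf_restrictScalars (hO : ∀ a : k, a ∈ O ∨ a⁻¹ ∈ O) [FiniteDimensional k V]
    {M : Submodule O V} (hM : M.FG) (W : Submodule k V) : (M ⊓ W.restrictScalars O).FG := by
  let B := Module.finBasis k (V ⧸ W)
  let ℓ : Fin (Module.finrank k (V ⧸ W)) → V →ₗ[k] k := fun i => B.coord i ∘ₗ W.mkQ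
  have key : ∀ S : Finset (Fin (Module.finrank k (V ⧸ W))),
      ∃ N : Submodule O V, N.FG ∧ ∀ v, v ∈ N ↔ v ∈ M ∧ ∀ i ∈ S, ℓ i v = 0 := by
    classical
    intro S
    induction S using Finset.induction_on with
    | empty => exact ⟨M, hM, by simp⟩
    | insert i S _ ih =>
      obtain ⟨N, hN, e⟩ := ih
      refine ⟨_, fg_inf_ker hO hN (ℓ i), fun v => ?_⟩
      rw [Submodule.mem_inf, e, Submodule.restrictScalars_mem, LinearMap.mem_ker]
      simp only [Finset.mem_insert, forall_eq_or_imp]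
      tauto
  obtain ⟨N, hN, e⟩ := key Finset.univ
  have e' : M ⊓ W.restrictScalars O = N := by
    ext v
    rw [e, Submodule.mem_inf, Submodule.restrictScalars_mem]
    refine and_congr_right fun _ => ?_
    rw [← Submodule.Quotient.mk_eq_zero W, ← B.repr.map_eq_zero_iff]
    constructor
    · intro h i _
      exact DFunLike.congr_fun h i
    · intro h
      ext i
      exact h i (Finset.mem_univ i)
  rwa [e']

end FG

variable {h : Type*} [LieRing h] [LieAlgebra k h]

/-- An Engel-type statement. With `A = b` and `T = h` it produces an element outside `b` normalising
`b`; with the centre modulo an ideal for `A`, it produces an element of the second centre. -/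
theorem exists_lie_mem_of_isNilpotent [LieRing.IsNilpotent h] (A T : Submodule k h) (s : Set h)
    (hT : ∀ x ∈ s, ∀ y ∈ T, ⁅x, y⁆ ∈ T) (hTA : ¬ T ≤ A) :
    ∃ y ∈ T, y ∉ A ∧ ∀ x ∈ s, ⁅x, y⁆ ∈ A := by
  -- If every element of `T` outside `A` has a bracket outside `A`, iterating brackets gives
  -- elements outside `A` arbitrarily deep in the lower central series.
  by_contra! H
  have key : ∀ n : ℕ, ∃ y ∈ T, y ∉ A ∧ y ∈ LieModule.lowerCentralSeries k h h n := by
    intro n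
    induction n with
    | zero =>
      obtain ⟨y, hy, hyA⟩ := SetLike.not_le_iff_exists.1 hTA
      exact ⟨y, hy, hyA, by simp⟩
    | succ n ih =>
      obtain ⟨y, hy, hyA, hyn⟩ := ih
      obtain ⟨x, hx, hxy⟩ := H y hy hyA
      refine ⟨_, hT x hx y hy, hxy, ?_⟩
      rw [LieModule.lowerCentralSeries_succ]
      exact LieSubmodule.lie_mem_lie (LieSubmodule.mem_top x) hyn
  obtain ⟨n, hn⟩ := LieModule.IsNilpotent.nilpotent k h h
  obtain ⟨y, -, hyA, hyn⟩ := key n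
  rw [hn, LieSubmodule.mem_bot] at hyn
  exact hyA (hyn ▸ zero_mem A)

/-- The decomposition `b₁ = b ⊕ k x`. -/
def CodimOne.ofSubalgebra {b b₁ : LieSubalgebra k h} (hb : b ≤ b₁) (x : h) (hx : x ∈ b₁)
    (ℓ : h →ₗ[k] k) (hℓx : ℓ x = 1) (hℓ : ∀ v ∈ b₁, ℓ v = 0 ↔ v ∈ b)
    (hxb : ∀ a ∈ b, ⁅x, a⁆ ∈ b) : CodimOne (LieSubalgebra.inclusion hb) where
  x := ⟨x, hx⟩
  π :=
    { toFun v := ⟨(v : h) - ℓ v • x, by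
        rw [← hℓ _ (sub_mem v.2 (b₁.smul_mem _ hx)), map_sub, map_smul, hℓx, smul_eq_mul, mul_one,
          sub_self]⟩
      map_add' v w := by
        ext
        change (v : h) + w - ℓ (v + w) • x = (v - ℓ v • x) + (w - ℓ w • x)
        rw [map_add, add_smul]
        abel
      map_smul' c v := by
        ext
        change c • (v : h) - ℓ (c • v) • x = c • (v - ℓ v • x)
        rw [map_smul, smul_eq_mul, mul_smul, smul_sub] }
  ℓ := ℓ ∘ₗ b₁.toSubmodule.subtype
  D :=
    { toFun a := ⟨⁅x, (a : h)⁆, hxb a a.2⟩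
      map_add' a c := by ext; simp
      map_smul' c a := by ext; simp
      leibniz' a c := by
        ext
        simp only [LinearMap.coe_mk, AddHom.coe_mk, LieSubalgebra.coe_bracket,
          AddSubgroupClass.coe_sub]
        rw [leibniz_lie, ← lie_skew ⁅x, (a : h)⁆ (c : h)]
        abel }
  decomp v := by
    ext
    exact sub_add_cancel (v : h) (ℓ v • x)
  π_j a := by
    have e : ℓ (a : h) = 0 := (hℓ a (hb a.2)).2 a.2
    ext
    simp [e]
  ℓ_j a := (hℓ a (hb a.2)).2 a.2
  π_x := by ext; simp [hℓx]
  ℓ_x := hℓx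
  j_D a := by ext; simp

/-- `b + k y` as a Lie subalgebra, for `y` normalising `b`. -/
def adjoinElement (b : LieSubalgebra k h) (y : h) (hy : ∀ a ∈ b, ⁅a, y⁆ ∈ b) : LieSubalgebra k h where
  toSubmodule := b.toSubmodule ⊔ Submodule.span k {y}
  lie_mem' {v w} hv hw := by
    obtain ⟨a, ha, v', hv', rfl⟩ := Submodule.mem_sup.1 hv
    obtain ⟨c, hc, w', hw', rfl⟩ := Submodule.mem_sup.1 hw
    obtain ⟨α, rfl⟩ := Submodule.mem_span_singleton.1 hv'
    obtain ⟨β, rfl⟩ := Submodule.mem_span_singleton.1 hw'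
    refine Submodule.mem_sup_left ?_
    change ⁅a + α • y, c + β • y⁆ ∈ b
    simp only [add_lie, lie_add, smul_lie, lie_smul, lie_self, smul_zero, add_zero]
    rw [← lie_skew y c]
    exact add_mem (add_mem (b.lie_mem ha hc) (b.smul_mem _ (neg_mem (hy c hc))))
      (b.smul_mem _ (hy a ha))

theorem mem_adjoinElement {b : LieSubalgebra k h} {y : h} {hy : ∀ a ∈ b, ⁅a, y⁆ ∈ b} {v : h} :
    v ∈ adjoinElement b y hy ↔ ∃ a ∈ b, ∃ c : k, v = a + c • y := by
  change v ∈ b.toSubmodule ⊔ Submodule.span k {y} ↔ _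
  rw [Submodule.mem_sup]
  constructor
  · rintro ⟨a, ha, v', hv', rfl⟩
    obtain ⟨α, rfl⟩ := Submodule.mem_span_singleton.1 hv'
    exact ⟨a, ha, α, rfl⟩
  · rintro ⟨a, ha, c, rfl⟩
    exact ⟨a, ha, _, Submodule.smul_mem _ _ (Submodule.mem_span_singleton_self y), rfl⟩

/-- The vector `y` is replaced by one spanning the same line modulo `b` and adapted to the lattice:
`M ∩ (b + k y)` becomes `(M ∩ b) + O x`. The form `ℓ` reads off the coefficient of `x`. -/
theorem exists_lattice_complement (hO : ∀ a : k, a ∈ O ∨ a⁻¹ ∈ O) [FiniteDimensional k h]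
    {M : Submodule O h} (hM : M.FG) (hspan : ∀ y : h, ∃ d ∈ O, d ≠ 0 ∧ d • y ∈ M)
    {b : LieSubalgebra k h} {y : h} (hyb : y ∉ b) :
    ∃ (x : h) (ℓ : h →ₗ[k] k), x ∈ M ∧ (∃ a ∈ b, ∃ c : k, x = a + c • y) ∧ ℓ x = 1 ∧
      (∀ a ∈ b, ℓ a = 0) ∧ ℓ y ≠ 0 ∧ (∀ m ∈ M, (∃ a ∈ b, ∃ c : k, m = a + c • y) → ℓ m ∈ O) := by
  obtain ⟨ℓ₀, h0, h1⟩ : ∃ ℓ₀ : h →ₗ[k] k, ℓ₀ y ≠ 0 ∧ ∀ a ∈ b, ℓ₀ a = 0 := by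
    obtain ⟨f, hf, e⟩ := Submodule.exists_le_ker_of_notMem (p := b.toSubmodule) (v := y) hyb
    exact ⟨f, hf, fun a ha => e ha⟩
  have hfg := fg_inf_restrictScalars hO hM (b.toSubmodule ⊔ Submodule.span k {y})
  obtain ⟨x₀, ⟨hx₀, hx₀'⟩, H⟩ := exists_generator_of_fg hO hfg ℓ₀
  have hmem : ∀ v : h, v ∈ b.toSubmodule ⊔ Submodule.span k {y} ↔ ∃ a ∈ b, ∃ c : k, v = a + c • y := by
    intro v
    rw [Submodule.mem_sup]
    constructor
    · rintro ⟨a, ha, v', hv', rfl⟩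
      obtain ⟨α, rfl⟩ := Submodule.mem_span_singleton.1 hv'
      exact ⟨a, ha, α, rfl⟩
    · rintro ⟨a, ha, c, rfl⟩
      exact ⟨a, ha, _, Submodule.smul_mem _ _ (Submodule.mem_span_singleton_self y), rfl⟩
  obtain ⟨d, hd, hd0, hdy⟩ := hspan y
  have hx0 : ℓ₀ x₀ ≠ 0 := by
    intro hx
    obtain ⟨c, -, e⟩ := H (d • y) ⟨hdy, (hmem _).2 ⟨0, zero_mem b, d, by simp⟩⟩
    rw [hx, mul_zero, map_smul, smul_eq_mul] at e
    exact (mul_ne_zero hd0 h0) e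
  refine ⟨x₀, (ℓ₀ x₀)⁻¹ • ℓ₀, hx₀, (hmem _).1 hx₀', ?_, ?_, ?_, ?_⟩
  · simp [hx0]
  · intro a ha; simp [h1 a ha]
  · simp [hx0, h0]
  · intro m hm hm'
    obtain ⟨c, hc, e⟩ := H m ⟨hm, (hmem _).2 hm'⟩
    rw [LinearMap.smul_apply, e, smul_eq_mul, mul_comm c, inv_mul_cancel_left₀ hx0]
    exact hc

/-- Induction on the codimension of `b`: an element `y` normalising `b` makes `b` an ideal of
codimension one in `b + k y`, and the powers of a lattice-adapted generator are composed with a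
relative basis for `b + k y`. -/
theorem exists_relBasis (hO : ∀ a : k, a ∈ O ∨ a⁻¹ ∈ O) [FiniteDimensional k h]
    [LieRing.IsNilpotent h] {M : Submodule O h} (hM : M.FG)
    (hspan : ∀ y : h, ∃ d ∈ O, d ≠ 0 ∧ d • y ∈ M) (hlie : ∀ a ∈ M, ∀ b ∈ M, ⁅a, b⁆ ∈ M)
    (b : LieSubalgebra k h) : Nonempty (RelBasis O b.incl M) := by
  induction hn : Module.finrank k h - Module.finrank k b using Nat.strong_induction_on
    generalizing b with
  | _ n ih =>
    by_cases hb : b = ⊤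
    · subst hb
      exact ⟨RelBasis.ofEquiv (LieSubalgebra.topEquiv (R := k) (L := h)) M⟩
    · have hb' : ¬ (⊤ : Submodule k h) ≤ b.toSubmodule := by
        intro hle
        exact hb (by ext v; exact ⟨fun _ => trivial, fun _ => hle trivial⟩)
      obtain ⟨y, -, hyb, hy⟩ := exists_lie_mem_of_isNilpotent b.toSubmodule ⊤ (b : Set h)
        (fun _ _ _ _ => trivial) hb'
      obtain ⟨x, ℓ, hxM, hx, hℓx, hℓb, hℓy, hℓM⟩ :=
        exists_lattice_complement hO hM hspan (b := b) (y := y) hyb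
      let b₁ := adjoinElement b y hy
      have hle : b ≤ b₁ := fun a ha => mem_adjoinElement.2 ⟨a, ha, 0, by simp⟩
      have hlt : Module.finrank k b < Module.finrank k b₁ := by
        refine Submodule.finrank_lt_finrank_of_lt (lt_of_le_of_ne hle fun e => hyb ?_)
        change y ∈ b.toSubmodule
        rw [e]
        exact mem_adjoinElement.2 ⟨0, zero_mem _, 1, by simp⟩
      obtain ⟨B⟩ := ih (Module.finrank k h - Module.finrank k b₁)
        (by have := Submodule.finrank_le b₁.toSubmodule
            change Module.finrank k b₁ ≤ _ at this
            omega) b₁ rfl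
      let C := CodimOne.ofSubalgebra hle x (mem_adjoinElement.2 hx) ℓ hℓx (by
        intro v hv
        obtain ⟨a, ha, c, rfl⟩ := mem_adjoinElement.1 hv
        rw [map_add, hℓb a ha, zero_add, map_smul, smul_eq_mul, mul_eq_zero, or_iff_left hℓy]
        constructor
        · rintro rfl; simpa using ha
        · intro h1
          by_contra hc
          have h2 : c • y ∈ b := by simpa using sub_mem h1 ha
          exact hyb (by simpa [hc] using b.smul_mem c⁻¹ h2)) (by
        obtain ⟨a', ha', c, rfl⟩ := hx
        intro a ha
        rw [add_lie, smul_lie, ← lie_skew]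
        exact add_mem (neg_mem (b.lie_mem ha ha')) (b.smul_mem _ (by
          rw [← lie_skew]; exact neg_mem (hy a ha))))
      exact ⟨B.comp (C.relBasis (zero_mem O) hxM
        (fun m hm => hℓM _ hm (mem_adjoinElement.1 m.2)) (fun v hv w hw => hlie _ hv _ hw))⟩

end Existence

/-! ### Functionals on induced modules -/

section Functionals

attribute [local instance 100] LieRing.ofAssociativeRing

open UniversalEnvelopingAlgebra (ι lift)
open Filter Topology

variable {k : Type*} [Field k] {O : Subring k}
variable {s h : Type*} [LieRing s] [LieAlgebra k s] [LieRing h] [LieAlgebra k h]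

/-- `φ` factors through the module induced from the character `f` of the subalgebra `b`. -/
def IsInd {E : Type*} [AddCommGroup E] [Module k E] (b : LieSubalgebra k h) (f : h →ₗ[k] k)
    (φ : UniversalEnvelopingAlgebra k h →ₗ[k] E) : Prop :=
  ∀ w, ∀ y ∈ b, φ (w * ι k y) = f y • φ w

theorem IsInd.comp_mulLeft {E : Type*} [AddCommGroup E] [Module k E] {b : LieSubalgebra k h}
    {f : h →ₗ[k] k} {φ : UniversalEnvelopingAlgebra k h →ₗ[k] E} (hφ : IsInd b f φ)
    (a : UniversalEnvelopingAlgebra k h) : IsInd b f (φ ∘ₗ LinearMap.mulLeft k a) := by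
  intro w y hy
  rw [LinearMap.comp_apply, LinearMap.mulLeft_apply, ← mul_assoc, hφ _ y hy]; rfl

theorem IsInd.mono {E : Type*} [AddCommGroup E] [Module k E] {b d : LieSubalgebra k h} (hd : d ≤ b)
    {f : h →ₗ[k] k} {φ : UniversalEnvelopingAlgebra k h →ₗ[k] E} (hφ : IsInd b f φ) : IsInd d f φ :=
  fun w y hy => hφ w y (hd hy)

variable (O) in
/-- The left ideal of the lattice `U(M)` generated by all `y - f(y)` with `y ∈ b ∩ M`. -/
def charIdeal (M : Submodule O h) (b : LieSubalgebra k h) (f : h →ₗ[k] k) :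
    Submodule (lat O 1 M) (UniversalEnvelopingAlgebra k h) :=
  Submodule.span _ {z | ∃ y ∈ b, y ∈ M ∧ z = ι k y - algebraMap k _ (f y)}

theorem IsInd.eq_zero_of_mem_charIdeal {E : Type*} [AddCommGroup E] [Module k E]
    {b : LieSubalgebra k h} {f : h →ₗ[k] k}
    {φ : UniversalEnvelopingAlgebra k h →ₗ[k] E} (hφ : IsInd b f φ) {M : Submodule O h}
    {w : UniversalEnvelopingAlgebra k h} (hw : w ∈ charIdeal O M b f) : φ w = 0 := by
  -- A left factor is carried along because `φ` itself is not linear over the lattice that acts on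
  -- the left ideal.
  have key : ∀ a, φ (a * w) = 0 := by
    induction hw using Submodule.span_induction with
    | mem x hx =>
      obtain ⟨y, hy, -, rfl⟩ := hx
      intro a
      rw [mul_sub, map_sub, hφ a y hy, ← Algebra.commutes, ← Algebra.smul_def, map_smul, sub_self]
    | zero => intro a; simp
    | add x y _ _ hx hy => intro a; rw [mul_add, map_add, hx, hy, add_zero]
    | smul c x _ hx =>
      intro a
      change φ (a * ((c : UniversalEnvelopingAlgebra k h) * x)) = 0
      rw [← mul_assoc, hx]
  simpa using key 1

variable (O) in
/-- A family of functionals on the module induced from the character `f` of `b`, together with a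
dual generating family, both adapted to all lattices generated by multiples of `M`. -/
structure DualBasis (M : Submodule O h) (b : LieSubalgebra k h) (f : h →ₗ[k] k) where
  I : Type
  deg : I → ℕ
  t : I → UniversalEnvelopingAlgebra k h
  φ : I → UniversalEnvelopingAlgebra k h →ₗ[k] k
  isInd : ∀ i, IsInd b f (φ i)
  φ_mem : ∀ q ∈ O, ∀ w ∈ lat O q M, ∀ i, ∃ c ∈ O, φ i w = q ^ deg i * c
  t_mem : ∀ q ∈ O, ∀ i, q ^ deg i • t i ∈ lat O q M
  repr : ∀ w ∈ lat O 1 M, ∃ S : Finset I, (∀ i ∉ S, φ i w = 0) ∧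
    w - ∑ i ∈ S, φ i w • t i ∈ charIdeal O M b f

/-- The character of `U(s)` given by a linear form that vanishes on brackets. -/
def charHom (j : s →ₗ⁅k⁆ h) (f : h →ₗ[k] k) (hf : ∀ a b : s, f (j ⁅a, b⁆) = 0) :
    UniversalEnvelopingAlgebra k s →ₐ[k] k :=
  lift k { f.comp (j : s →ₗ[k] h) with
    map_lie' := fun {x y} => by
      have h2 : ⁅f (j x), f (j y)⁆ = 0 := by
        rw [LieRing.of_associative_ring_bracket, mul_comm, sub_self]
      exact (hf x y).trans h2.symm }

theorem charHom_ι (j : s →ₗ⁅k⁆ h) (f : h →ₗ[k] k) (hf : ∀ a b : s, f (j ⁅a, b⁆) = 0) (a : s) :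
    charHom j f hf (ι k a) = f (j a) :=
  lift_ι _ a

theorem charHom_mem {j : s →ₗ⁅k⁆ h} {f : h →ₗ[k] k} (hf : ∀ a b : s, f (j ⁅a, b⁆) = 0)
    {M : Submodule O h} (hfM : ∀ a : s, j a ∈ M → f (j a) ∈ O) {q : k} (hq : q ∈ O)
    {u : UniversalEnvelopingAlgebra k s} (hu : u ∈ lat O q (comapLat O j M)) :
    charHom j f hf u ∈ O := by
  induction hu using lat_induction with
  | hι y hy =>
    rw [charHom_ι, map_smul, map_smul]
    exact mul_mem hq (hfM y hy)
  | hc c hc => rw [AlgHom.commutes]; exact hc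
  | hadd v w _ _ hv hw => rw [map_add]; exact add_mem hv hw
  | hmul v w _ _ hv hw => rw [map_mul]; exact mul_mem hv hw

theorem smul_mem_charIdeal {M : Submodule O h} {b : LieSubalgebra k h} {f : h →ₗ[k] k} {c : k}
    (hc : c ∈ O) {w : UniversalEnvelopingAlgebra k h} (hw : w ∈ charIdeal O M b f) :
    c • w ∈ charIdeal O M b f := by
  have := (charIdeal O M b f).smul_mem
    (⟨algebraMap k _ c, algebraMap_mem_lat hc⟩ : lat O 1 M) hw
  rw [Algebra.smul_def]
  exact this

theorem mul_mem_charIdeal {M : Submodule O h} {b : LieSubalgebra k h} {f : h →ₗ[k] k}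
    {a : UniversalEnvelopingAlgebra k h} (ha : a ∈ lat O 1 M)
    {w : UniversalEnvelopingAlgebra k h} (hw : w ∈ charIdeal O M b f) :
    a * w ∈ charIdeal O M b f :=
  (charIdeal O M b f).smul_mem (⟨a, ha⟩ : lat O 1 M) hw

/-- With `χ` the character, `v w - χ(v w) = v (w - χ(w)) + χ(w) (v - χ(v))`; both coefficients stay
in the lattice because `χ` is integral on it. -/
theorem envMap_sub_charHom_mem {j : s →ₗ⁅k⁆ h} {f : h →ₗ[k] k}
    (hf : ∀ a b : s, f (j ⁅a, b⁆) = 0)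
    {M : Submodule O h} (hfM : ∀ a : s, j a ∈ M → f (j a) ∈ O) {b : LieSubalgebra k h}
    (hj : ∀ a, j a ∈ b) {u : UniversalEnvelopingAlgebra k s}
    (hu : u ∈ lat O 1 (comapLat O j M)) :
    envMap j u - algebraMap k _ (charHom j f hf u) ∈ charIdeal O M b f := by
  induction hu using lat_induction with
  | hι y hy =>
    rw [charHom_ι, envMap_ι, one_smul]
    exact Submodule.subset_span ⟨_, hj y, hy, rfl⟩
  | hc c hc => rw [AlgHom.commutes, AlgHom.commutes]; simp
  | hadd v w _ _ hv hw =>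
    rw [map_add, map_add, map_add, add_sub_add_comm]
    exact add_mem hv hw
  | hmul v w h1 h2 hv hw =>
    have e : envMap j (v * w) - algebraMap k _ (charHom j f hf (v * w))
        = envMap j v * (envMap j w - algebraMap k _ (charHom j f hf w))
          + charHom j f hf w • (envMap j v - algebraMap k _ (charHom j f hf v)) := by
      rw [map_mul, map_mul, map_mul, mul_sub, smul_sub, Algebra.smul_def, Algebra.smul_def,
        Algebra.commutes _ (envMap j v), Algebra.commutes (charHom j f hf w)]
      abel
    rw [e]
    exact add_mem (mul_mem_charIdeal (envMap_mem_lat_of_comapLat h1) hw)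
      (smul_mem_charIdeal (charHom_mem hf hfM (one_mem O) h2) hv)

/-- The dual basis obtained from a relative basis. -/
def RelBasis.dualBasis {j : s →ₗ⁅k⁆ h} {M : Submodule O h} (B : RelBasis O j M)
    {b : LieSubalgebra k h} (hj : ∀ y, y ∈ b ↔ ∃ a, j a = y) {f : h →ₗ[k] k}
    (hf : ∀ a b : s, f (j ⁅a, b⁆) = 0) (hfM : ∀ a : s, j a ∈ M → f (j a) ∈ O) :
    DualBasis O M b f where
  I := B.I
  deg := B.deg
  t := B.t
  φ i := (charHom j f hf).toLinearMap ∘ₗ B.coord i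
  isInd i w y hy := by
    obtain ⟨a, rfl⟩ := (hj y).1 hy
    change charHom j f hf (B.coord i (w * _)) = _ * charHom j f hf (B.coord i w)
    rw [← envMap_ι, B.coord_mul, map_mul, charHom_ι, mul_comm]
  φ_mem q hq w hw i := by
    obtain ⟨u, hu, e⟩ := B.coord_mem q hq w hw i
    refine ⟨charHom j f hf u, charHom_mem hf hfM hq hu, ?_⟩
    change charHom j f hf (B.coord i w) = _
    rw [e, map_smul, smul_eq_mul]
  t_mem := B.t_mem
  repr w hw := by
    obtain ⟨S, hS, e⟩ := B.repr w
    refine ⟨S, fun i hi => ?_, ?_⟩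
    · change charHom j f hf (B.coord i w) = 0
      rw [hS i hi, map_zero]
    · have e₁ := congrArg
        (fun z => z - ∑ i ∈ S, ((charHom j f hf).toLinearMap ∘ₗ B.coord i) w • B.t i) e
      refine Eq.mpr (congrArg (· ∈ charIdeal O M b f) e₁) ?_
      rw [← Finset.sum_sub_distrib]
      refine sum_mem fun i _ => ?_
      change B.t i * envMap j (B.coord i w) - charHom j f hf (B.coord i w) • B.t i ∈ _
      rw [Algebra.smul_def, Algebra.commutes, ← mul_sub]
      obtain ⟨u, hu, e'⟩ := B.coord_mem 1 (one_mem O) w hw i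
      rw [one_pow, one_smul] at e'
      rw [e']
      have ht := B.t_mem 1 (one_mem O) i
      rw [one_pow, one_smul] at ht
      exact mul_mem_charIdeal ht (envMap_sub_charHom_mem hf hfM (fun a => (hj _).2 ⟨a, rfl⟩) hu)

namespace DualBasis

variable {M : Submodule O h} {b : LieSubalgebra k h} {f : h →ₗ[k] k} (B : DualBasis O M b f)

/-- After clearing denominators this is `repr`, since `φ` vanishes on the left ideal. The finite set
`S` depends on `w` alone and serves all `φ`, including those with values in a larger field. -/
theorem expand {E : Type*} [AddCommGroup E] [Module k E]
    (hO : ∀ c : k, ∃ d ∈ O, d ≠ 0 ∧ d * c ∈ O) (hM : ∀ y : h, ∃ d ∈ O, d ≠ 0 ∧ d • y ∈ M)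
    (w : UniversalEnvelopingAlgebra k h) :
    ∃ S : Finset B.I, ∀ φ : UniversalEnvelopingAlgebra k h →ₗ[k] E, IsInd b f φ →
      φ w = ∑ i ∈ S, B.φ i w • φ (B.t i) := by
  obtain ⟨d, -, hd0, hdw⟩ := exists_smul_mem_lat one_ne_zero hO hM w
  obtain ⟨S, -, hS⟩ := B.repr _ hdw
  refine ⟨S, fun φ hφ => ?_⟩
  have e := hφ.eq_zero_of_mem_charIdeal hS
  rw [map_sub, sub_eq_zero, map_smul, map_sum] at e
  simp only [map_smul, smul_eq_mul, mul_smul] at e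
  rw [← Finset.smul_sum] at e
  exact smul_right_injective E hd0 e

end DualBasis

end Functionals

/-! ### Null sequences of values -/

section Null

open Filter Topology

variable {E : Type*} [Field E] (v : AbsoluteValue E ℝ)

/-- The values of `θ` tend to zero along a filter. -/
def Null {G : Type*} (ℱ : Filter G) (θ : G → E) : Prop := Tendsto (fun x => v (θ x)) ℱ (𝓝 0)

variable {v} {G : Type*} {ℱ : Filter G}

theorem Null.zero : Null v ℱ (fun _ : G => (0 : E)) := by
  unfold Null
  simpa using tendsto_const_nhds

theorem Null.add {θ₁ θ₂ : G → E} (h₁ : Null v ℱ θ₁) (h₂ : Null v ℱ θ₂) :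
    Null v ℱ (fun x => θ₁ x + θ₂ x) := by
  refine squeeze_zero (fun x => v.nonneg _) (fun x => v.add_le _ _) ?_
  simpa using Tendsto.add h₁ h₂

theorem Null.const_mul {θ : G → E} (c : E) (h : Null v ℱ θ) : Null v ℱ (fun x => c * θ x) := by
  unfold Null
  simpa using Tendsto.const_mul (v c) h

theorem Null.sub {θ₁ θ₂ : G → E} (h₁ : Null v ℱ θ₁) (h₂ : Null v ℱ θ₂) :
    Null v ℱ (fun x => θ₁ x - θ₂ x) := by
  have := h₁.add (h₂.const_mul (-1))
  simpa [sub_eq_add_neg] using this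

theorem Null.sum {ι : Type*} (S : Finset ι) {θ : ι → G → E} (h : ∀ i ∈ S, Null v ℱ (θ i)) :
    Null v ℱ (fun x => ∑ i ∈ S, θ i x) := by
  classical
  induction S using Finset.induction_on with
  | empty => simpa using Null.zero
  | insert i S hi ih =>
    simp only [Finset.sum_insert hi]
    exact (h i (Finset.mem_insert_self _ _)).add
      (ih fun j hj => h j (Finset.mem_insert_of_mem hj))

/-- `ℱ` is a Cauchy filter for the `p`-adic topology given by `Λ`. -/
def CauchyFor [AddCommGroup G] (p : ℕ) (ℱ : Filter G) (Λ : Set G) : Prop :=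
  ∀ m : ℕ, ∀ᶠ x in ℱ, ∀ᶠ y in ℱ, ∃ z ∈ Λ, x - y = p ^ m • z

theorem CauchyFor.mono [AddCommGroup G] {p : ℕ} {Λ Λ' : Set G} (hc : CauchyFor p ℱ Λ)
    (hΛ : Λ ⊆ Λ') : CauchyFor p ℱ Λ' := fun m =>
  (hc m).mono fun _ hx => hx.mono fun _ ⟨z, hz, e⟩ => ⟨z, hΛ hz, e⟩

/-- Null functionals are closed under equibounded limits that are locally eventually constant. -/
theorem Null.of_equibounded [AddCommGroup G] [NeBot ℱ] (hv : IsNonarchimedean v) {p : ℕ}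
    (hp : v (p : E) < 1) {Λ : Set G}
    (hc : CauchyFor p ℱ Λ) {ι : Type*} (θ : G → E) (θs : ι → G →+ E) {C : ℝ}
    (hC : ∀ i, ∀ z ∈ Λ, v (θs i z) ≤ C) (hnull : ∀ i, Null v ℱ (θs i))
    (hθ : ∀ x, ∃ i, θs i x = θ x) : Null v ℱ θ := by
  rw [Null, Metric.tendsto_nhds]
  intro ε hε
  have hlim : Tendsto (fun m : ℕ => v (p : E) ^ m * C) atTop (𝓝 (0 * C)) :=
    (tendsto_pow_atTop_nhds_zero_of_lt_one (v.nonneg _) hp).mul_const _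
  rw [zero_mul] at hlim
  obtain ⟨m, hm⟩ := (hlim.eventually (gt_mem_nhds hε)).exists
  filter_upwards [hc m] with x hx
  -- The index `i` is fixed by `x` before `y` is chosen, so only the nullity of one `θs i` is used
  -- at a time; the common bound `C` controls the remaining `pᵐ θs i z`.
  obtain ⟨i, hi⟩ := hθ x
  have h1 := (hnull i).eventually (gt_mem_nhds hε)
  obtain ⟨y, ⟨z, hz, e⟩, hy⟩ := (hx.and h1).exists
  have e' : θ x = θs i y + p ^ m * θs i z := by
    rw [← hi, ← sub_add_cancel x y, e, map_add, map_nsmul, nsmul_eq_mul, Nat.cast_pow, add_comm]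
  rw [dist_zero_right, Real.norm_eq_abs, abs_of_nonneg (v.nonneg _), e']
  refine (hv _ _).trans_lt (max_lt hy ?_)
  rw [map_mul, map_pow]
  exact (mul_le_mul_of_nonneg_left (hC i z hz) (pow_nonneg (v.nonneg _) m)).trans_lt hm

end Null

/-! ### Change of polarisation: the adjacent case -/

section Adjacent

attribute [local instance 100] LieRing.ofAssociativeRing

open UniversalEnvelopingAlgebra (ι lift)
open Filter Topology

variable {k : Type*} [Field k] {O : Subring k} {v : AbsoluteValue k ℝ} {p : ℕ}
variable {h : Type*} [LieRing h] [LieAlgebra k h]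

/-- `O` is the valuation ring of a nonarchimedean absolute value with residue characteristic `p`,
and `M` is a finitely generated Lie lattice over `O`. -/
structure IsGoodLattice (v : AbsoluteValue k ℝ) (p : ℕ) (M : Submodule O h) : Prop where
  nonarch : IsNonarchimedean v
  mem_iff : ∀ x, x ∈ O ↔ v x ≤ 1
  p_lt : v (p : k) < 1
  fg : M.FG
  span : ∀ y : h, ∃ d ∈ O, d ≠ 0 ∧ d • y ∈ M
  lie : ∀ a ∈ M, ∀ b ∈ M, ⁅a, b⁆ ∈ M

namespace IsGoodLattice

variable {M : Submodule O h} (H : IsGoodLattice v p M)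

include H in
theorem mem_or_inv_mem (a : k) : a ∈ O ∨ a⁻¹ ∈ O := by
  rw [H.mem_iff, H.mem_iff, map_inv₀]
  rcases le_total (v a) 1 with h | h
  · exact Or.inl h
  · exact Or.inr (inv_le_one_of_one_le₀ h)

include H in
theorem exists_mul_mem (c : k) : ∃ d ∈ O, d ≠ 0 ∧ d * c ∈ O := by
  rcases H.mem_or_inv_mem c with h | h
  · exact ⟨1, one_mem O, one_ne_zero, by rwa [one_mul]⟩
  · by_cases hc : c = 0
    · exact ⟨1, one_mem O, one_ne_zero, by rw [hc, mul_zero]; exact zero_mem O⟩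
    · exact ⟨c⁻¹, h, inv_ne_zero hc, by rw [inv_mul_cancel₀ hc]; exact one_mem O⟩

include H in
theorem exists_smul_mem_lat {q : k} (hq : q ≠ 0) (a : UniversalEnvelopingAlgebra k h) :
    ∃ d ∈ O, d ≠ 0 ∧ d • a ∈ lat O q M :=
  AffinoidDixmier.exists_smul_mem_lat hq H.exists_mul_mem H.span a

end IsGoodLattice

/-- `φ` is bounded on the subset `Λ`. -/
def BddOn {G E : Type*} [Field E] (v : AbsoluteValue E ℝ) (Λ : Set G) (φ : G → E) : Prop :=
  ∃ C : ℝ, ∀ w ∈ Λ, v (φ w) ≤ C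

theorem bddOn_comp_mul {E : Type*} [Field E] [Algebra k E] {vE : AbsoluteValue E ℝ}
    {M : Submodule O h} (H : IsGoodLattice v p M) {q : k} (hq : q ≠ 0)
    {φ : UniversalEnvelopingAlgebra k h →ₗ[k] E} (hφ : BddOn vE (lat O q M : Set _) φ)
    (a b : UniversalEnvelopingAlgebra k h) : BddOn vE (lat O q M : Set _) fun w => φ (a * w * b) := by
  obtain ⟨C, hC⟩ := hφ
  obtain ⟨d, -, hd0, hd⟩ := H.exists_smul_mem_lat hq a
  obtain ⟨e, -, he0, he⟩ := H.exists_smul_mem_lat hq b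
  have hde : algebraMap k E (d * e) ≠ 0 := by
    rw [Ne, map_eq_zero]; exact mul_ne_zero hd0 he0
  refine ⟨(vE (algebraMap k E (d * e)))⁻¹ * C, fun w hw => ?_⟩
  have h1 := hC _ (mul_mem (mul_mem hd hw) he)
  have e1 : d • a * w * e • b = (d * e) • (a * w * b) := by
    rw [smul_mul_assoc, smul_mul_assoc, mul_smul_comm, mul_smul]
  rw [e1, map_smul, Algebra.smul_def, map_mul] at h1
  rwa [← div_eq_inv_mul, le_div_iff₀ (vE.pos hde), mul_comm]

theorem bddOn_comp_mul_right {E : Type*} [Field E] [Algebra k E] {vE : AbsoluteValue E ℝ}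
    {M : Submodule O h} (H : IsGoodLattice v p M) {q : k} (hq : q ≠ 0)
    {φ : UniversalEnvelopingAlgebra k h →ₗ[k] E} (hφ : BddOn vE (lat O q M : Set _) φ)
    (b : UniversalEnvelopingAlgebra k h) : BddOn vE (lat O q M : Set _) fun w => φ (w * b) := by
  simpa using bddOn_comp_mul H hq hφ 1 b

theorem BddOn.sub {G E : Type*} [Field E] {v : AbsoluteValue E ℝ} {Λ : Set G} {φ ψ : G → E}
    (hφ : BddOn v Λ φ) (hψ : BddOn v Λ ψ) : BddOn v Λ fun w => φ w - ψ w := by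
  obtain ⟨C, hC⟩ := hφ
  obtain ⟨D, hD⟩ := hψ
  exact ⟨C + D, fun w hw => (v.sub_le_add _ _).trans (add_le_add (hC w hw) (hD w hw))⟩

theorem BddOn.const_mul {G E : Type*} [Field E] {v : AbsoluteValue E ℝ} {Λ : Set G} {φ : G → E}
    (c : E) (hφ : BddOn v Λ φ) : BddOn v Λ fun w => c * φ w := by
  obtain ⟨C, hC⟩ := hφ
  refine ⟨v c * C, fun w hw => ?_⟩
  rw [map_mul]
  exact mul_le_mul_of_nonneg_left (hC w hw) (v.nonneg c)

theorem IsNonarchimedean.sum_le {E ι : Type*} [Field E] {v : AbsoluteValue E ℝ}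
    (hv : IsNonarchimedean v) (S : Finset ι) (g : ι → E) {C : ℝ} (hC : 0 ≤ C)
    (hg : ∀ i ∈ S, v (g i) ≤ C) : v (∑ i ∈ S, g i) ≤ C := by
  classical
  induction S using Finset.induction_on with
  | empty => simpa using hC
  | insert i S hi ih =>
    rw [Finset.sum_insert hi]
    exact (hv _ _).trans (max_le (hg i (Finset.mem_insert_self _ _))
      (ih fun j hj => hg j (Finset.mem_insert_of_mem hj)))

/-- If all functionals of a dual basis are null along a Cauchy filter, then so is every functional
that is bounded on a multiple of the lattice. -/
theorem DualBasis.null {E : Type*} [Field E] [Algebra k E] {vE : AbsoluteValue E ℝ}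
    (hE : IsNonarchimedean vE) (hEv : ∀ c, vE (algebraMap k E c) = v c)
    {M : Submodule O h} (H : IsGoodLattice v p M) {b : LieSubalgebra k h} {f : h →ₗ[k] k}
    (B : DualBasis O M b f) {G : Type*} [AddCommGroup G] {ℱ : Filter G} [NeBot ℱ] {Λ : Set G}
    (hc : CauchyFor p ℱ Λ) (T : G →+ UniversalEnvelopingAlgebra k h) {q : k} (hq : q ∈ O)
    {d : k} (hd : d ≠ 0) (hT : ∀ z ∈ Λ, d • T z ∈ lat O q M)
    {φ : UniversalEnvelopingAlgebra k h →ₗ[k] E} (hφ : IsInd b f φ)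
    (hφb : BddOn vE (lat O q M : Set _) φ) (hnull : ∀ i, Null v ℱ fun x => B.φ i (T x)) :
    Null vE ℱ fun x => φ (T x) := by
  obtain ⟨C, hC⟩ := hφb
  have hC0 : 0 ≤ C := (vE.nonneg _).trans (hC 1 (one_mem (lat O q M)))
  refine Null.of_equibounded hE (p := p) (by
      rw [← map_natCast (algebraMap k E), hEv]; exact H.p_lt) hc _
    (fun S : Finset B.I => ∑ i ∈ S,
      ((((B.φ i).smulRight (φ (B.t i))).toAddMonoidHom).comp T)) (C := (v d)⁻¹ * C) ?_ ?_ ?_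
  · intro S z hz
    rw [AddMonoidHom.finsetSum_apply]
    refine IsNonarchimedean.sum_le hE _ _ (mul_nonneg (inv_nonneg.2 (v.nonneg d)) hC0)
      fun i _ => ?_
    change vE (B.φ i (T z) • φ (B.t i)) ≤ _
    obtain ⟨c, hcO, e⟩ := B.φ_mem q hq _ (hT z hz) i
    have h1 := hC _ (B.t_mem q hq i)
    -- The power of `q` gained by the coordinate functional is moved onto the basis element, where
    -- it brings `tᵢ` into the lattice on which `φ` is bounded. Hence the bound does not depend on
    -- `i`.
    have e2 : d • (B.φ i (T z) • φ (B.t i)) = c • φ (q ^ B.deg i • B.t i) := by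
      rw [← smul_assoc, ← map_smul (B.φ i), e, map_smul, ← mul_smul, mul_comm]
    have h2 : v d * vE (B.φ i (T z) • φ (B.t i)) ≤ C := by
      rw [← hEv, ← map_mul, ← Algebra.smul_def, e2, Algebra.smul_def, map_mul, hEv]
      exact (mul_le_of_le_one_left (vE.nonneg _) ((H.mem_iff c).1 hcO)).trans h1
    rwa [← div_eq_inv_mul, le_div_iff₀ (v.pos hd), mul_comm]
  · intro S
    have : Null vE ℱ fun x => ∑ i ∈ S, φ (B.t i) * algebraMap k E (B.φ i (T x)) := by
      refine Null.sum S fun i _ => Null.const_mul _ ?_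
      unfold Null
      simp only [hEv]
      exact hnull i
    convert this using 2 with x
    rw [AddMonoidHom.finsetSum_apply]
    refine Finset.sum_congr rfl fun i _ => ?_
    change B.φ i (T x) • φ (B.t i) = _
    rw [Algebra.smul_def, mul_comm]
  · intro x
    obtain ⟨S, hS⟩ := B.expand (E := E) H.exists_mul_mem H.span (T x)
    refine ⟨S, ?_⟩
    rw [hS φ hφ, AddMonoidHom.finsetSum_apply]
    rfl

/-- The filter `ℱ` converges to an element that annihilates the completed module induced from the
character `f` of `b`. -/
def Kill (v : AbsoluteValue k ℝ) (ℱ : Filter (UniversalEnvelopingAlgebra k h)) (M : Submodule O h)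
    (b : LieSubalgebra k h) (f : h →ₗ[k] k) : Prop :=
  ∀ φ : UniversalEnvelopingAlgebra k h →ₗ[k] k, IsInd b f φ → BddOn v (lat O 1 M : Set _) φ →
    ∀ a, Null v ℱ fun x => φ (x * a)

theorem Kill.mono {ℱ : Filter (UniversalEnvelopingAlgebra k h)} {M : Submodule O h}
    {b d : LieSubalgebra k h} {f : h →ₗ[k] k} (hd : d ≤ b) (hK : Kill v ℱ M d f) :
    Kill v ℱ M b f :=
  fun φ hφ hb a => hK φ (hφ.mono hd) hb a

/-! ### Weyl algebra relations on functionals. -/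

section Weyl

variable {d : LieSubalgebra k h} {f : h →ₗ[k] k} {x y : h}

/-- Right multiplication by `y` commutes with that by `a ∈ d` up to `[a, y]`, which lies in `d` and
on which `f` vanishes. -/
theorem IsInd.comp_mulRight {φ : UniversalEnvelopingAlgebra k h →ₗ[k] k} (hφ : IsInd d f φ)
    (hyd : ∀ a ∈ d, ⁅a, y⁆ ∈ d) (hfy : ∀ a ∈ d, f ⁅a, y⁆ = 0) (c : k) :
    IsInd d f (φ ∘ₗ LinearMap.mulRight k (ι k y - algebraMap k _ c)) := by
  intro w a ha
  have e : w * ι k a * (ι k y - algebraMap k _ c)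
      = w * (ι k y - algebraMap k _ c) * ι k a + w * ι k ⁅a, y⁆ := by
    rw [LieHom.map_lie, LieRing.of_associative_ring_bracket]
    simp only [mul_sub, sub_mul, mul_assoc]
    rw [Algebra.commutes c (ι k a)]
    abel
  change φ (w * ι k a * (ι k y - algebraMap k _ c)) = _
  rw [e, map_add, hφ _ a ha, hφ _ _ (hyd a ha), hfy a ha, zero_smul, add_zero]
  rfl

theorem IsInd.comp_mulRight_pow {φ : UniversalEnvelopingAlgebra k h →ₗ[k] k} (hφ : IsInd d f φ)
    (hyd : ∀ a ∈ d, ⁅a, y⁆ ∈ d) (hfy : ∀ a ∈ d, f ⁅a, y⁆ = 0) (c : k) (m : ℕ) :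
    IsInd d f (φ ∘ₗ LinearMap.mulRight k ((ι k y - algebraMap k _ c) ^ m)) := by
  induction m with
  | zero =>
    have e : φ ∘ₗ LinearMap.mulRight k ((ι k y - algebraMap k _ c) ^ 0) = φ := by ext w; simp
    rwa [e]
  | succ m ih =>
    have := ih.comp_mulRight hyd hfy c
    have e : (φ ∘ₗ LinearMap.mulRight k ((ι k y - algebraMap k _ c) ^ m)) ∘ₗ
        LinearMap.mulRight k (ι k y - algebraMap k _ c)
        = φ ∘ₗ LinearMap.mulRight k ((ι k y - algebraMap k _ c) ^ (m + 1)) := by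
      ext w
      simp only [LinearMap.comp_apply, LinearMap.mulRight_apply, mul_assoc, pow_succ']
    rwa [e] at this

variable (hyd : ∀ a ∈ d, ⁅a, y⁆ ∈ d) (hfy : ∀ a ∈ d, f ⁅a, y⁆ = 0) (hxy : ⁅x, y⁆ ∈ d)

-- Moving `x - f(x)` to the right past `yᵐ` produces `m` copies of `[x, y]`, which acts by the
-- scalar `f [x, y]`, until `x - f(x)` meets the end and dies. So it acts as `f [x, y]` times the
-- derivative in `y`; for `m = 0` the factor `m` neutralises the truncated exponent.
include hyd hfy hxy in
theorem weyl_relation {ψ : UniversalEnvelopingAlgebra k h →ₗ[k] k} (hψ : IsInd d f ψ)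
    (hψx : ∀ w, ψ (w * (ι k x - algebraMap k _ (f x))) = 0) (m : ℕ)
    (w : UniversalEnvelopingAlgebra k h) :
    ψ (w * (ι k x - algebraMap k _ (f x)) * ι k y ^ m)
      = m * f ⁅x, y⁆ * ψ (w * ι k y ^ (m - 1)) := by
  induction m generalizing w with
  | zero => rw [pow_zero, mul_one, hψx, Nat.cast_zero, zero_mul, zero_mul]
  | succ m ih =>
    have e : w * (ι k x - algebraMap k _ (f x)) * ι k y ^ (m + 1)
        = w * ι k y * (ι k x - algebraMap k _ (f x)) * ι k y ^ m + w * ι k ⁅x, y⁆ * ι k y ^ m := by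
      rw [LieHom.map_lie, LieRing.of_associative_ring_bracket, pow_succ']
      simp only [mul_sub, sub_mul, mul_assoc]
      rw [← mul_assoc (algebraMap k _ (f x)), Algebra.commutes (f x) (ι k y), mul_assoc]
      abel
    have h1 := hψ.comp_mulRight_pow hyd hfy 0 m w _ hxy
    simp only [LinearMap.comp_apply, LinearMap.mulRight_apply, map_zero, sub_zero,
      smul_eq_mul] at h1
    rw [e, map_add, ih, h1]
    rcases m with _ | m
    · simp
    · rw [Nat.add_sub_cancel, Nat.add_sub_cancel, mul_assoc w, ← pow_succ']
      push_cast
      ring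

include hyd hfy hxy in
theorem weyl_relation_pow {ψ : UniversalEnvelopingAlgebra k h →ₗ[k] k} (hψ : IsInd d f ψ)
    (hψx : ∀ w, ψ (w * (ι k x - algebraMap k _ (f x))) = 0) (m : ℕ)
    (w : UniversalEnvelopingAlgebra k h) :
    ψ (w * (ι k x - algebraMap k _ (f x)) ^ m * ι k y ^ m) = m.factorial * f ⁅x, y⁆ ^ m * ψ w := by
  induction m with
  | zero => simp
  | succ m ih =>
    rw [pow_succ, ← mul_assoc, weyl_relation hyd hfy hxy hψ hψx, Nat.add_sub_cancel, ih,
      Nat.factorial_succ]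
    push_cast
    ring

variable {b : LieSubalgebra k h} (hb : ∀ u ∈ b, ∃ a ∈ d, ∃ c : k, u = a + c • x)
  (hxd : ∀ a ∈ d, ⁅a, x⁆ ∈ d) (hfx : ∀ a ∈ d, f ⁅a, x⁆ = 0) (hfxy : f ⁅x, y⁆ ≠ 0)

-- Induction on the order of nilpotency. If `(x - f(x))ᵐ⁺¹` kills `φ`, then `ψ = φ(· (x - f(x))ᵐ)`
-- is induced from `b`, so `Kill` applies to it. Subtracting a multiple of `ψ(· yᵐ)` from `φ` lowers
-- the order by one, by the Weyl relation.
include hb hxd hfx hyd hfy hxy hfxy in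
theorem Kill.null_of_nilpotent [CharZero k] {M : Submodule O h} (H : IsGoodLattice v p M)
    {ℱ : Filter (UniversalEnvelopingAlgebra k h)} (hK : Kill v ℱ M b f) (m : ℕ)
    {φ : UniversalEnvelopingAlgebra k h →ₗ[k] k} (hφ : IsInd d f φ)
    (hφb : BddOn v (lat O 1 M : Set _) φ)
    (hφx : ∀ w, φ (w * (ι k x - algebraMap k _ (f x)) ^ m) = 0)
    (a : UniversalEnvelopingAlgebra k h) : Null v ℱ fun z => φ (z * a) := by
  induction m generalizing φ with
  | zero =>
    have e : ∀ w, φ w = 0 := fun w => by simpa using hφx w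
    simp only [e]
    exact Null.zero
  | succ m ih =>
    let ψ := φ ∘ₗ LinearMap.mulRight k ((ι k x - algebraMap k _ (f x)) ^ m)
    have hψd : IsInd d f ψ := hφ.comp_mulRight_pow hxd hfx (f x) m
    have hψx : ∀ w, ψ (w * (ι k x - algebraMap k _ (f x))) = 0 := by
      intro w
      change φ (w * _ * _) = 0
      rw [mul_assoc, ← pow_succ', hφx]
    have hψ : IsInd b f ψ := by
      intro w u hu
      obtain ⟨a, ha, c, rfl⟩ := hb u hu
      have h1 := hψx w
      rw [mul_sub, map_sub, sub_eq_zero, ← Algebra.commutes, ← Algebra.smul_def, map_smul] at h1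
      rw [map_add, map_smul, mul_add, map_add, hψd w a ha, mul_smul_comm, map_smul, h1, map_add,
        add_smul, map_smul, smul_assoc]
    have hψb : BddOn v (lat O 1 M : Set _) ψ := bddOn_comp_mul_right H one_ne_zero hφb _
    -- The inverse of the scalar by which `(x - f(x))ᵐ` followed by `yᵐ` acts on `ψ`; it exists
    -- because the characteristic is zero and `f [x, y] ≠ 0`.
    let c : k := (m.factorial * f ⁅x, y⁆ ^ m)⁻¹
    have hc : (m.factorial * f ⁅x, y⁆ ^ m : k) ≠ 0 :=
      mul_ne_zero (Nat.cast_ne_zero.2 m.factorial_ne_zero) (pow_ne_zero m hfxy)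
    let φ' := φ - c • (ψ ∘ₗ LinearMap.mulRight k (ι k y ^ m))
    have h1 : IsInd d f φ' := by
      intro w a ha
      have h2 := hψd.comp_mulRight_pow hyd hfy 0 m w a ha
      rw [map_zero, sub_zero] at h2
      simp only [φ', LinearMap.sub_apply, LinearMap.smul_apply, h2, hφ w a ha]
      simp only [smul_eq_mul]
      ring
    have h2 : BddOn v (lat O 1 M : Set _) φ' :=
      hφb.sub ((bddOn_comp_mul_right H one_ne_zero hψb _).const_mul c)
    have h3 := ih h1 h2 (fun w => by
      change φ (w * _) - c * ψ (w * _ * ι k y ^ m) = 0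
      rw [weyl_relation_pow hyd hfy hxy hψd hψx, inv_mul_cancel_left₀ hc]
      exact sub_self _)
    have h4 := h3.add ((hK ψ hψ hψb (a * ι k y ^ m)).const_mul c)
    convert h4 using 2 with z
    change φ (z * a) = φ (z * a) - c * ψ (z * a * ι k y ^ m) + _
    rw [mul_assoc]
    ring

end Weyl

/-- Composed with the character, the derivation `D = ad x` disappears because `f [x, d] = 0`, and
the scalar `f(x)` cancels the centre of the expansion. What remains of right multiplication by `x -
f(x)` is the shift of degrees by one. -/
theorem CodimOne.charHom_coords_mul_pow {d b : LieSubalgebra k h} {hd : d ≤ b}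
    (S : CodimOne (LieSubalgebra.inclusion hd)) (f : h →ₗ[k] k)
    (hf : ∀ a b : d, f (d.incl ⁅a, b⁆) = 0) (hfx : ∀ a : d, f ⁅(S.x : h), (a : h)⁆ = 0) (m i : ℕ)
    (u : UniversalEnvelopingAlgebra k b) (him : i < m) :
    charHom d.incl f hf
      (S.coords (f S.x) (u * (ι k S.x - algebraMap k _ (f S.x)) ^ m) i) = 0 := by
  have hder : ∀ w, charHom d.incl f hf (envDer S.D w) = 0 := by
    intro w
    induction w using env_induction with
    | hι y =>
      rw [envDer_ι, charHom_ι]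
      have e : (d.incl (S.D y) : h) = ⁅(S.x : h), (y : h)⁆ := congrArg Subtype.val (S.j_D y)
      rw [e, hfx]
    | hc c => rw [envDer_algebraMap, map_zero]
    | hadd v w hv hw => rw [map_add, map_add, hv, hw, add_zero]
    | hmul v w hv hw => rw [envDer_mul, map_add, map_mul, map_mul, hv, hw]; ring
  have hstep : ∀ w : UniversalEnvelopingAlgebra k b, S.coords (f S.x)
      (w * (ι k S.x - algebraMap k _ (f S.x)))
      = S.rmulX (f S.x) (S.coords (f S.x) w) - f S.x • S.coords (f S.x) w := by
    intro w
    rw [mul_sub, map_sub, S.coords_mul_x, ← Algebra.commutes, ← Algebra.smul_def, map_smul]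
  induction m generalizing i with
  | zero => omega
  | succ m ih =>
    rw [pow_succ, ← mul_assoc, hstep, Finsupp.sub_apply, Finsupp.smul_apply]
    rcases i with _ | i
    · rw [S.rmulX_apply_zero, map_sub, map_sub, hder, sub_zero, sub_self]
    · rw [S.rmulX_apply_succ, map_sub, map_sub, map_add, hder, ih i (by omega)]
      simp

/-- The dual basis for `d` is taken through the chain `d ⊂ b ⊂ h`. Each of its functionals is killed
by a power of `x - f(x)`, so `Kill.null_of_nilpotent` applies to it, and `DualBasis.null` passes to
all bounded functionals. -/
theorem Kill.of_codimOne [CharZero k] [FiniteDimensional k h] [LieRing.IsNilpotent h]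
    {M : Submodule O h} (H : IsGoodLattice v p M)
    {ℱ : Filter (UniversalEnvelopingAlgebra k h)} [NeBot ℱ]
    (hc : CauchyFor p ℱ (lat O 1 M : Set _)) {f : h →ₗ[k] k} (hfM : ∀ m ∈ M, f m ∈ O)
    {d b : LieSubalgebra k h} (hdb : d ≤ b) {x y : h} (hxb : x ∈ b)
    (hb : ∀ u ∈ b, ∃ a ∈ d, ∃ c : k, u = a + c • x)
    (hd : ∀ a ∈ d, ∀ c ∈ d, f ⁅a, c⁆ = 0)
    (hxd : ∀ a ∈ d, ⁅a, x⁆ ∈ d) (hfx : ∀ a ∈ d, f ⁅a, x⁆ = 0)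
    (hyd : ∀ a ∈ d, ⁅a, y⁆ ∈ d) (hfy : ∀ a ∈ d, f ⁅a, y⁆ = 0)
    (hxy : ⁅x, y⁆ ∈ d) (hfxy : f ⁅x, y⁆ ≠ 0)
    (hK : Kill v ℱ M b f) : Kill v ℱ M d f := by
  have hx : x ∉ d := fun hx => hfxy (hfy x hx)
  obtain ⟨x₀, ℓ, hx₀M, hx₀, hℓx, hℓd, hℓx', hℓM⟩ :=
    exists_lattice_complement H.mem_or_inv_mem H.fg H.span (b := d) (y := x) hx
  obtain ⟨a₀, ha₀, α, e₀⟩ := hx₀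
  have hα : α ≠ 0 := by
    rintro rfl
    rw [e₀, zero_smul, add_zero, hℓd a₀ ha₀] at hℓx
    exact zero_ne_one hℓx
  have hx₀b : x₀ ∈ b := by rw [e₀]; exact add_mem (hdb ha₀) (b.smul_mem _ hxb)
  have hb₀ : ∀ u ∈ b, ∃ a ∈ d, ∃ c : k, u = a + c • x₀ := by
    intro u hu
    obtain ⟨a, ha, c, rfl⟩ := hb u hu
    refine ⟨a - (c * α⁻¹) • a₀, sub_mem ha (d.smul_mem _ ha₀), c * α⁻¹, ?_⟩
    rw [e₀, smul_add, ← mul_smul, inv_mul_cancel_right₀ hα]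
    abel
  have hx₀d : ∀ a ∈ d, ⁅a, x₀⁆ ∈ d := by
    intro a ha
    rw [e₀, lie_add, lie_smul]
    exact add_mem (d.lie_mem ha ha₀) (d.smul_mem _ (hxd a ha))
  have hfx₀ : ∀ a ∈ d, f ⁅a, x₀⁆ = 0 := by
    intro a ha
    rw [e₀, lie_add, lie_smul, map_add, map_smul, hd a ha a₀ ha₀, hfx a ha, smul_zero, add_zero]
  have hx₀y : ⁅x₀, y⁆ ∈ d := by
    rw [e₀, add_lie, smul_lie]
    exact add_mem (hyd a₀ ha₀) (d.smul_mem _ hxy)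
  have hfx₀y : f ⁅x₀, y⁆ ≠ 0 := by
    rw [e₀, add_lie, smul_lie, map_add, hfy a₀ ha₀, map_smul, zero_add]
    exact mul_ne_zero hα hfxy
  obtain ⟨B⟩ := exists_relBasis H.mem_or_inv_mem H.fg H.span H.lie b
  let S : CodimOne (LieSubalgebra.inclusion hdb) :=
    CodimOne.ofSubalgebra hdb x₀ hx₀b ℓ hℓx (by
      intro u hu
      obtain ⟨a, ha, c, rfl⟩ := hb₀ u hu
      rw [map_add, hℓd a ha, zero_add, map_smul, hℓx, smul_eq_mul, mul_one]
      constructor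
      · rintro rfl; simpa using ha
      · intro h1
        by_contra hc
        have h2 : c • x₀ ∈ d := by simpa using sub_mem h1 ha
        have h3 := d.smul_mem c⁻¹ h2
        rw [inv_smul_smul₀ hc] at h3
        exact one_ne_zero (hℓx.symm.trans (hℓd _ h3))) (by
      intro a ha
      rw [← lie_skew]
      exact neg_mem (hx₀d a ha))
  -- The expansion in `b` over `d` is centred at `f x₀`: only then do powers of `x₀ - f x₀`
  -- annihilate the dual functionals from the right.
  let R := B.comp (S.relBasis (M := comapLat O b.incl M) (c := f x₀) (hfM _ hx₀M) hx₀M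
    (fun m hm => hℓM _ hm (hb m m.2)) (fun u hu w hw => H.lie _ hu _ hw))
  have hf : ∀ a b : d, f (d.incl ⁅a, b⁆) = 0 := fun a b => hd a a.2 b b.2
  let D : DualBasis O M d f := RelBasis.dualBasis (j := d.incl) R
    (fun y => ⟨fun hy => ⟨⟨y, hy⟩, rfl⟩, fun ⟨a, ha⟩ => ha ▸ a.2⟩) hf (fun a ha => hfM _ ha)
  have hD : ∀ i, ∃ m, ∀ w, D.φ i (w * (ι k x₀ - algebraMap k _ (f x₀)) ^ m) = 0 := by
    rintro ⟨i, l⟩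
    change ℕ at l
    -- The coordinate of degree `l` survives multiplication by the `l`-th power, hence the exponent
    -- `l + 1`.
    refine ⟨l + 1, fun w => ?_⟩
    change charHom d.incl f hf (S.coords (f x₀) (B.coord i (w * _)) l) = 0
    have e : (ι k x₀ - algebraMap k (UniversalEnvelopingAlgebra k h) (f x₀)) ^ (l + 1)
        = envMap b.incl ((ι k S.x - algebraMap k _ (f x₀)) ^ (l + 1)) := by
      rw [map_pow, map_sub, envMap_ι, AlgHom.commutes]; rfl
    rw [e, B.coord_mul]
    exact S.charHom_coords_mul_pow f hf (fun a => by
      rw [← lie_skew, map_neg, neg_eq_zero]; exact hfx₀ a a.2) _ _ _ (Nat.lt_succ_self _)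
  intro φ hφ hφb a
  obtain ⟨δ, -, hδ0, hδ⟩ := H.exists_smul_mem_lat one_ne_zero a
  refine D.null H.nonarch (fun c => rfl) H hc (AddMonoidHom.mulRight a) (one_mem O) hδ0
    (fun z hz => ?_) hφ hφb fun i => ?_
  · change δ • (z * a) ∈ _
    rw [← mul_smul_comm]
    exact mul_mem hz hδ
  · obtain ⟨m, hm⟩ := hD i
    refine Kill.null_of_nilpotent hyd hfy hx₀y hb₀ hx₀d hfx₀ hfx₀y H hK m (D.isInd i) ⟨1, ?_⟩ hm a
    intro w hw
    obtain ⟨c, hc, e⟩ := D.φ_mem 1 (one_mem O) w hw i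
    rw [e, one_pow, one_mul]
    exact (H.mem_iff c).1 hc

end Adjacent

/-! ### Independence of the polarisation -/

section Polarisations

attribute [local instance 100] LieRing.ofAssociativeRing

open Filter Topology

variable {k : Type*} [Field k] {h : Type*} [LieRing h] [LieAlgebra k h]

/-- The largest ideal of `s` on which `f` vanishes. -/
def kerIdeal (s : LieSubalgebra k h) (f : h →ₗ[k] k) : Submodule k h :=
  sSup {a | a ≤ s.toSubmodule ∧ a ≤ LinearMap.ker f ∧ ∀ x ∈ s, ∀ u ∈ a, ⁅x, u⁆ ∈ a}

variable {s : LieSubalgebra k h} {f : h →ₗ[k] k}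

theorem kerIdeal_le : kerIdeal s f ≤ s.toSubmodule := sSup_le fun _ ha => ha.1

theorem apply_eq_zero_of_mem_kerIdeal {u : h} (hu : u ∈ kerIdeal s f) : f u = 0 :=
  (sSup_le fun _ ha => ha.2.1 : kerIdeal s f ≤ LinearMap.ker f) hu

theorem lie_mem_kerIdeal {x u : h} (hx : x ∈ s) (hu : u ∈ kerIdeal s f) :
    ⁅x, u⁆ ∈ kerIdeal s f := by
  have : kerIdeal s f ≤ (kerIdeal s f).comap (LieAlgebra.ad k h x : h →ₗ[k] h) :=
    sSup_le fun a ha w hw => (le_sSup ha : a ≤ kerIdeal s f) (ha.2.2 x hx w hw)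
  exact this hu

/-- The elements of `s` that are central modulo `kerIdeal s f`. -/
def kerCentre (s : LieSubalgebra k h) (f : h →ₗ[k] k) : Submodule k h where
  carrier := {y | y ∈ s ∧ ∀ x ∈ s, ⁅x, y⁆ ∈ kerIdeal s f}
  add_mem' {y z} hy hz := ⟨add_mem hy.1 hz.1, fun x hx => by
    rw [lie_add]; exact add_mem (hy.2 x hx) (hz.2 x hx)⟩
  zero_mem' := ⟨zero_mem s, fun x _ => by rw [lie_zero]; exact zero_mem _⟩
  smul_mem' c y hy := ⟨s.smul_mem c hy.1, fun x hx => by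
    rw [lie_smul]; exact Submodule.smul_mem _ c (hy.2 x hx)⟩

/-- Adjoining `z` to the ideal gives another ideal of `s` inside `ker f`, so maximality applies.
Thus `f` is injective on the centre of `s` modulo `kerIdeal s f`. -/
theorem mem_kerIdeal_of_mem_kerCentre {z : h} (hz : z ∈ kerCentre s f) (hfz : f z = 0) :
    z ∈ kerIdeal s f := by
  have : kerIdeal s f ⊔ Submodule.span k {z} ≤ kerIdeal s f := by
    refine le_sSup ⟨sup_le kerIdeal_le ?_, sup_le ?_ ?_, ?_⟩
    · rw [Submodule.span_singleton_le_iff_mem]; exact hz.1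
    · exact fun u hu => apply_eq_zero_of_mem_kerIdeal hu
    · rw [Submodule.span_singleton_le_iff_mem]; exact hfz
    · intro x hx u hu
      obtain ⟨a, ha, w, hw, rfl⟩ := Submodule.mem_sup.1 hu
      obtain ⟨c, rfl⟩ := Submodule.mem_span_singleton.1 hw
      rw [lie_add, lie_smul]
      exact Submodule.mem_sup_left
        (add_mem (lie_mem_kerIdeal hx ha) (Submodule.smul_mem _ _ (hz.2 x hx)))
  exact this (Submodule.mem_sup_right (Submodule.mem_span_singleton_self z))

variable (s f) in
/-- The centraliser of `y` in `s` modulo `kerIdeal s f`. -/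
def kerCentraliser (y : h) : LieSubalgebra k h where
  carrier := {v | v ∈ s ∧ ⁅v, y⁆ ∈ kerIdeal s f}
  add_mem' {v w} hv hw := ⟨add_mem hv.1 hw.1, by rw [add_lie]; exact add_mem hv.2 hw.2⟩
  zero_mem' := ⟨zero_mem s, by rw [zero_lie]; exact zero_mem _⟩
  smul_mem' c v hv := ⟨s.smul_mem c hv.1, by
    rw [smul_lie]; exact Submodule.smul_mem _ c hv.2⟩
  lie_mem' {v w} hv hw := ⟨s.lie_mem hv.1 hw.1, by
    rw [lie_lie]
    exact sub_mem (lie_mem_kerIdeal hv.1 hw.2) (lie_mem_kerIdeal hw.1 hv.2)⟩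

/-- The orthogonality condition for a polarisation of a subalgebra `s` of `h`. -/
structure IsPolIn (s b : LieSubalgebra k h) (f : h →ₗ[k] k) : Prop where
  le : b ≤ s
  mem_iff : ∀ u ∈ s, (∀ w ∈ b, f ⁅u, w⁆ = 0) ↔ u ∈ b

namespace IsPolIn

variable {b : LieSubalgebra k h}

theorem isotropic (hb : IsPolIn s b f) {u w : h} (hu : u ∈ b) (hw : w ∈ b) : f ⁅u, w⁆ = 0 :=
  (hb.mem_iff u (hb.le hu)).2 hu w hw

theorem kerCentre_le (hb : IsPolIn s b f) {z : h} (hz : z ∈ kerCentre s f) : z ∈ b := by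
  refine (hb.mem_iff z hz.1).1 fun w hw => ?_
  rw [← lie_skew, map_neg, apply_eq_zero_of_mem_kerIdeal (hz.2 w (hb.le hw)), neg_zero]

theorem kerIdeal_le_kerCentre : kerIdeal s f ≤ kerCentre s f :=
  fun _ hu => ⟨kerIdeal_le hu, fun _ hx => lie_mem_kerIdeal hx hu⟩

variable {O : Subring k} {v : AbsoluteValue k ℝ} {p : ℕ} [CharZero k] [FiniteDimensional k h]
  [LieRing.IsNilpotent h] {M : Submodule O h}
  {ℱ : Filter (UniversalEnvelopingAlgebra k h)} [NeBot ℱ]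

/-- For `y` in the second centre modulo `kerIdeal s f`, the centraliser of `y` is the kernel of `u ↦
f [u, y]` on `s`. If `b` is not contained in it, `b` is replaced by `b' = d + k y`, where `d` is the
part of `b` centralising `y`. Then `b = d + k x` with `f [x, y] ≠ 0`, which is the adjacent
situation. -/
theorem exists_adjacent (H : IsGoodLattice v p M)
    (hc : CauchyFor p ℱ (lat O 1 M : Set _)) (hfM : ∀ m ∈ M, f m ∈ O)
    (hb : IsPolIn s b f) {y : h} (hys : y ∈ s) (hy : ∀ x ∈ s, ⁅x, y⁆ ∈ kerCentre s f) :
    ∃ b', IsPolIn (kerCentraliser s f y) b' f ∧ (Kill v ℱ M b f ↔ Kill v ℱ M b' f) := by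
  have hcen : ∀ u ∈ s, f ⁅u, y⁆ = 0 → u ∈ kerCentraliser s f y :=
    fun u hu h0 => ⟨hu, mem_kerIdeal_of_mem_kerCentre (hy u hu) h0⟩
  by_cases hle : b ≤ kerCentraliser s f y
  · exact ⟨b, ⟨hle, fun u hu => hb.mem_iff u hu.1⟩, Iff.rfl⟩
  obtain ⟨x, hxb, hx⟩ := SetLike.not_le_iff_exists.1 hle
  have hfxy : f ⁅x, y⁆ ≠ 0 := fun h0 => hx (hcen x (hb.le hxb) h0)
  have hyc : y ∈ kerCentraliser s f y := ⟨hys, by rw [lie_self]; exact zero_mem _⟩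
  have hzc : ∀ z ∈ kerCentre s f, z ∈ b ⊓ kerCentraliser s f y := by
    intro z hz
    refine ⟨hb.kerCentre_le hz, hz.1, ?_⟩
    rw [← lie_skew]
    exact neg_mem (hz.2 y hys)
  have hyd : ∀ a ∈ b ⊓ kerCentraliser s f y, ⁅a, y⁆ ∈ b ⊓ kerCentraliser s f y :=
    fun a ha => hzc _ (kerIdeal_le_kerCentre ha.2.2)
  have hfy : ∀ a ∈ b ⊓ kerCentraliser s f y, f ⁅a, y⁆ = 0 :=
    fun a ha => apply_eq_zero_of_mem_kerIdeal ha.2.2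
  have hd : ∀ a ∈ b ⊓ kerCentraliser s f y, ∀ c ∈ b ⊓ kerCentraliser s f y, f ⁅a, c⁆ = 0 :=
    fun a ha c hc => hb.isotropic ha.1 hc.1
  have hxd : ∀ a ∈ b ⊓ kerCentraliser s f y, ⁅a, x⁆ ∈ b ⊓ kerCentraliser s f y := by
    intro a ha
    refine ⟨b.lie_mem ha.1 hxb, s.lie_mem ha.2.1 (hb.le hxb), ?_⟩
    rw [lie_lie]
    exact sub_mem ((hy x (hb.le hxb)).2 a ha.2.1) (lie_mem_kerIdeal (hb.le hxb) ha.2.2)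
  have hfx : ∀ a ∈ b ⊓ kerCentraliser s f y, f ⁅a, x⁆ = 0 :=
    fun a ha => hb.isotropic ha.1 hxb
  have hxy : ⁅x, y⁆ ∈ b ⊓ kerCentraliser s f y := hzc _ (hy x (hb.le hxb))
  have hdecomp : ∀ u ∈ b, ∃ a ∈ b ⊓ kerCentraliser s f y, ∃ c : k, u = a + c • x := by
    intro u hu
    refine ⟨u - (f ⁅u, y⁆ / f ⁅x, y⁆) • x, ⟨sub_mem hu (b.smul_mem _ hxb), ?_⟩, _,
      (sub_add_cancel u _).symm⟩
    refine hcen _ (hb.le (sub_mem hu (b.smul_mem _ hxb))) ?_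
    rw [sub_lie, smul_lie, map_sub, map_smul, smul_eq_mul, div_mul_cancel₀ _ hfxy, sub_self]
  refine ⟨adjoinElement _ y hyd, ⟨?_, ?_⟩, ?_⟩
  · intro u hu
    obtain ⟨a, ha, c, rfl⟩ := mem_adjoinElement.1 hu
    exact add_mem ha.2 ((kerCentraliser s f y).smul_mem c hyc)
  · intro u hu
    constructor
    · intro h0
      -- The multiple of `y` makes the sum orthogonal to `x`; orthogonality to `d` is inherited from
      -- `u` and `y`.
      have hub : u + (f ⁅u, x⁆ / f ⁅x, y⁆) • y ∈ b := by
        refine (hb.mem_iff _ (add_mem hu.1 (s.smul_mem _ hys))).1 fun w hw => ?_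
        obtain ⟨a, ha, c, rfl⟩ := hdecomp w hw
        have h1 : f ⁅u, a⁆ = 0 := h0 a (mem_adjoinElement.2 ⟨a, ha, 0, by simp⟩)
        have h2 : f ⁅y, a⁆ = 0 := by rw [← lie_skew, map_neg, hfy a ha, neg_zero]
        have h3 : f ⁅y, x⁆ = - f ⁅x, y⁆ := by rw [← lie_skew, map_neg]
        simp only [add_lie, lie_add, smul_lie, lie_smul, map_add, map_smul, h1, h2, h3, smul_eq_mul]
        field_simp
        ring
      refine mem_adjoinElement.2 ⟨_, ⟨hub, add_mem hu ((kerCentraliser s f y).smul_mem _ hyc)⟩,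
        -(f ⁅u, x⁆ / f ⁅x, y⁆), ?_⟩
      rw [neg_smul, add_neg_cancel_right]
    · intro hu' w hw
      obtain ⟨a, ha, c, rfl⟩ := mem_adjoinElement.1 hu'
      obtain ⟨a', ha', c', rfl⟩ := mem_adjoinElement.1 hw
      have h2 : f ⁅y, a'⁆ = 0 := by rw [← lie_skew, map_neg, hfy a' ha', neg_zero]
      simp only [add_lie, lie_add, smul_lie, lie_smul, map_add, map_smul, hd a ha a' ha', h2,
        hfy a ha, lie_self, smul_zero, add_zero]
  -- Each direction passes down to the common part `d` by `Kill.of_codimOne`, with `x` and `y`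
  -- exchanged for the converse, and up again by monotonicity.
  · have hdle : b ⊓ kerCentraliser s f y ≤ adjoinElement _ y hyd :=
      fun a ha => mem_adjoinElement.2 ⟨a, ha, 0, by simp⟩
    constructor
    · intro hK
      exact (Kill.of_codimOne H hc hfM inf_le_left hxb hdecomp hd hxd hfx hyd hfy hxy hfxy hK).mono
        hdle
    · intro hK
      refine (Kill.of_codimOne H hc hfM hdle (x := y) (y := x)
        (mem_adjoinElement.2 ⟨0, zero_mem _, 1, by simp⟩) (fun u hu => mem_adjoinElement.1 hu) hd
        hyd hfy hxd hfx ?_ ?_ hK).mono inf_le_left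
      · rw [← lie_skew]; exact neg_mem hxy
      · rw [← lie_skew, map_neg]; exact neg_ne_zero.2 hfxy

/-- Induction on `dim s`: both polarisations are moved into the centraliser of the same `y`, a
proper subalgebra because `y` is not central modulo `kerIdeal s f`. When all of `s` is central
modulo this ideal, the only polarisation of `s` is `s`. -/
theorem kill_imp (H : IsGoodLattice v p M)
    (hc : CauchyFor p ℱ (lat O 1 M : Set _)) (hfM : ∀ m ∈ M, f m ∈ O)
    {b₁ b₂ : LieSubalgebra k h} (h₁ : IsPolIn s b₁ f) (h₂ : IsPolIn s b₂ f)
    (hK : Kill v ℱ M b₁ f) : Kill v ℱ M b₂ f := by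
  induction hn : Module.finrank k s using Nat.strong_induction_on generalizing s b₁ b₂ with
  | _ n ih =>
    by_cases hs : s.toSubmodule ≤ kerCentre s f
    · have e : ∀ b : LieSubalgebra k h, IsPolIn s b f → b = s := fun b hb =>
        le_antisymm hb.le fun u hu => hb.kerCentre_le (hs hu)
      rw [e b₂ h₂, ← e b₁ h₁]
      exact hK
    · obtain ⟨y, hys, hyc, hy⟩ := exists_lie_mem_of_isNilpotent (kerCentre s f) s.toSubmodule
        (s : Set h) (fun x hx y hy => s.lie_mem hx hy) hs
      obtain ⟨b₁', h₁', e₁⟩ := h₁.exists_adjacent H hc hfM hys hy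
      obtain ⟨b₂', h₂', e₂⟩ := h₂.exists_adjacent H hc hfM hys hy
      have hlt : Module.finrank k (kerCentraliser s f y) < Module.finrank k s := by
        refine Submodule.finrank_lt_finrank_of_lt (lt_of_le_of_ne (fun u hu => hu.1) fun e => ?_)
        refine hyc ⟨hys, fun x hx => ?_⟩
        have hx' : x ∈ (kerCentraliser s f y).toSubmodule := by rw [e]; exact hx
        exact hx'.2
      exact e₂.2 (ih _ (hn ▸ hlt) h₁' h₂' (e₁.1 hK) rfl)

end IsPolIn

theorem IsPolarisation.isPolIn {b : LieSubalgebra k h} (hb : IsPolarisation f b) :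
    IsPolIn ⊤ b f :=
  ⟨fun _ _ => trivial, fun u _ => hb.2 u⟩

end Polarisations

/-! ### The coadjoint action -/

section Coadjoint

attribute [local instance 100] LieRing.ofAssociativeRing

open UniversalEnvelopingAlgebra (ι lift)
open Filter Topology Polynomial

variable {k : Type*} [Field k] [CharZero k] {h : Type*} [LieRing h] [LieAlgebra k h]

theorem exists_expAd_equiv {u : h} (hu : IsNilpotent (LieAlgebra.ad k h u)) :
    ∃ σ : h ≃ₗ⁅k⁆ h, (∀ x, σ x = expAd k u x) ∧ (∀ x, σ.symm x = expAd k (-u) x) := by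
  -- The exponential of a nilpotent derivation is formed with rational coefficients; the rational
  -- structure is the one restricted from `k`.
  let : Module ℚ h := Module.compHom h (algebraMap ℚ k)
  have hsm : ∀ (r : ℚ) (x : h), r • x = (r : k) • x := fun r x => rfl
  let : LieAlgebra ℚ h := { lie_smul := fun r x y => by rw [hsm, hsm, lie_smul] }
  let D : LieDerivation k h h :=
    { toLinearMap := LieAlgebra.ad k h u
      leibniz' := fun a b => by
        rw [LieAlgebra.ad_apply, LieAlgebra.ad_apply, LieAlgebra.ad_apply, ← lie_skew b ⁅u, a⁆,
          leibniz_lie u a b, sub_neg_eq_add, add_comm] }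
  have hu' : IsNilpotent D.toLinearMap := hu
  refine ⟨LieDerivation.exp D hu', fun x => ?_, fun x => ?_⟩
  · change IsNilpotent.exp (LieAlgebra.ad k h u) x = _
    simp only [IsNilpotent.exp, expAd, LinearMap.sum_apply, LinearMap.smul_apply, hsm]
    refine Finset.sum_congr rfl fun i _ => ?_
    norm_num
  · change IsNilpotent.exp (-(LieAlgebra.ad k h u)) x = _
    rw [← map_neg]
    simp only [IsNilpotent.exp, expAd, LinearMap.sum_apply, LinearMap.smul_apply, hsm]
    refine Finset.sum_congr rfl fun i _ => ?_
    norm_num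

/-- The divided power `ad(u)ⁱ / i!`. -/
def adDiv (u : h) (i : ℕ) : h →ₗ[k] h := (i.factorial : k)⁻¹ • (LieAlgebra.ad k h u) ^ i

omit [CharZero k] in
theorem expAd_eq_sum {u : h} {N : ℕ} (hN : (LieAlgebra.ad k h u) ^ N = 0) (x : h) :
    expAd k u x = ∑ i ∈ Finset.range N, adDiv (k := k) u i x := by
  have hle : nilpotencyClass (LieAlgebra.ad k h u) ≤ N := Nat.sInf_le hN
  rw [expAd, LinearMap.sum_apply]
  refine Finset.sum_subset (Finset.range_subset_range.2 hle) fun i _ hi => ?_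
  rw [Finset.mem_range, not_lt] at hi
  rw [pow_eq_zero_of_le hi (pow_nilpotencyClass ⟨N, hN⟩), smul_zero, LinearMap.zero_apply]

theorem adDiv_lie (u : h) (n : ℕ) (y z : h) :
    adDiv (k := k) u n ⁅y, z⁆
      = ∑ ij ∈ Finset.HasAntidiagonal.antidiagonal n, ⁅adDiv (k := k) u ij.1 y, adDiv (k := k) u ij.2 z⁆ := by
  simp only [adDiv, LinearMap.smul_apply, LieAlgebra.ad_pow_lie, Finset.smul_sum, smul_lie,
    lie_smul]
  refine Finset.sum_congr rfl fun ij hij => ?_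
  rw [Finset.HasAntidiagonal.mem_antidiagonal] at hij
  rw [← Nat.cast_smul_eq_nsmul k, ← mul_smul, ← mul_smul]
  congr 1
  subst hij
  rw [← Nat.add_choose_mul_factorial_mul_factorial ij.1 ij.2]
  push_cast
  have h1 : ((ij.1.factorial : ℕ) : k) ≠ 0 := Nat.cast_ne_zero.2 (Nat.factorial_ne_zero _)
  have h2 : ((ij.2.factorial : ℕ) : k) ≠ 0 := Nat.cast_ne_zero.2 (Nat.factorial_ne_zero _)
  have h3 : (((ij.1 + ij.2).choose ij.1 : ℕ) : k) ≠ 0 :=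
    Nat.cast_ne_zero.2 (Nat.choose_pos (Nat.le_add_right _ _)).ne'
  rw [Nat.choose_symm_add] at h3 ⊢
  field_simp

theorem adDiv_succ (u : h) (n : ℕ) (y : h) :
    ((n + 1 : ℕ) : k) • adDiv (k := k) u (n + 1) y = ⁅u, adDiv (k := k) u n y⁆ := by
  simp only [adDiv, LinearMap.smul_apply, pow_succ', Module.End.mul_apply, LieAlgebra.ad_apply,
    lie_smul, Nat.factorial_succ]
  rw [← mul_smul]
  congr 1
  push_cast
  have h1 : ((n.factorial : ℕ) : k) ≠ 0 := Nat.cast_ne_zero.2 (Nat.factorial_ne_zero _)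
  have h2 : ((n : k) + 1) ≠ 0 := by exact_mod_cast Nat.succ_ne_zero n
  field_simp

/-- The homomorphism `y ↦ ∑ᵢ ad(u)ⁱ(y) / i! Xⁱ` to polynomials over the enveloping algebra, for
`u` with `ad(u)ᴺ = 0`. -/
def expHom (u : h) {N : ℕ} (hN : (LieAlgebra.ad k h u) ^ N = 0) :
    UniversalEnvelopingAlgebra k h →ₐ[k] (UniversalEnvelopingAlgebra k h)[X] :=
  have hcoeff : ∀ (y : h) (n : ℕ),
      (∑ i ∈ Finset.range N, monomial i (ι k (adDiv (k := k) u i y))).coeff n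
        = ι k (adDiv (k := k) u n y) := by
    intro y n
    simp only [finsetSum_coeff, coeff_monomial, Finset.sum_ite_eq', Finset.mem_range]
    split_ifs with hn
    · rfl
    · rw [adDiv, pow_eq_zero_of_le (not_lt.1 hn) hN, smul_zero, LinearMap.zero_apply, map_zero]
  lift k
    { toFun := fun y => ∑ i ∈ Finset.range N, monomial i (ι k (adDiv (k := k) u i y))
      map_add' := fun y z => by simp only [map_add, Finset.sum_add_distrib]
      map_smul' := fun c y => by
        simp only [map_smul, Finset.smul_sum, RingHom.id_apply, smul_monomial]
      map_lie' := fun {y z} => by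
        ext n
        rw [LieRing.of_associative_ring_bracket, coeff_sub, coeff_mul, coeff_mul]
        simp only [hcoeff]
        rw [adDiv_lie, map_sum]
        simp only [LieHom.map_lie, LieRing.of_associative_ring_bracket, Finset.sum_sub_distrib]
        congr 1
        -- In the product taken in the other order the two indices are exchanged.
        exact Finset.sum_bij (fun ij _ => ij.swap)
          (fun ij hij => Finset.HasAntidiagonal.swap_mem_antidiagonal.2 hij)
          (fun _ _ _ _ e => Prod.swap_injective e)
          (fun ij hij => ⟨ij.swap, Finset.HasAntidiagonal.swap_mem_antidiagonal.2 hij, Prod.swap_swap ij⟩)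
          (fun _ _ => rfl) }

variable {u : h} {N : ℕ} (hN : (LieAlgebra.ad k h u) ^ N = 0)

theorem coeff_expHom_ι (y : h) (n : ℕ) :
    (expHom u hN (ι k y)).coeff n = ι k (adDiv (k := k) u n y) := by
  rw [expHom, lift_ι]
  change (∑ i ∈ Finset.range N, monomial i (ι k (adDiv (k := k) u i y))).coeff n = _
  simp only [finsetSum_coeff, coeff_monomial, Finset.sum_ite_eq', Finset.mem_range]
  split_ifs with hn
  · rfl
  · rw [adDiv, pow_eq_zero_of_le (not_lt.1 hn) hN, smul_zero, LinearMap.zero_apply, map_zero]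

theorem expHom_algebraMap (c : k) :
    expHom u hN (algebraMap k _ c) = C (algebraMap k _ c) := by
  rw [AlgHom.commutes]; rfl

theorem coeff_zero_expHom (w : UniversalEnvelopingAlgebra k h) : (expHom u hN w).coeff 0 = w := by
  induction w using env_induction with
  | hι y => rw [coeff_expHom_ι]; simp [adDiv]
  | hc c => rw [expHom_algebraMap, coeff_C_zero]
  | hadd v w hv hw => rw [map_add, coeff_add, hv, hw]
  | hmul v w hv hw => rw [map_mul, mul_coeff_zero, hv, hw]

/-- The differential equation `P' = [u, P]` of conjugation by `exp(X u)`. Both sides obey the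
Leibniz rule in `w`, so generators decide, and there it is the recursion for divided powers. -/
theorem derivative_expHom (w : UniversalEnvelopingAlgebra k h) :
    derivative (expHom u hN w) = C (ι k u) * expHom u hN w - expHom u hN w * C (ι k u) := by
  induction w using env_induction with
  | hι y =>
    ext n
    rw [coeff_derivative, coeff_sub, coeff_C_mul, coeff_mul_C, coeff_expHom_ι, coeff_expHom_ι,
      ← LieRing.of_associative_ring_bracket, ← LieHom.map_lie, ← adDiv_succ, map_smul,
      Nat.cast_smul_eq_nsmul, nsmul_eq_mul, ← Nat.cast_succ, Nat.cast_comm]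
  | hc c =>
    rw [expHom_algebraMap, derivative_C, ← C_mul, ← C_mul, Algebra.commutes, sub_self]
  | hadd v w hv hw => rw [map_add, derivative_add, hv, hw]; noncomm_ring
  | hmul v w hv hw => rw [map_mul, derivative_mul, hv, hw]; noncomm_ring

/-- Comparing coefficients in the differential equation: they are `ad(u)ⁿ(w) / n!`, so each lies in
the two-sided ideal generated by `w`. -/
theorem coeff_succ_expHom (w : UniversalEnvelopingAlgebra k h) (n : ℕ) :
    (expHom u hN w).coeff (n + 1) = ((n : k) + 1)⁻¹ •
      (ι k u * (expHom u hN w).coeff n - (expHom u hN w).coeff n * ι k u) := by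
  have e := congrArg (fun P => coeff P n) (derivative_expHom hN w)
  simp only [coeff_derivative, coeff_sub, coeff_C_mul, coeff_mul_C] at e
  rw [← e]
  have h2 : ((n : k) + 1) ≠ 0 := by exact_mod_cast Nat.succ_ne_zero n
  have h3 : ((n : UniversalEnvelopingAlgebra k h) + 1) = algebraMap k _ ((n : k) + 1) := by simp
  rw [h3, ← Algebra.commutes, ← Algebra.smul_def, inv_smul_smul₀ h2]

theorem eval_expHom {σ : h →ₗ⁅k⁆ h} (hσ : ∀ x, σ x = expAd k u x)
    (w : UniversalEnvelopingAlgebra k h) : (expHom u hN w).eval 1 = envMap σ w := by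
  induction w using env_induction with
  | hι y =>
    rw [envMap_ι, hσ, expAd_eq_sum hN, map_sum, expHom, lift_ι]
    change eval 1 (∑ i ∈ Finset.range N, monomial i (ι k (adDiv (k := k) u i y))) = _
    rw [eval_finsetSum]
    simp
  | hc c => rw [expHom_algebraMap, eval_C, AlgHom.commutes]
  | hadd v w hv hw => rw [map_add, eval_add, hv, hw, map_add]
  | hmul v w hv hw =>
    -- Evaluation is multiplicative over the noncommutative ring because the point `1` is central.
    rw [map_mul, eval, eval₂_mul_noncomm _ _ fun _ => Commute.one_right _, map_mul, ← hv, ← hw]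
    rfl

variable {O : Subring k} {M : Submodule O h}

/-- Every generator `q q' y` carries its own factor `q`, which absorbs the denominator of the
divided power applied to `y`. Long products therefore need no further factor. -/
theorem coeff_expHom_mem {q q' : k} (hq : ∀ y ∈ M, ∀ i, q • adDiv (k := k) u i y ∈ M)
    {w : UniversalEnvelopingAlgebra k h} (hw : w ∈ lat O (q * q') M) (i : ℕ) :
    (expHom u hN w).coeff i ∈ lat O q' M := by
  induction hw using lat_induction generalizing i with
  | hι y hy =>
    rw [coeff_expHom_ι, map_smul, mul_comm, mul_smul]
    exact ι_smul_mem_lat (hq y hy i)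
  | hc c hc =>
    rw [expHom_algebraMap, coeff_C]
    split_ifs
    · exact algebraMap_mem_lat hc
    · exact zero_mem _
  | hadd v w _ _ hv hw => rw [map_add, coeff_add]; exact add_mem (hv i) (hw i)
  | hmul v w _ _ hv hw =>
    rw [map_mul, coeff_mul]
    exact sum_mem fun ij _ => mul_mem (hv ij.1) (hw ij.2)

theorem envMap_exp_mem {q q' : k} (hq : ∀ y ∈ M, ∀ i, q • adDiv (k := k) u i y ∈ M)
    (hN : (LieAlgebra.ad k h u) ^ N = 0) {σ : h →ₗ⁅k⁆ h}
    (hσ : ∀ x, σ x = expAd k u x) {w : UniversalEnvelopingAlgebra k h}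
    (hw : w ∈ lat O (q * q') M) : envMap σ w ∈ lat O q' M := by
  rw [← eval_expHom hN hσ, eval_eq_sum_range]
  exact sum_mem fun i _ => by
    rw [one_pow, mul_one]
    exact coeff_expHom_mem hN hq hw i

variable {v : AbsoluteValue k ℝ} {p : ℕ} {ℱ : Filter (UniversalEnvelopingAlgebra k h)} [NeBot ℱ]

omit [NeBot ℱ] in
-- The hypothesis is stable under composing `φ` with multiplication by `u` on either side, so the
-- recursion for the coefficients gives the claim by induction.
theorem null_coeff_expHom (i : ℕ) {φ : UniversalEnvelopingAlgebra k h →ₗ[k] k}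
    (hφ : ∀ a b, Null v ℱ fun x => φ (a * x * b)) :
    Null v ℱ fun x => φ ((expHom u hN x).coeff i) := by
  induction i generalizing φ with
  | zero =>
    simp only [coeff_zero_expHom]
    simpa using hφ 1 1
  | succ i ih =>
    simp only [coeff_succ_expHom, map_smul, map_sub, smul_eq_mul]
    refine Null.const_mul _ (Null.sub ?_ ?_)
    · refine ih (φ := φ ∘ₗ LinearMap.mulLeft k (ι k u)) fun a b => ?_
      have := hφ (ι k u * a) b
      simpa only [LinearMap.comp_apply, LinearMap.mulLeft_apply, mul_assoc] using this
    · refine ih (φ := φ ∘ₗ LinearMap.mulRight k (ι k u)) fun a b => ?_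
      have := hφ a (b * ι k u)
      simpa only [LinearMap.comp_apply, LinearMap.mulRight_apply, mul_assoc] using this

/-- The value at `σ(x)` is the sum over the coefficients of `expHom`. Each summand is null since
annihilation is a two-sided condition. The number of summands grows with `x`, but for `z ∈ U(q² M)`
all coefficients lie in `U(M)`, so the partial sums are equibounded. -/
theorem Kill.null_envMap_exp (H : IsGoodLattice v p M) {q : k} (hqO : q ∈ O)
    (hq : ∀ y ∈ M, ∀ i, q • adDiv (k := k) u i y ∈ M)
    (hN : (LieAlgebra.ad k h u) ^ N = 0)
    (hc : CauchyFor p ℱ (lat O (q * q) M : Set _)) {σ : h →ₗ⁅k⁆ h}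
    (hσ : ∀ x, σ x = expAd k u x) {b : LieSubalgebra k h} {f : h →ₗ[k] k}
    (hK : Kill v ℱ M b f) {ψ : UniversalEnvelopingAlgebra k h →ₗ[k] k} (hψ : IsInd b f ψ)
    (hψb : BddOn v (lat O 1 M : Set _) ψ) (a : UniversalEnvelopingAlgebra k h) :
    Null v ℱ fun x => ψ (envMap σ x * a) := by
  have hnull : ∀ c d, Null v ℱ fun x => ψ (c * x * d) := fun c d =>
    hK (ψ ∘ₗ LinearMap.mulLeft k c) (hψ.comp_mulLeft c) (by
      obtain ⟨C, hC⟩ := bddOn_comp_mul H one_ne_zero hψb c 1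
      exact ⟨C, fun w hw => by simpa using hC w hw⟩) d |> fun h => by
        simpa only [LinearMap.comp_apply, LinearMap.mulLeft_apply, mul_assoc] using h
  obtain ⟨C, hC⟩ := bddOn_comp_mul_right H one_ne_zero hψb a
  have hC0 : 0 ≤ C := (v.nonneg _).trans (hC 1 (one_mem (lat O 1 M)))
  let ψa := ψ ∘ₗ LinearMap.mulRight k a
  let θ : ℕ → UniversalEnvelopingAlgebra k h →ₗ[k] k := fun i =>
    ψa ∘ₗ (lcoeff (UniversalEnvelopingAlgebra k h) i).restrictScalars k ∘ₗ (expHom u hN).toLinearMap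
  refine Null.of_equibounded H.nonarch H.p_lt hc _
    (fun S : ℕ => (∑ i ∈ Finset.range S, θ i).toAddMonoidHom) (C := C) ?_ ?_ ?_
  · intro S z hz
    change v ((∑ i ∈ Finset.range S, θ i) z) ≤ C
    rw [LinearMap.sum_apply]
    refine IsNonarchimedean.sum_le H.nonarch _ _ hC0 fun i _ => hC _ ?_
    exact lat_le_lat ⟨q, hqO, (mul_one q).symm⟩ (coeff_expHom_mem hN hq hz i)
  · intro S
    change Null v ℱ fun x => (∑ i ∈ Finset.range S, θ i) x
    simp only [LinearMap.sum_apply]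
    refine Null.sum _ fun i _ => null_coeff_expHom hN i (φ := ψa) fun c d => ?_
    have := hnull c (d * a)
    simpa only [ψa, LinearMap.comp_apply, LinearMap.mulRight_apply, mul_assoc] using this
  · intro x
    refine ⟨(expHom u hN x).natDegree + 1, ?_⟩
    change (∑ i ∈ Finset.range _, θ i) x = _
    rw [LinearMap.sum_apply, ← eval_expHom hN hσ, eval_eq_sum_range, Finset.sum_mul, map_sum]
    simp only [one_pow, mul_one]
    rfl

/-- For `φ` induced from `σ(b)`, write `φ(x a) = (φ ∘ σ)(σ⁻¹(x) σ⁻¹(a))`. The functional `φ ∘ σ` is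
induced from `b` but bounded only on `U(q M)`, while `σ⁻¹` maps `U(q² M)` into `U(q M)`. The dual
basis for `b` handles this smaller lattice, and its functionals are null at `σ⁻¹(x) σ⁻¹(a)` by
`Kill.null_envMap_exp`. -/
theorem Kill.conj [FiniteDimensional k h] [LieRing.IsNilpotent h] (H : IsGoodLattice v p M)
    {q : k} (hqO : q ∈ O) (hq0 : q ≠ 0)
    (hq : ∀ y ∈ M, ∀ i, q • adDiv (k := k) u i y ∈ M)
    (hN : (LieAlgebra.ad k h u) ^ N = 0)
    (hc : CauchyFor p ℱ (lat O (q * q) M : Set _)) {f f' : h →ₗ[k] k}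
    (hfM : ∀ m ∈ M, f m ∈ O) (hfM' : ∀ m ∈ M, f' m ∈ O) (hconj : IsCoadjointConj k u f f')
    {b b' : LieSubalgebra k h} (hb : IsPolIn ⊤ b f) (hb' : IsPolIn ⊤ b' f')
    (hK : Kill v ℱ M b f) : Kill v ℱ M b' f' := by
  obtain ⟨σ, hσ, hσ'⟩ := exists_expAd_equiv (k := k) (u := u) ⟨N, hN⟩
  have hN' : (LieAlgebra.ad k h (-u)) ^ N = 0 := by
    rw [map_neg, neg_pow, hN, mul_zero]
  have hq' : ∀ y ∈ M, ∀ i, q • adDiv (k := k) (-u) i y ∈ M := by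
    intro y hy i
    have e : adDiv (k := k) (-u) i y = (-1 : k) ^ i • adDiv (k := k) u i y := by
      simp only [adDiv, map_neg, neg_pow (LieAlgebra.ad k h u), LinearMap.smul_apply]
      rw [smul_comm]
      congr 1
      rcases Nat.even_or_odd i with hi | hi <;> simp [hi.neg_one_pow]
    rw [e, smul_comm]
    exact M.smul_mem (⟨(-1) ^ i, pow_mem (neg_mem (one_mem O)) i⟩ : O) (hq y hy i)
  have hff' : ∀ x, f' (σ x) = f x := fun x => by rw [hσ]; exact hconj x
  have hc1 : CauchyFor p ℱ (lat O 1 M : Set _) :=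
    hc.mono (lat_le_lat ⟨q * q, mul_mem hqO hqO, (mul_one _).symm⟩)
  have hσb : IsPolIn ⊤ (b.map (σ : h →ₗ⁅k⁆ h)) f' := by
    refine ⟨le_top, fun w _ => ?_⟩
    have e : σ (σ.symm w) = w := σ.apply_symm_apply w
    have h1 := hb.mem_iff (σ.symm w) trivial
    have h2 : w ∈ b.map (σ : h →ₗ⁅k⁆ h) ↔ σ.symm w ∈ b := by
      rw [LieSubalgebra.mem_map]
      constructor
      · rintro ⟨y, hy, rfl⟩
        have : σ.symm (σ y) = y := σ.symm_apply_apply y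
        change σ.symm (σ y) ∈ b
        rwa [this]
      · intro hw
        exact ⟨_, hw, e⟩
    rw [h2, ← h1]
    constructor
    · intro H y hy
      rw [← hff', LieEquiv.map_lie, e]
      exact H _ ((LieSubalgebra.mem_map _ _ _).2 ⟨y, hy, rfl⟩)
    · intro H y hy
      obtain ⟨y, hy', rfl⟩ := (LieSubalgebra.mem_map _ _ _).1 hy
      rw [← e]
      change f' ⁅σ _, σ y⁆ = 0
      rw [← LieEquiv.map_lie, hff']
      exact H y hy'
  -- Independence of the polarisation reduces the claim to `σ(b)` in place of `b'`.
  refine IsPolIn.kill_imp H hc1 hfM' hσb hb' fun φ hφ hφb a => ?_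
  let σU := envMap (σ : h →ₗ⁅k⁆ h)
  let σU' := envMap (σ.symm : h →ₗ⁅k⁆ h)
  have hinv : ∀ w, σU (σU' w) = w := by
    intro w
    change envMap _ (envMap _ w) = w
    rw [← envMap_comp]
    have e' : (σ : h →ₗ⁅k⁆ h).comp (σ.symm : h →ₗ⁅k⁆ h) = LieHom.id := by ext a; simp
    rw [e']
    induction w using env_induction with
    | hι y => rw [envMap_ι]; rfl
    | hc c => rw [AlgHom.commutes]
    | hadd v w hv hw => rw [map_add, hv, hw]
    | hmul v w hv hw => rw [map_mul, hv, hw]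
  have hφσ : IsInd b f (φ ∘ₗ σU.toLinearMap) := by
    intro w y hy
    change φ (σU (w * ι k y)) = f y • φ (σU w)
    rw [map_mul]
    change φ (σU w * envMap _ (ι k y)) = _
    rw [envMap_ι, hφ _ _ ((LieSubalgebra.mem_map _ _ _).2 ⟨y, hy, rfl⟩), ← hff']
    rfl
  -- The first factor `q` is spent on `σ`, which maps `U(q M)` into `U(M)`.
  have hφσb : BddOn v (lat O q M : Set _) (φ ∘ₗ σU.toLinearMap) := by
    obtain ⟨C, hC⟩ := hφb
    refine ⟨C, fun w hw => hC _ ?_⟩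
    exact envMap_exp_mem (q := q) hq hN hσ (by rw [mul_one]; exact hw)
  obtain ⟨R⟩ := exists_relBasis H.mem_or_inv_mem H.fg H.span H.lie b
  let B : DualBasis O M b f := RelBasis.dualBasis (j := b.incl) R
    (fun y => ⟨fun hy => ⟨⟨y, hy⟩, rfl⟩, fun ⟨a, ha⟩ => ha ▸ a.2⟩)
    (fun a c => hb.isotropic a.2 c.2) (fun a ha => hfM _ ha)
  obtain ⟨d, -, hd0, hd⟩ := H.exists_smul_mem_lat hq0 (σU' a)
  -- The second factor `q` is spent on `σ⁻¹`, which maps `U(q² M)` into `U(q M)`.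
  have key := B.null (vE := v) H.nonarch (fun c => rfl) H hc
    ((AddMonoidHom.mulRight (σU' a)).comp (σU' : _ →+* _).toAddMonoidHom) hqO hd0 (fun z hz => by
      change d • (σU' z * σU' a) ∈ _
      rw [← mul_smul_comm]
      exact mul_mem (envMap_exp_mem hq' hN' hσ' hz) hd) hφσ hφσb (fun i => by
      refine hK.null_envMap_exp H hqO hq' hN' hc hσ' (B.isInd i) ⟨1, fun w hw => ?_⟩ (σU' a)
      obtain ⟨c, hc, e⟩ := B.φ_mem 1 (one_mem O) w hw i
      rw [e, one_pow, one_mul]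
      exact (H.mem_iff c).1 hc)
  convert key using 2 with x
  change φ (x * a) = φ (σU (σU' x * σU' a))
  rw [map_mul σU, hinv, hinv]

end Coadjoint

/-! ### Separated lattices are finitely generated -/

section FiniteGeneration

open Filter Topology

variable {𝕜 : Type*} [NormedField 𝕜] [ProperSpace 𝕜]
  {O : Subring 𝕜} (hO : ∀ x, x ∈ O ↔ ‖x‖ ≤ 1)

-- A nonzero ideal is a union of cosets of a ball, hence closed in the compact unit ball; an element
-- of maximal norm divides all the others.
include hO in
theorem isPrincipalIdealRing_of_proper : IsPrincipalIdealRing O := by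
  refine ⟨fun J => ?_⟩
  by_cases hJ : J = ⊥
  · rw [hJ]; exact ⟨0, by simp⟩
  obtain ⟨a, haJ, ha0⟩ := Submodule.exists_mem_ne_zero_of_ne_bot hJ
  have ha0' : (a : 𝕜) ≠ 0 := fun h => ha0 (Subtype.ext h)
  let T : Set 𝕜 := {x | ∃ y ∈ J, (y : 𝕜) = x}
  have hdiv : ∀ x y : 𝕜, y ∈ T → ‖x‖ ≤ ‖y‖ → y ≠ 0 → x ∈ T := by
    rintro x _ ⟨y, hy, rfl⟩ hxy hy0
    have hq : x / y ∈ O := by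
      rw [hO, norm_div]
      exact div_le_one_of_le₀ hxy (norm_nonneg _)
    exact ⟨⟨x / y, hq⟩ * y, J.mul_mem_left _ hy, div_mul_cancel₀ _ hy0⟩
  have hclosed : IsClosed T := by
    rw [← isOpen_compl_iff, Metric.isOpen_iff]
    intro x hx
    refine ⟨‖(a : 𝕜)‖, norm_pos_iff.2 ha0', fun y hy hyT => hx ?_⟩
    obtain ⟨y', hy', rfl⟩ := hyT
    obtain ⟨z, hz, e⟩ := hdiv (x - y') a ⟨a, haJ, rfl⟩ (by
      rw [← dist_eq_norm, dist_comm]; exact (Metric.mem_ball.1 hy).le) ha0'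
    exact ⟨z + y', J.add_mem hz hy', by push_cast; rw [e]; ring⟩
  have hcomp : IsCompact T := by
    refine (isCompact_closedBall (0 : 𝕜) 1).of_isClosed_subset hclosed ?_
    rintro _ ⟨y, -, rfl⟩
    rw [mem_closedBall_zero_iff]
    exact (hO _).1 y.2
  obtain ⟨m, ⟨m', hm', rfl⟩, hmax⟩ :=
    hcomp.exists_isMaxOn (f := fun x => ‖x‖) ⟨a, a, haJ, rfl⟩ continuous_norm.continuousOn
  refine ⟨m', ?_⟩
  refine le_antisymm (fun y hy => ?_) ?_
  · have hym : ‖(y : 𝕜)‖ ≤ ‖(m' : 𝕜)‖ := hmax ⟨y, hy, rfl⟩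
    have hm0 : (m' : 𝕜) ≠ 0 := by
      intro h0
      have : ‖(a : 𝕜)‖ ≤ ‖(m' : 𝕜)‖ := hmax ⟨a, haJ, rfl⟩
      rw [h0, norm_zero] at this
      exact ha0' (norm_le_zero_iff.1 this)
    refine Submodule.mem_span_singleton.2 ⟨⟨(y : 𝕜) / m', ?_⟩, Subtype.ext ?_⟩
    · rw [hO, norm_div]
      exact div_le_one_of_le₀ hym (norm_nonneg _)
    · exact div_mul_cancel₀ _ hm0
  · rw [Submodule.span_le, Set.singleton_subset_iff]
    exact hm'

-- The point is that `W` is bounded. If it were not, each `πⁿ W` would contain a vector of norm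
-- between `|π|` and `1`, in coordinates for a basis taken from `W`. By compactness these nested
-- closed sets would have a common point, against separatedness. A bounded `W` embeds into a free
-- module of finite rank over the principal ideal ring `O`.
include hO in
theorem fg_of_separated {π : 𝕜} (hπ0 : π ≠ 0) (hπ : ‖π‖ < 1) {V : Type*} [AddCommGroup V]
    [Module 𝕜 V] [FiniteDimensional 𝕜 V] (W : Submodule O V)
    (hspan : Submodule.span 𝕜 (W : Set V) = ⊤)
    (hsep : ∀ x : V, (∀ n : ℕ, ∃ y ∈ W, π ^ n • y = x) → x = 0) : W.FG := by
  have hPIR := isPrincipalIdealRing_of_proper hO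
  have hπO : π ∈ O := (hO _).2 hπ.le
  have hmulO : ∀ {c : 𝕜} {x : V}, ‖c‖ ≤ 1 → x ∈ W → c • x ∈ W := fun hc hx =>
    W.smul_mem (⟨_, (hO _).2 hc⟩ : O) hx
  let bs := Module.Basis.ofSpan hspan.ge
  have hbs : ∀ i, bs i ∈ W := fun i => Module.Basis.ofSpan_subset hspan.ge ⟨i, rfl⟩
  have hfin := Module.Finite.finite_basis bs
  have := Fintype.ofFinite (↑((linearIndepOn_empty 𝕜 id).extend (Set.empty_subset (W : Set V))))
  let e := bs.equivFun
  let W' : ℕ → Set (_ → 𝕜) := fun n => {x | ∃ y ∈ W, π ^ n • y = e.symm x}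
  have hadd : ∀ n x y, x ∈ W' n → y ∈ W' n → x + y ∈ W' n := by
    rintro n x y ⟨x', hx', ex⟩ ⟨y', hy', ey⟩
    exact ⟨x' + y', add_mem hx' hy', by rw [smul_add, ex, ey, map_add]⟩
  have hball : ∀ n x, ‖x‖ ≤ ‖π‖ ^ n → x ∈ W' n := by
    intro n x hx
    refine ⟨(π ^ n)⁻¹ • e.symm x, ?_, smul_inv_smul₀ (pow_ne_zero _ hπ0) _⟩
    rw [Module.Basis.equivFun_symm_apply, Finset.smul_sum]
    refine sum_mem fun i _ => ?_
    rw [← mul_smul]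
    refine hmulO ?_ (hbs i)
    rw [norm_mul, norm_inv, norm_pow, inv_mul_le_iff₀ (pow_pos (norm_pos_iff.2 hπ0) n), mul_one]
    exact (norm_le_pi_norm x i).trans hx
  have hclosed : ∀ n, IsClosed (W' n) := by
    intro n
    rw [← isOpen_compl_iff, Metric.isOpen_iff]
    intro x hx
    refine ⟨‖π‖ ^ n, pow_pos (norm_pos_iff.2 hπ0) n, fun y hy hyT => hx ?_⟩
    have := hadd n _ _ hyT (hball n (x - y) (by
      rw [← dist_eq_norm, dist_comm]; exact (Metric.mem_ball.1 hy).le))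
    simpa using this
  have hanti : ∀ n, W' (n + 1) ⊆ W' n := by
    rintro n x ⟨y, hy, ey⟩
    exact ⟨π • y, hmulO hπ.le hy, by rw [← ey, pow_succ, mul_smul]⟩
  let T : ℕ → Set (_ → 𝕜) := fun n => W' n ∩ {x | ‖π‖ ≤ ‖x‖ ∧ ‖x‖ ≤ 1}
  have hC : IsClosed {x : (↑((linearIndepOn_empty 𝕜 id).extend (Set.empty_subset (W : Set V)))) → 𝕜 |
      ‖π‖ ≤ ‖x‖ ∧ ‖x‖ ≤ 1} :=
    (isClosed_le continuous_const continuous_norm).inter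
      (isClosed_le continuous_norm continuous_const)
  have hTclosed : ∀ n, IsClosed (T n) := fun n => (hclosed n).inter hC
  have hbdd : ∃ m : ℕ, ∀ x ∈ W' 0, ‖π ^ m • x‖ ≤ 1 := by
    by_contra! hcon
    have hne : ∀ n, (T n).Nonempty := by
      intro n
      obtain ⟨x, hx, hx1⟩ := hcon n
      have hlim : Tendsto (fun k : ℕ => ‖π ^ k • x‖) atTop (𝓝 0) := by
        simp only [norm_smul, norm_pow]
        simpa using (tendsto_pow_atTop_nhds_zero_of_lt_one (norm_nonneg _) hπ).mul_const ‖x‖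
      have hex : ∃ k : ℕ, ‖π ^ k • x‖ ≤ 1 := (hlim.eventually (ge_mem_nhds one_pos)).exists
      classical
      -- The least `k` bringing `x` into the unit ball: minimality gives norm at least `|π|`, and `k
      -- > n` because `πⁿ x` is still outside, so the rescaled vector lies in `πⁿ W`.
      let k := Nat.find hex
      have hk : ‖π ^ k • x‖ ≤ 1 := Nat.find_spec hex
      have hnk : n < k := by
        by_contra! hkn
        refine absurd ?_ (not_le.2 hx1)
        obtain ⟨j, rfl⟩ := Nat.exists_eq_add_of_le hkn
        rw [pow_add, mul_comm, mul_smul, norm_smul, norm_pow]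
        exact mul_le_one₀ (pow_le_one₀ (norm_nonneg _) hπ.le) (norm_nonneg _) hk
      obtain ⟨j, hj⟩ : ∃ j, k = j + 1 := ⟨k - 1, by omega⟩
      have hk' : 1 < ‖π ^ j • x‖ := not_le.1 (Nat.find_min hex (by change j < k; omega))
      refine ⟨π ^ k • x, ?_, ?_, hk⟩
      · obtain ⟨y, hy, ey⟩ := hx
        rw [pow_zero, one_smul] at ey
        obtain ⟨i, hi⟩ := Nat.exists_eq_add_of_lt hnk
        refine ⟨π ^ (i + 1) • y, hmulO (by
          rw [norm_pow]; exact pow_le_one₀ (norm_nonneg _) hπ.le) hy, ?_⟩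
        rw [map_smul, ← ey, ← mul_smul, ← pow_add, hi, add_assoc]
      · rw [hj, pow_succ', mul_smul, norm_smul]
        exact le_mul_of_one_le_right (norm_nonneg _) hk'.le
    obtain ⟨x, hx⟩ := IsCompact.nonempty_iInter_of_sequence_nonempty_isCompact_isClosed T
      (fun n => Set.inter_subset_inter_left _ (hanti n)) hne
      ((isCompact_closedBall _ 1).of_isClosed_subset (hTclosed 0) fun x hx => by
        rw [mem_closedBall_zero_iff]; exact hx.2.2) hTclosed
    rw [Set.mem_iInter] at hx
    have h0 : e.symm x = 0 := hsep _ fun n => (hx n).1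
    rw [map_eq_zero_iff _ e.symm.injective] at h0
    have := (hx 0).2.1
    rw [h0, norm_zero] at this
    exact hπ0 (norm_le_zero_iff.1 this)
  obtain ⟨m, hm⟩ := hbdd
  let W₀ := Submodule.span O (Set.range bs)
  have hN : IsNoetherian O W₀ := isNoetherian_span_of_finite O (Set.finite_range bs)
  have hle : ∀ x ∈ W, π ^ m • x ∈ W₀ := by
    intro x hx
    have h1 := hm (e x) ⟨x, hx, by simp⟩
    have h2 : π ^ m • x = ∑ i, (π ^ m • e x) i • bs i := by
      rw [← Module.Basis.equivFun_symm_apply]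
      change _ = e.symm _
      rw [map_smul, LinearEquiv.symm_apply_apply]
    rw [h2]
    refine sum_mem fun i _ => ?_
    have h3 : (π ^ m • e x) i ∈ O := (hO _).2 ((norm_le_pi_norm _ i).trans h1)
    exact W₀.smul_mem (⟨_, h3⟩ : O) (Submodule.subset_span ⟨i, rfl⟩)
  let j : W →ₗ[O] W₀ :=
    { toFun := fun x => ⟨π ^ m • (x : V), hle x x.2⟩
      map_add' := fun x y => Subtype.ext (smul_add _ _ _)
      map_smul' := fun c x => Subtype.ext (smul_comm _ (c : 𝕜) _) }
  have hj : Function.Injective j := by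
    intro x y hxy
    exact Subtype.ext (smul_right_injective V (pow_ne_zero m hπ0) (congrArg Subtype.val hxy))
  have : IsNoetherian O W := isNoetherian_of_injective j hj
  exact Module.Finite.iff_fg.1 inferInstance

end FiniteGeneration

/-! ### Lattices over the valuation ring of an algebraic extension of `ℚ_p`. -/

section PadicLattice

variable {p : ℕ} [Fact p.Prime]

variable (p) in
/-- The absolute value of an algebraic extension of `ℚ_p`. -/
def padicAbs (k : Type*) [Field k] [Algebra ℚ_[p] k] [Algebra.IsAlgebraic ℚ_[p] k] :
    AbsoluteValue k ℝ where
  toFun := spectralNorm ℚ_[p] k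
  map_mul' x y := by
    let := spectralNorm.normedField ℚ_[p] k
    exact norm_mul x y
  nonneg' x := by
    let := spectralNorm.normedField ℚ_[p] k
    exact norm_nonneg x
  eq_zero' x := by
    let := spectralNorm.normedField ℚ_[p] k
    exact norm_eq_zero (a := x)
  add_le' x y := by
    let := spectralNorm.normedField ℚ_[p] k
    exact norm_add_le x y

section

variable {k : Type*} [Field k] [Algebra ℚ_[p] k] [Algebra.IsAlgebraic ℚ_[p] k]

theorem isNonarchimedean_padicAbs : IsNonarchimedean (padicAbs p k) :=
  isNonarchimedean_spectralNorm (K := ℚ_[p]) (L := k)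

theorem mem_valuationRing_iff (x : k) : x ∈ valuationRing p k ↔ padicAbs p k x ≤ 1 := Iff.rfl

theorem padicAbs_p : padicAbs p k (p : k) = (p : ℝ)⁻¹ := by
  have := spectralNorm_p_pow p (k := k) 1
  rwa [pow_one, pow_one] at this

theorem padicAbs_extends (x : ℚ_[p]) : padicAbs p k (algebraMap ℚ_[p] k x) = ‖x‖ :=
  spectralNorm_extends x

theorem padicAbs_tower (F : Type*) [Field F] [Algebra ℚ_[p] F] [Algebra.IsAlgebraic ℚ_[p] F]
    [Algebra k F] [IsScalarTower ℚ_[p] k F] (x : k) :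
    padicAbs p F (algebraMap k F x) = padicAbs p k x :=
  (spectralNorm.eq_of_tower (K := ℚ_[p]) (L := F) x).symm

/-- Since `i!` divides `c!`, and `c!` is `p^(v_p(c!))` times a unit, `p^(v_p(c!)) / i!` is integral;
the remaining `pᵉ` cancels the last factor. -/
theorem pow_mul_inv_factorial_mem {e i c n : ℕ} (hi : i ≤ c)
    (hn : e + padicValNat p c.factorial ≤ n) :
    (p : k) ^ n * (i.factorial : k)⁻¹ * ((p : k) ^ e)⁻¹ ∈ valuationRing p k := by
  have hp0 := p_ne_zero p k
  have hchar : CharZero k := charZero_of_injective_algebraMap (algebraMap ℚ_[p] k).injective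
  obtain ⟨m, hm⟩ := Nat.factorial_dvd_factorial hi
  obtain ⟨m', hm'⟩ : p ^ padicValNat p c.factorial ∣ c.factorial := pow_padicValNat_dvd
  have hcop : ¬ p ∣ m' := by
    rintro ⟨r, rfl⟩
    refine pow_succ_padicValNat_not_dvd (p := p) (Nat.factorial_ne_zero c) ⟨r, ?_⟩
    rw [pow_succ, mul_assoc]
    exact hm'
  obtain ⟨r, rfl⟩ := Nat.exists_eq_add_of_le hn
  have hm0 : (m' : k) ≠ 0 := Nat.cast_ne_zero.2 fun h => hcop (h ▸ dvd_zero p)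
  have hm1 : (m' : k)⁻¹ ∈ valuationRing p k := by
    have e : (m' : k) = algebraMap ℚ_[p] k m' := by simp
    rw [mem_valuationRing_iff, map_inv₀, e, padicAbs_extends,
      Padic.norm_natCast_eq_one_iff.2 ((Nat.Prime.coprime_iff_not_dvd Fact.out).2 hcop), inv_one]
  have hi0 : (i.factorial : k) ≠ 0 := Nat.cast_ne_zero.2 (Nat.factorial_ne_zero i)
  have key : (p : k) ^ padicValNat p c.factorial * (i.factorial : k)⁻¹ = m * (m' : k)⁻¹ := by
    have h1 : (i.factorial : k) * m = (p : k) ^ padicValNat p c.factorial * m' := by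
      exact_mod_cast hm.symm.trans hm'
    field_simp
    rw [← h1, mul_comm]
  have e : (p : k) ^ (e + padicValNat p c.factorial + r) * (i.factorial : k)⁻¹ * ((p : k) ^ e)⁻¹
      = (p : k) ^ r * (m * (m' : k)⁻¹) := by
    rw [← key, pow_add, pow_add]
    field_simp
  rw [e]
  exact mul_mem (p_pow_mem p r) (mul_mem (natCast_mem _ m) hm1)

variable {h : Type*} [LieRing h] [LieAlgebra k h]

theorem LieSpan.fg_of_isSeparated [FiniteDimensional ℚ_[p] k] [FiniteDimensional k h]
    (L : LieSpan p k h) (hL : L.IsSeparated) : L.toSubmodule.FG := by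
  let := spectralNorm.normedField ℚ_[p] k
  let := spectralNorm.normedSpace ℚ_[p] k
  have : ProperSpace k := FiniteDimensional.proper ℚ_[p] k
  refine fg_of_separated (𝕜 := k) (O := valuationRing p k) (fun x => Iff.rfl) (p_ne_zero p k) ?_
    L.toSubmodule L.span_eq_top hL
  change padicAbs p k (p : k) < 1
  rw [padicAbs_p]
  exact inv_p_lt_one p

theorem LieSpan.isGoodLattice (L : LieSpan p k h) (hL : L.toSubmodule.FG) :
    IsGoodLattice (padicAbs p k) p L.toSubmodule where
  nonarch := isNonarchimedean_padicAbs
  mem_iff _ := Iff.rfl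
  p_lt := by rw [padicAbs_p]; exact inv_p_lt_one p
  fg := hL
  span y := by
    obtain ⟨n, hn⟩ := L.exists_p_pow_smul_mem y
    exact ⟨(p : k) ^ n, p_pow_mem p n, pow_ne_zero _ (p_ne_zero p k), hn⟩
  lie := L.lie_mem

theorem LieSpan.fg_extend (L : LieSpan p k h) (hL : L.toSubmodule.FG) (F : Type*) [Field F]
    [Algebra ℚ_[p] F] [Algebra.IsAlgebraic ℚ_[p] F] [Algebra k F] [IsScalarTower ℚ_[p] k F] :
    (L.extend F).toSubmodule.FG := by
  classical
  obtain ⟨S, hS⟩ := hL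
  refine ⟨S.image fun x => (1 : F) ⊗ₜ[k] x, le_antisymm (Submodule.span_mono ?_) ?_⟩
  · intro z hz
    obtain ⟨x, hx, rfl⟩ := Finset.mem_image.1 hz
    exact ⟨x, hS ▸ Submodule.subset_span hx, rfl⟩
  · refine Submodule.span_le.2 ?_
    rintro _ ⟨x, hx, rfl⟩
    rw [← hS] at hx
    induction hx using Submodule.span_induction with
    | mem x hx => exact Submodule.subset_span (Finset.mem_image_of_mem _ hx)
    | zero => rw [TensorProduct.tmul_zero]; exact zero_mem _
    | add x y _ _ hx hy => rw [TensorProduct.tmul_add]; exact add_mem hx hy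
    | smul a x _ hx =>
      have e : (1 : F) ⊗ₜ[k] (a • x)
          = (⟨_, algebraMap_mem_valuationRing F a.2⟩ : valuationRing p F) • ((1 : F) ⊗ₜ[k] x) := by
        change (1 : F) ⊗ₜ[k] ((a : k) • x) = algebraMap k F a • ((1 : F) ⊗ₜ[k] x)
        rw [TensorProduct.tmul_smul, algebraMap_smul]
      rw [e]
      exact Submodule.smul_mem _ _ hx

attribute [local instance 100] LieRing.ofAssociativeRing

theorem envLattice_eq_lat (L : LieSpan p k h) : envLattice L = lat (valuationRing p k) 1 L.toSubmodule := by
  simp only [envLattice, lat, one_smul]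

theorem envLattice_scale (L : LieSpan p k h) (m : ℕ) :
    envLattice (L.scale m) = lat (valuationRing p k) ((p : k) ^ m) L.toSubmodule := by
  rw [envLattice, lat]
  congr 1
  ext w
  constructor
  · rintro ⟨_, ⟨y, hy, rfl⟩, rfl⟩
    exact ⟨y, hy, rfl⟩
  · rintro ⟨y, hy, rfl⟩
    exact ⟨_, ⟨y, hy, rfl⟩, rfl⟩

end

end PadicLattice

/-! ### Nilpotency of `ad u` after extension of scalars. -/

section Nilpotency

variable {k : Type*} [Field k] {g : Type*} [LieRing g] [LieAlgebra k g] [LieRing.IsNilpotent g]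
variable (F : Type*) [Field F] [Algebra k F]

theorem ad_pow_nilpotencyLength (u : F ⊗[k] g) :
    (LieAlgebra.ad F (F ⊗[k] g) u) ^ LieModule.nilpotencyLength g g = 0 := by
  -- The nilpotency length is taken from the lower central series over `ℤ`, whose terms have the
  -- same underlying sets as those over `k`.
  have h0 : LieModule.lowerCentralSeries k g g (LieModule.nilpotencyLength g g) = ⊥ := by
    have hne : {n | LieModule.lowerCentralSeries ℤ g g n = ⊥}.Nonempty :=
      (LieModule.isNilpotent_iff_int g g).1 inferInstance
    have : LieModule.lowerCentralSeries ℤ g g (LieModule.nilpotencyLength g g) = ⊥ :=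
      Nat.sInf_mem hne
    simpa [SetLike.ext'_iff, LieModule.coe_lowerCentralSeries_eq_int k g g] using this
  have h1 : LieModule.lowerCentralSeries F (F ⊗[k] g) (F ⊗[k] g)
      (LieModule.nilpotencyLength g g) = ⊥ := by
    rw [LieSubmodule.lowerCentralSeries_tensor_eq_baseChange, h0, LieSubmodule.baseChange_bot]
  refine LinearMap.ext fun y => ?_
  have h2 := LieModule.iterate_toEnd_mem_lowerCentralSeries F (F ⊗[k] g) (F ⊗[k] g) u y
    (LieModule.nilpotencyLength g g)
  rw [h1, LieSubmodule.mem_bot] at h2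
  rw [Module.End.pow_apply]
  exact h2

end Nilpotency

/-! ### Sequences in affinoid enveloping algebras -/

section Sequences

attribute [local instance 100] LieRing.ofAssociativeRing

open UniversalEnvelopingAlgebra (ι lift)
open Filter Topology UniformSpace

variable {p : ℕ} [Fact p.Prime]
variable {k : Type*} [Field k] [Algebra ℚ_[p] k] [Algebra.IsAlgebraic ℚ_[p] k]
variable {h : Type*} [LieRing h] [LieAlgebra k h]

/-- The canonical map from `U(h)` to its completion. -/
def toAffinoid (L : LieSpan p k h) : UniversalEnvelopingAlgebra k h →+* AffinoidEnvelope L :=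
  Completion.coeRingHom (α := EnvTop L)

theorem tendsto_toAffinoid_zero (L : LieSpan p k h) {G : Type*} {ℱ : Filter G}
    {x : G → UniversalEnvelopingAlgebra k h} (hx : ∀ n, ∀ᶠ g in ℱ, x g ∈ envBall L n) :
    Tendsto (fun g => toAffinoid L (x g)) ℱ (𝓝 0) := by
  have h0 : Tendsto (α := G) (β := EnvTop L) x ℱ (𝓝 0) :=
    ((envBall_basis L).hasBasis_nhds_zero.tendsto_right_iff).2 fun n _ => hx n
  have h1 := ((Completion.continuous_coe (EnvTop L)).tendsto 0).comp h0
  rwa [Completion.coe_zero] at h1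

/-- Successive terms of the sequence get `p`-adically close. -/
def IsFast (L : LieSpan p k h) (x : ℕ → UniversalEnvelopingAlgebra k h) : Prop :=
  ∀ n, x (n + 1) - x n ∈ envBall L n

theorem IsFast.sub_mem {L : LieSpan p k h} {x : ℕ → UniversalEnvelopingAlgebra k h}
    (hx : IsFast L x) {n m : ℕ} (hnm : n ≤ m) : x m - x n ∈ envBall L n := by
  induction m, hnm using Nat.le_induction with
  | base => rw [sub_self]; exact zero_mem _
  | succ m hm ih =>
    rw [← sub_add_sub_cancel _ (x m)]
    exact add_mem (envBall_anti L hm (hx m)) ih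

theorem IsFast.exists_tendsto {L : LieSpan p k h} {x : ℕ → UniversalEnvelopingAlgebra k h}
    (hx : IsFast L x) : ∃ y, Tendsto (fun n => toAffinoid L (x n)) atTop (𝓝 y) := by
  have hc : CauchySeq (β := ℕ) (α := EnvTop L) x := by
    have hb : (uniformity (EnvTop L)).HasBasis (fun _ : ℕ => True) _ :=
      (uniformity_eq_comap_nhds_zero (EnvTop L)) ▸ (envBall_basis L).hasBasis_nhds_zero.comap _
    refine hb.cauchySeq_iff.2 fun n _ => ⟨n, fun a ha b hb => ?_⟩
    change x b - x a ∈ envBall L n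
    rw [← sub_sub_sub_cancel_right _ _ (x n)]
    exact AddSubgroup.sub_mem _ (hx.sub_mem hb) (hx.sub_mem ha)
  exact cauchySeq_tendsto_of_complete
    (hc.map (Completion.uniformContinuous_coe (EnvTop L)))

theorem exists_isFast_tendsto (L : LieSpan p k h) (y : AffinoidEnvelope L) :
    ∃ x, IsFast L x ∧ Tendsto (fun n => toAffinoid L (x n)) atTop (𝓝 y) := by
  let 𝒢 : Filter (EnvTop L) := comap (fun x : EnvTop L => (x : Completion (EnvTop L))) (𝓝 y)
  have hne : 𝒢.NeBot := (Completion.isDenseInducing_coe (α := EnvTop L)).comap_nhds_neBot y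
  have hS : ∀ n, ∃ S ∈ 𝒢, ∀ a ∈ S, ∀ b ∈ S,
      (show UniversalEnvelopingAlgebra k h from a - b) ∈ envBall L n := by
    intro n
    have hcau : Cauchy 𝒢 := (cauchy_nhds (a := y)).comap'
      (Completion.isUniformInducing_coe (EnvTop L)).comap_uniformity.le hne
    have hmem : {q : EnvTop L × EnvTop L | q.2 - q.1 ∈ envBall L n} ∈ uniformity (EnvTop L) := by
      rw [uniformity_eq_comap_nhds_zero]
      exact preimage_mem_comap ((envBall_basis L).hasBasis_nhds_zero.mem_of_mem (i := n) trivial)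
    obtain ⟨S, hS, hS'⟩ := (cauchy_iff.1 hcau).2 _ hmem
    exact ⟨S, hS, fun a ha b hb => hS' (Set.mk_mem_prod hb ha)⟩
  choose S hS hS' using hS
  -- The sets `S m` need not be nested, so the `n`-th term is chosen in all of the first ones;
  -- consecutive terms then share `S n`.
  have hx : ∀ n, ∃ x, ∀ m ≤ n, x ∈ S m := by
    intro n
    have : (⋂ m ∈ Set.Iic n, S m) ∈ 𝒢 :=
      (biInter_mem (Set.finite_Iic n)).2 fun m _ => hS m
    obtain ⟨x, hx⟩ := hne.nonempty_of_mem this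
    exact ⟨x, fun m hm => Set.mem_iInter₂.1 hx m hm⟩
  choose x hx using hx
  refine ⟨x, fun n => hS' n _ (hx (n + 1) n (Nat.le_succ n)) _ (hx n n le_rfl), ?_⟩
  -- The sequence is compared with an independent variable running through the trace of the
  -- neighbourhoods of `y`; the limit of the sequence is afterwards projected out of the product
  -- filter.
  have h1 : Tendsto (fun q : ℕ × EnvTop L => toAffinoid L (x q.1 - q.2)) (atTop ×ˢ 𝒢) (𝓝 0) := by
    refine tendsto_toAffinoid_zero L fun n => ?_
    filter_upwards [prod_mem_prod (Ici_mem_atTop n) (hS n)] with q hq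
    exact hS' n _ (hx q.1 n hq.1) _ hq.2
  have h2 : Tendsto (fun q : ℕ × EnvTop L => toAffinoid L q.2) (atTop ×ˢ 𝒢) (𝓝 y) :=
    tendsto_comap.comp tendsto_snd
  have h3 := h1.add h2
  rw [zero_add] at h3
  have h4 : Tendsto ((fun n => toAffinoid L (x n)) ∘ Prod.fst) (atTop ×ˢ 𝒢) (𝓝 y) := by
    have e : ∀ a b, toAffinoid L (a - b) + toAffinoid L b = toAffinoid L a := fun a b => by
      rw [← map_add, sub_add_cancel]
    exact h3.congr fun q => e _ _
  rwa [← tendsto_map'_iff, map_fst_prod] at h4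

theorem IsFast.cauchyFor {L : LieSpan p k h} {x : ℕ → UniversalEnvelopingAlgebra k h}
    (hx : IsFast L x) : CauchyFor p (map x atTop) (envLattice L : Set _) := by
  intro m
  simp only [eventually_map]
  filter_upwards [eventually_ge_atTop m] with a ha
  filter_upwards [eventually_ge_atTop m] with b hb
  have : x a - x b ∈ envBall L m := by
    rw [← sub_sub_sub_cancel_right _ _ (x m)]
    exact AddSubgroup.sub_mem _ (hx.sub_mem ha) (hx.sub_mem hb)
  obtain ⟨y, hy, e⟩ := this
  exact ⟨y, hy, e.symm⟩

theorem exists_extension (L : LieSpan p k h) [FiniteDimensional ℚ_[p] k]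
    {φ : UniversalEnvelopingAlgebra k h →ₗ[k] k}
    (hφ : BddOn (padicAbs p k) (envLattice L : Set _) φ) :
    letI := spectralNorm.normedField ℚ_[p] k
    ∃ φ' : AffinoidEnvelope L →+ k, Continuous φ' ∧ ∀ x, φ' (toAffinoid L x) = φ x := by
  let := spectralNorm.normedField ℚ_[p] k
  have : CompleteSpace k := spectralNorm.completeSpace ℚ_[p] k
  obtain ⟨C, hC⟩ := hφ
  have hcont : Continuous (X := EnvTop L) (Y := k) φ := by
    refine continuous_of_continuousAt_zero
      (show EnvTop L →+ k from φ.toAddMonoidHom) ?_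
    intro V hV
    rw [map_zero] at hV
    obtain ⟨ε, hε, hV⟩ := Metric.mem_nhds_iff.1 hV
    have hlim : Tendsto (fun n : ℕ => ((p : ℝ)⁻¹) ^ n * C) atTop (𝓝 (0 * C)) :=
      (tendsto_pow_atTop_nhds_zero_of_lt_one (by positivity) (inv_p_lt_one p)).mul_const _
    rw [zero_mul] at hlim
    obtain ⟨n, hn⟩ := (hlim.eventually (gt_mem_nhds hε)).exists
    refine mem_map.2 (((envBall_basis L).hasBasis_nhds_zero.mem_iff).2 ⟨n, trivial, ?_⟩)
    rintro _ ⟨y, hy, rfl⟩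
    refine hV ?_
    rw [mem_ball_zero_iff]
    change ‖φ ((p ^ n) • y)‖ < ε
    rw [map_nsmul, nsmul_eq_mul, Nat.cast_pow, norm_mul]
    have h2 : ‖(p : k) ^ n‖ = ((p : ℝ)⁻¹) ^ n := spectralNorm_p_pow p n
    rw [h2]
    exact (mul_le_mul_of_nonneg_left (hC y hy) (by positivity)).trans_lt hn
  exact ⟨AddMonoidHom.extension (show EnvTop L →+ k from φ.toAddMonoidHom) hcont,
    AddMonoidHom.continuous_extension _ hcont, fun x =>
      AddMonoidHom.extension_coe (show EnvTop L →+ k from φ.toAddMonoidHom) hcont x⟩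

end Sequences

/-! ### Annihilators of affinoid Dixmier modules -/

section CharIdealGenerators

attribute [local instance 100] LieRing.ofAssociativeRing

open UniversalEnvelopingAlgebra (ι lift)

variable {k : Type*} [Field k] {O : Subring k} {h : Type*} [LieRing h] [LieAlgebra k h]
  [FiniteDimensional k h]

/-- Finite generation of `b ∩ M` gives finitely many generators of the left ideal that do not depend
on `z`, with coefficients in the lattice. Therefore limits of elements of the ideal still involve a
finite sum, and the uncompleted tensor product can be used. -/
theorem exists_charIdeal_generators (hO : ∀ a, a ∈ O ∨ a⁻¹ ∈ O) {M : Submodule O h} (hM : M.FG)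
    (b : LieSubalgebra k h) (f : h →ₗ[k] k) :
    ∃ S : Finset h, (∀ s ∈ S, s ∈ b ∧ s ∈ M) ∧ ∀ z ∈ charIdeal O M b f,
      ∃ v : h → UniversalEnvelopingAlgebra k h, (∀ s, v s ∈ lat O 1 M) ∧
        z = ∑ s ∈ S, v s * (ι k s - algebraMap k _ (f s)) := by
  obtain ⟨S, hS⟩ := fg_inf_restrictScalars hO hM b.toSubmodule
  refine ⟨S, fun s hs => ?_, fun z hz => ?_⟩
  · have : s ∈ M ⊓ b.toSubmodule.restrictScalars O := hS ▸ Submodule.subset_span hs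
    exact ⟨this.2, this.1⟩
  · induction hz using Submodule.span_induction with
    | mem z hz =>
      obtain ⟨y, hyb, hyM, rfl⟩ := hz
      have hy : y ∈ Submodule.span O (S : Set h) := hS ▸ ⟨hyM, hyb⟩
      obtain ⟨c, -, e⟩ := Submodule.mem_span_finset.1 hy
      refine ⟨fun s => algebraMap k _ (c s : k), fun s => algebraMap_mem_lat (c s).2, ?_⟩
      have e' : y = ∑ s ∈ S, (c s : k) • s := e.symm
      simp only [mul_sub, Finset.sum_sub_distrib, ← map_mul]
      rw [← map_sum]
      congr 1
      · rw [e', map_sum]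
        exact Finset.sum_congr rfl fun s _ => by rw [map_smul, Algebra.smul_def]
      · rw [e', map_sum]
        simp only [map_smul, smul_eq_mul]
    | zero => exact ⟨0, fun _ => zero_mem _, by simp⟩
    | add z w _ _ hz hw =>
      obtain ⟨v, hv, rfl⟩ := hz
      obtain ⟨v', hv', rfl⟩ := hw
      exact ⟨v + v', fun s => add_mem (hv s) (hv' s), by
        simp only [Pi.add_apply, add_mul, Finset.sum_add_distrib]⟩
    | smul a z _ hz =>
      obtain ⟨v, hv, rfl⟩ := hz
      refine ⟨fun s => a * v s, fun s => mul_mem a.2 (hv s), ?_⟩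
      rw [Subalgebra.smul_def, smul_eq_mul, Finset.mul_sum]
      simp only [mul_assoc]

end CharIdealGenerators

/-! ### Annihilation of the affinoid Dixmier module in terms of functionals. -/

section Annihilators

attribute [local instance 100] LieRing.ofAssociativeRing

open UniversalEnvelopingAlgebra (ι lift)
open Filter Topology UniformSpace

variable {p : ℕ} [Fact p.Prime]
variable {k : Type*} [Field k] [Algebra ℚ_[p] k] [FiniteDimensional ℚ_[p] k]
variable {h : Type*} [LieRing h] [LieAlgebra k h]
variable {L : LieSpan p k h} {f : h →ₗ[k] k}
  (hf : ∀ x ∈ L.toSubmodule, f x ∈ valuationRing p k) {b : LieSubalgebra k h}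
  (hb : IsPolarisation f b)

theorem subalgebraMap_toAffinoid (y : UniversalEnvelopingAlgebra k b) :
    subalgebraMap L b (toAffinoid (L.restrict b) y) = toAffinoid L (envIncl b y) :=
  Completion.mapRingHom_coe _ (α := EnvTop (L.restrict b)) y

theorem continuous_subalgebraMap : Continuous (subalgebraMap L b) :=
  Completion.continuous_map

theorem affinoidChar_toAffinoid (y : UniversalEnvelopingAlgebra k b) :
    affinoidChar L hf hb (toAffinoid (L.restrict b) y) = envChar hb y := by
  let := spectralNorm.normedField ℚ_[p] k
  have : CompleteSpace k := spectralNorm.completeSpace ℚ_[p] k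
  exact Completion.extensionHom_coe (α := EnvTop (L.restrict b)) _ _ y

theorem continuous_affinoidChar :
    letI := spectralNorm.normedField ℚ_[p] k
    Continuous (affinoidChar L hf hb) := by
  let := spectralNorm.normedField ℚ_[p] k
  have : CompleteSpace k := spectralNorm.completeSpace ℚ_[p] k
  exact Completion.continuous_extension

theorem IsInd.mul_envIncl {φ : UniversalEnvelopingAlgebra k h →ₗ[k] k} (hφ : IsInd b f φ)
    (x : UniversalEnvelopingAlgebra k h) (y : UniversalEnvelopingAlgebra k b) :
    φ (x * envIncl b y) = envChar hb y * φ x := by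
  change φ (x * envMap b.incl y) = _
  induction y using env_induction generalizing x with
  | hι y => rw [envMap_ι, envChar_ι]; exact hφ x _ y.2
  | hc c => rw [AlgHom.commutes, AlgHom.commutes, ← Algebra.commutes, ← Algebra.smul_def, map_smul]; rfl
  | hadd v w hv hw => rw [map_add, mul_add, map_add, hv, hw, map_add, add_mul]
  | hmul v w hv hw => rw [map_mul (envMap b.incl), ← mul_assoc, hw, hv, map_mul]; ring

theorem toAffinoid_induction {P : AffinoidEnvelope L → Prop} (y : AffinoidEnvelope L)
    (hP : IsClosed {y | P y}) (h : ∀ x, P (toAffinoid L x)) : P y :=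
  Completion.induction_on y hP h

/-- A bounded functional that factors through the induced module, extended to the completion,
vanishes on whatever is zero in the affinoid Dixmier module. -/
theorem extension_eq_zero_of_mem_balancing {φ : UniversalEnvelopingAlgebra k h →ₗ[k] k}
    (hφ : IsInd b f φ) :
    letI := spectralNorm.normedField ℚ_[p] k
    ∀ φ' : AffinoidEnvelope L →+ k, Continuous φ' → (∀ x, φ' (toAffinoid L x) = φ x) →
    ∀ w, (w ⊗ₜ[ℤ] (show CharModule (affinoidChar L hf hb) from (1 : k)) ∈
      balancing (subalgebraMap L b) (CharModule (affinoidChar L hf hb))) → φ' w = 0 := by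
  let := spectralNorm.normedField ℚ_[p] k
  intro φ' hcont hφ' w hw
  have hmul : ∀ a y, φ' (a * subalgebraMap L b y) = affinoidChar L hf hb y * φ' a := by
    intro a y
    induction a using toAffinoid_induction with
    | hP =>
      exact isClosed_eq (hcont.comp (continuous_id.mul continuous_const))
        (continuous_const.mul hcont)
    | h a =>
      induction y using toAffinoid_induction with
      | hP =>
        exact isClosed_eq (hcont.comp (continuous_const.mul continuous_subalgebraMap))
          ((continuous_affinoidChar hf hb).mul continuous_const)
      | h y =>
        rw [subalgebraMap_toAffinoid, ← map_mul, hφ', hφ', affinoidChar_toAffinoid]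
        exact hφ.mul_envIncl hb a y
  let Φ : AffinoidEnvelope L ⊗[ℤ] CharModule (affinoidChar L hf hb) →+ k :=
    TensorProduct.liftAddHom
      ((AddMonoidHom.mul.comp φ') : AffinoidEnvelope L →+ k →+ k) (by
        intro r a m
        change φ' (r • a) * (show k from m) = φ' a * (r • (show k from m))
        rw [map_zsmul, smul_mul_assoc, mul_smul_comm])
  have hΦ : ∀ a (m : CharModule (affinoidChar L hf hb)), Φ (a ⊗ₜ m) = φ' a * (show k from m) :=
    fun a m => rfl
  -- The submodule is spanned over the completed algebra, for which `Φ` is not linear, so a left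
  -- multiplier is carried through the induction.
  have key : ∀ z ∈ balancing (subalgebraMap L b) (CharModule (affinoidChar L hf hb)),
      ∀ a : AffinoidEnvelope L, Φ (a • z) = 0 := by
    intro z hz
    induction hz using Submodule.span_induction with
    | mem z hz =>
      obtain ⟨c, y, m, rfl⟩ := hz
      intro a
      rw [smul_sub, TensorProduct.smul_tmul', TensorProduct.smul_tmul', map_sub, hΦ, hΦ,
        smul_eq_mul, smul_eq_mul, ← mul_assoc, hmul]
      change _ - _ * (affinoidChar L hf hb y * (show k from m)) = 0
      ring
    | zero => intro a; rw [smul_zero, map_zero]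
    | add z w _ _ hz hw => intro a; rw [smul_add, map_add, hz, hw, add_zero]
    | smul c z _ hz => intro a; rw [← mul_smul]; exact hz _
  have h1 := key _ hw 1
  rw [one_smul, hΦ] at h1
  exact (mul_one _).symm.trans h1

theorem DualBasis.exists_finset (H : IsGoodLattice (padicAbs p k) p L.toSubmodule)
    (B : DualBasis (valuationRing p k) L.toSubmodule b f) {S : Finset h}
    (hS : ∀ z ∈ charIdeal (valuationRing p k) L.toSubmodule b f,
      ∃ v : h → UniversalEnvelopingAlgebra k h, (∀ s, v s ∈ envLattice L) ∧
        z = ∑ s ∈ S, v s * (ι k s - algebraMap k _ (f s)))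
    (x : UniversalEnvelopingAlgebra k h) :
    ∃ (T : Finset B.I) (v : h → UniversalEnvelopingAlgebra k h), (∀ i ∉ T, B.φ i x = 0) ∧
      (x ∈ envLattice L → ∀ s, v s ∈ envLattice L) ∧
      x = ∑ i ∈ T, B.φ i x • B.t i + ∑ s ∈ S, v s * (ι k s - algebraMap k _ (f s)) := by
  by_cases hx : x ∈ envLattice L
  · obtain ⟨T, hT, hT'⟩ := B.repr x (by rwa [← envLattice_eq_lat])
    obtain ⟨v, hv, e⟩ := hS _ hT'
    exact ⟨T, v, hT, fun _ => hv, by rw [← e, add_sub_cancel]⟩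
  · obtain ⟨d, -, hd0, hd⟩ := H.exists_smul_mem_lat one_ne_zero x
    obtain ⟨T, hT, hT'⟩ := B.repr _ hd
    obtain ⟨v, -, e⟩ := hS _ hT'
    refine ⟨T, fun s => d⁻¹ • v s, fun i hi => ?_, fun h => absurd h hx, ?_⟩
    · have := hT i hi
      rw [map_smul, smul_eq_mul] at this
      exact (mul_eq_zero.1 this).resolve_left hd0
    · have e' := congrArg (fun z => d⁻¹ • z) e
      simp only [smul_sub, inv_smul_smul₀ hd0, map_smul, Finset.smul_sum, smul_assoc,
        ← smul_mul_assoc] at e'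
      exact sub_eq_iff_eq_add'.1 e'

/-- For `m ≥ n` the value at `x m` differs from that at `x n` by an element of `pⁿ O`, and for large
`m` it is itself that small. -/
theorem DualBasis.exists_mul_eq (B : DualBasis (valuationRing p k) L.toSubmodule b f)
    {x : ℕ → UniversalEnvelopingAlgebra k h} (hx : IsFast L x)
    (hnull : ∀ i, Null (padicAbs p k) atTop fun n => B.φ i (x n)) (i : B.I) (n : ℕ) :
    ∃ c ∈ valuationRing p k, B.φ i (x n) = (p : k) ^ n * c := by
  have hp0 : (p : k) ^ n ≠ 0 := pow_ne_zero _ (p_ne_zero p k)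
  have hpn : padicAbs p k ((p : k) ^ n) = ((p : ℝ)⁻¹) ^ n := spectralNorm_p_pow p n
  refine ⟨((p : k) ^ n)⁻¹ * B.φ i (x n), ?_, (mul_inv_cancel_left₀ hp0 _).symm⟩
  have hpos : 0 < ((p : ℝ)⁻¹) ^ n := by
    rw [← hpn]; exact (padicAbs p k).pos hp0
  obtain ⟨m, hm, hmn⟩ := (((hnull i).eventually (gt_mem_nhds hpos)).and
    (eventually_ge_atTop n)).exists
  obtain ⟨z, hz, e⟩ := hx.sub_mem hmn
  have hz' : z ∈ lat (valuationRing p k) 1 L.toSubmodule := by rw [← envLattice_eq_lat]; exact hz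
  obtain ⟨c, hc, ec⟩ := B.φ_mem 1 (one_mem _) z hz' i
  have e2 : B.φ i (x n) = B.φ i (x m) + -((p : k) ^ n * c) := by
    have e1 : B.φ i ((p ^ n) • z) = B.φ i (x m - x n) := congrArg (B.φ i) e
    rw [map_nsmul, map_sub, ec, one_pow, one_mul, nsmul_eq_mul, Nat.cast_pow] at e1
    rw [e1]; ring
  rw [mem_valuationRing_iff, map_mul, map_inv₀, hpn, inv_mul_le_iff₀ hpos, mul_one, e2]
  refine (isNonarchimedean_padicAbs _ _).trans (max_le hm.le ?_)
  rw [map_neg_eq_map, map_mul, hpn]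
  exact mul_le_of_le_one_right hpos.le hc

/-- Each difference `pⁿ z n` is split into a combination of the `tᵢ` and one of the finitely many
generators `s - f(s)`. The coefficients of the generators converge because those of `z n` are
integral; the accumulated `tᵢ`-part of `x n` lies in `pⁿ U(L)` by `exists_mul_eq` and tends to zero.
-/
theorem DualBasis.exists_eq_sum (H : IsGoodLattice (padicAbs p k) p L.toSubmodule)
    (B : DualBasis (valuationRing p k) L.toSubmodule b f) {S : Finset h}
    (hS : ∀ z ∈ charIdeal (valuationRing p k) L.toSubmodule b f,
      ∃ v : h → UniversalEnvelopingAlgebra k h, (∀ s, v s ∈ envLattice L) ∧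
        z = ∑ s ∈ S, v s * (ι k s - algebraMap k _ (f s)))
    {x : ℕ → UniversalEnvelopingAlgebra k h} (hx : IsFast L x) {y : AffinoidEnvelope L}
    (hy : Tendsto (fun n => toAffinoid L (x n)) atTop (𝓝 y))
    (hnull : ∀ i, Null (padicAbs p k) atTop fun n => B.φ i (x n)) :
    ∃ V : h → AffinoidEnvelope L,
      y = ∑ s ∈ S, V s * toAffinoid L (ι k s - algebraMap k _ (f s)) := by
  classical
  obtain ⟨T₀, v₀, hT₀, -, e₀⟩ := B.exists_finset H hS (x 0)
  have hz : ∀ n, ∃ z ∈ envLattice L, (p ^ n) • z = x (n + 1) - x n := hx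
  choose z hz ez using hz
  choose T v hT hv e using fun n => B.exists_finset H hS (z n)
  let W : ℕ → h → UniversalEnvelopingAlgebra k h := fun n s =>
    v₀ s + ∑ m ∈ Finset.range n, (p ^ m) • v m s
  have hW : ∀ s, IsFast L fun n => W n s := fun s n => by
    refine ⟨v n s, hv n (hz n) s, ?_⟩
    change (p ^ n) • v n s = W (n + 1) s - W n s
    simp only [W, Finset.sum_range_succ]
    abel
  have hR : ∀ n, ∃ T' : Finset B.I, (∀ i ∉ T', B.φ i (x n) = 0) ∧
      x n - ∑ s ∈ S, W n s * (ι k s - algebraMap k _ (f s)) = ∑ i ∈ T', B.φ i (x n) • B.t i := by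
    intro n
    induction n with
    | zero =>
      refine ⟨T₀, hT₀, ?_⟩
      simp only [W, Finset.range_zero, Finset.sum_empty, add_zero]
      rw [sub_eq_iff_eq_add]
      exact e₀
    | succ n ih =>
      obtain ⟨T', hT', e'⟩ := ih
      have hφ : ∀ i, B.φ i (x (n + 1)) = B.φ i (x n) + (p ^ n) • B.φ i (z n) := fun i => by
        rw [← map_nsmul, ez, map_sub, add_sub_cancel]
      refine ⟨T' ∪ T n, fun i hi => ?_, ?_⟩
      · rw [Finset.notMem_union] at hi
        rw [hφ, hT' i hi.1, hT n i hi.2, smul_zero, add_zero]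
      · have h1 : ∑ i ∈ T' ∪ T n, B.φ i (x n) • B.t i = ∑ i ∈ T', B.φ i (x n) • B.t i :=
          (Finset.sum_subset Finset.subset_union_left fun i _ hi => by
            rw [hT' i hi, zero_smul]).symm
        have h2 : ∑ i ∈ T' ∪ T n, B.φ i (z n) • B.t i = ∑ i ∈ T n, B.φ i (z n) • B.t i :=
          (Finset.sum_subset Finset.subset_union_right fun i _ hi => by
            rw [hT n i hi, zero_smul]).symm
        have h3 : ∑ i ∈ T n, B.φ i (z n) • B.t i
            = z n - ∑ s ∈ S, v n s * (ι k s - algebraMap k _ (f s)) :=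
          eq_sub_of_add_eq (e n).symm
        have h4 : x (n + 1) = x n + (p ^ n) • z n := by rw [ez, add_sub_cancel]
        simp only [hφ, add_smul, Finset.sum_add_distrib, smul_assoc]
        rw [← Finset.smul_sum, h1, h2, h3, ← e', h4]
        simp only [W, Finset.sum_range_succ, ← add_assoc]
        simp only [add_mul, Finset.sum_add_distrib, smul_mul_assoc, smul_sub, Finset.smul_sum]
        abel
  have hlim : Tendsto (fun n => toAffinoid L
      (x n - ∑ s ∈ S, W n s * (ι k s - algebraMap k _ (f s)))) atTop (𝓝 0) := by
    refine tendsto_toAffinoid_zero L fun n => ?_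
    filter_upwards [eventually_ge_atTop n] with m hm
    refine envBall_anti L hm ?_
    obtain ⟨T', -, e'⟩ := hR m
    rw [e']
    refine sum_mem fun i _ => ?_
    obtain ⟨c, hc, ec⟩ := B.exists_mul_eq hx hnull i m
    refine ⟨c • B.t i, ?_, ?_⟩
    · have ht := B.t_mem 1 (one_mem _) i
      rw [one_pow, one_smul] at ht
      change c • B.t i ∈ envLattice L
      rw [envLattice_eq_lat]
      exact smul_mem_lat hc ht
    · change (p ^ m) • c • B.t i = _
      rw [ec, mul_smul, ← Nat.cast_pow, Nat.cast_smul_eq_nsmul]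
  choose V hV using fun s => (hW s).exists_tendsto
  refine ⟨V, ?_⟩
  have h1 : Tendsto (fun n => toAffinoid L
      (x n - ∑ s ∈ S, W n s * (ι k s - algebraMap k _ (f s)))) atTop
      (𝓝 (y - ∑ s ∈ S, V s * toAffinoid L (ι k s - algebraMap k _ (f s)))) := by
    simp only [map_sub, map_sum, map_mul]
    simp only [← map_sub]
    refine hy.sub (tendsto_finsetSum _ fun s _ => (hV s).mul tendsto_const_nhds)
  exact sub_eq_zero.1 (tendsto_nhds_unique h1 hlim)

/-- If `w` annihilates the module, continuous extensions of bounded functionals vanish on `w a`.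
Conversely, if the dual basis functionals vanish on all `w y`, then `w y` is a finite sum `∑ V s (s
- f(s))`, and such a sum tensored with the character is zero. -/
theorem mem_annihilator_iff_kill [FiniteDimensional k h] [LieRing.IsNilpotent h]
    (hL : L.toSubmodule.FG) {x : ℕ → UniversalEnvelopingAlgebra k h}
    {w : AffinoidEnvelope L} (hw : Tendsto (fun n => toAffinoid L (x n)) atTop (𝓝 w)) :
    w ∈ Module.annihilator (AffinoidEnvelope L) (DixmierModule L hf hb) ↔
      Kill (padicAbs p k) (map x atTop) L.toSubmodule b f := by
  let := spectralNorm.normedField ℚ_[p] k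
  have H := L.isGoodLattice hL
  have hlimU : ∀ {φ : UniversalEnvelopingAlgebra k h →ₗ[k] k} {φ' : AffinoidEnvelope L →+ k},
      Continuous φ' → (∀ x, φ' (toAffinoid L x) = φ x) → ∀ a,
      Tendsto (fun n => φ (x n * a)) atTop (𝓝 (φ' (w * toAffinoid L a))) := by
    intro φ φ' hcont hφ' a
    refine ((hcont.tendsto _).comp (hw.mul_const (toAffinoid L a))).congr fun n => ?_
    rw [Function.comp_apply, ← map_mul, hφ']
  constructor
  · intro hann φ hφ hφb a
    rw [← envLattice_eq_lat] at hφb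
    obtain ⟨φ', hcont, hφ'⟩ := exists_extension L hφb
    have hmem : (w * toAffinoid L a) ⊗ₜ[ℤ] (show CharModule (affinoidChar L hf hb) from (1 : k)) ∈
        balancing (subalgebraMap L b) (CharModule (affinoidChar L hf hb)) := by
      have h1 := Module.mem_annihilator.1 hann (Submodule.Quotient.mk
        (toAffinoid L a ⊗ₜ[ℤ] (show CharModule (affinoidChar L hf hb) from (1 : k))))
      rw [← Submodule.Quotient.mk_smul, Submodule.Quotient.mk_eq_zero,
        TensorProduct.smul_tmul'] at h1
      exact h1
    have h0 := extension_eq_zero_of_mem_balancing hf hb hφ φ' hcont hφ' _ hmem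
    have h2 := hlimU hcont hφ' a
    rw [h0] at h2
    exact tendsto_map'_iff.2 (tendsto_zero_iff_norm_tendsto_zero.1 h2)
  · intro hK
    obtain ⟨R⟩ := exists_relBasis H.mem_or_inv_mem hL H.span H.lie b
    let B : DualBasis (valuationRing p k) L.toSubmodule b f := RelBasis.dualBasis (j := b.incl) R
      (fun y => ⟨fun hy => ⟨⟨y, hy⟩, rfl⟩, fun ⟨a, ha⟩ => ha ▸ a.2⟩)
      (fun a c => (hb.2 a).2 a.2 c c.2) (fun a ha => hf _ ha)
    obtain ⟨S, hSb, hS'⟩ := exists_charIdeal_generators H.mem_or_inv_mem hL b f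
    have hS : ∀ z ∈ charIdeal (valuationRing p k) L.toSubmodule b f,
        ∃ v : h → UniversalEnvelopingAlgebra k h, (∀ s, v s ∈ envLattice L) ∧
          z = ∑ s ∈ S, v s * (ι k s - algebraMap k _ (f s)) := by
      simpa only [envLattice_eq_lat] using hS'
    have hBb : ∀ i, BddOn (padicAbs p k) (lat (valuationRing p k) 1 L.toSubmodule : Set _) (B.φ i) :=
      fun i => ⟨1, fun z hz => by
        obtain ⟨c, hc, e⟩ := B.φ_mem 1 (one_mem _) z hz i
        rw [e, one_pow, one_mul]
        exact hc⟩
    have hnull : ∀ {y : AffinoidEnvelope L} {u : ℕ → UniversalEnvelopingAlgebra k h},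
        Tendsto (fun n => toAffinoid L (u n)) atTop (𝓝 (w * y)) → ∀ i,
        Null (padicAbs p k) atTop fun n => B.φ i (u n) := by
      intro y u hu i
      have hb' := hBb i
      rw [← envLattice_eq_lat] at hb'
      obtain ⟨φ', hcont, hφ'⟩ := exists_extension L hb'
      have hzero : ∀ z, φ' (w * z) = 0 := by
        intro z
        induction z using toAffinoid_induction with
        | hP => exact isClosed_eq (hcont.comp (continuous_const.mul continuous_id)) continuous_const
        | h a =>
          refine tendsto_nhds_unique (hlimU hcont hφ' a) ?_
          exact tendsto_zero_iff_norm_tendsto_zero.2 (tendsto_map'_iff.1 (hK _ (B.isInd i) (hBb i) a))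
      have h1 := ((hcont.tendsto _).comp hu)
      rw [hzero] at h1
      refine (tendsto_zero_iff_norm_tendsto_zero.1 h1).congr fun n => ?_
      rw [Function.comp_apply, hφ']
      rfl
    rw [Module.mem_annihilator]
    intro m
    obtain ⟨t, rfl⟩ := Submodule.Quotient.mk_surjective _ m
    rw [← Submodule.Quotient.mk_smul, Submodule.Quotient.mk_eq_zero]
    induction t using TensorProduct.induction_on with
    | zero => rw [smul_zero]; exact zero_mem _
    | add t t' ht ht' => rw [smul_add]; exact add_mem ht ht'
    | tmul y m =>
      obtain ⟨u, hu, hu'⟩ := exists_isFast_tendsto L (w * y)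
      obtain ⟨V, hV⟩ := B.exists_eq_sum H hS hu hu' (hnull hu')
      rw [TensorProduct.smul_tmul', smul_eq_mul, hV, TensorProduct.sum_tmul]
      refine sum_mem fun s hs => Submodule.subset_span ?_
      let s' : b := ⟨s, (hSb s hs).1⟩
      refine ⟨V s, toAffinoid (L.restrict b) (ι k s' - algebraMap k _ (f s)), m, ?_⟩
      rw [subalgebraMap_toAffinoid]
      have e1 : envIncl b (ι k s' - algebraMap k _ (f s)) = ι k s - algebraMap k _ (f s) := by
        rw [map_sub, AlgHom.commutes]
        congr 1
        exact envMap_ι b.incl s'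
      have e2 : toAffinoid (L.restrict b) (ι k s' - algebraMap k _ (f s)) • m = 0 := by
        change affinoidChar L hf hb (toAffinoid (L.restrict b) (ι k s' - algebraMap k _ (f s)))
          * (show k from m) = 0
        rw [affinoidChar_toAffinoid, map_sub, AlgHom.commutes, envChar_ι]
        exact mul_eq_zero_of_left (sub_self _) _
      rw [e1, e2, TensorProduct.tmul_zero, sub_zero]

end Annihilators

/-! ### Base change -/

section BaseChange

attribute [local instance 100] LieRing.ofAssociativeRing

open UniversalEnvelopingAlgebra (ι lift)
open Filter Topology

/-- An extension of scalars `h → H` of Lie algebras, with the induced maps between enveloping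
algebras. -/
structure LieBaseChange (k E h H : Type*) [Field k] [Field E] [Algebra k E] [LieRing h]
    [LieAlgebra k h] [LieRing H] [LieAlgebra E H] where
  j : h →+ H
  τ : UniversalEnvelopingAlgebra k h →+* UniversalEnvelopingAlgebra E H
  T : UniversalEnvelopingAlgebra E H →ₐ[E] E ⊗[k] UniversalEnvelopingAlgebra k h
  j_smul : ∀ (c : k) y, j (c • y) = algebraMap k E c • j y
  j_lie : ∀ x y, j ⁅x, y⁆ = ⁅j x, j y⁆
  span : ∀ z, z ∈ Submodule.span E (Set.range j)
  τ_ι : ∀ y, τ (ι k y) = ι E (j y)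
  τ_algebraMap : ∀ c, τ (algebraMap k _ c) = algebraMap E _ (algebraMap k E c)
  T_τ : ∀ w, T (τ w) = 1 ⊗ₜ w

namespace LieBaseChange

variable {k E h H : Type*} [Field k] [Field E] [Algebra k E] [LieRing h]
  [LieAlgebra k h] [LieRing H] [LieAlgebra E H] (D : LieBaseChange k E h H)

theorem τ_smul (c : k) (w : UniversalEnvelopingAlgebra k h) :
    D.τ (c • w) = algebraMap k E c • D.τ w := by
  rw [Algebra.smul_def, map_mul, D.τ_algebraMap, Algebra.smul_def]

theorem mem_span_τ (w : UniversalEnvelopingAlgebra E H) :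
    w ∈ Submodule.span E (Set.range D.τ) := by
  induction w using env_induction with
  | hι y =>
    have hy := D.span y
    induction hy using Submodule.span_induction with
    | mem y hy =>
      obtain ⟨x, rfl⟩ := hy
      exact Submodule.subset_span ⟨ι k x, D.τ_ι x⟩
    | zero => rw [map_zero]; exact zero_mem _
    | add x y _ _ hx hy => rw [map_add]; exact add_mem hx hy
    | smul c x _ hx => rw [map_smul]; exact Submodule.smul_mem _ _ hx
  | hc c =>
    rw [Algebra.algebraMap_eq_smul_one]
    exact Submodule.smul_mem _ _ (Submodule.subset_span ⟨1, map_one _⟩)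
  | hadd v w hv hw => exact add_mem hv hw
  | hmul v w hv hw =>
    have h1 := Submodule.mul_mem_mul hv hw
    rw [Submodule.span_mul_span] at h1
    refine Submodule.span_mono ?_ h1
    rintro _ ⟨_, ⟨a, rfl⟩, _, ⟨c, rfl⟩, rfl⟩
    exact ⟨a * c, map_mul _ _ _⟩

/-- The subalgebra obtained from `b` by extension of scalars. -/
def extendSub (b : LieSubalgebra k h) : LieSubalgebra E H :=
  { Submodule.span E (D.j '' (b : Set h)) with
    lie_mem' := by
      intro x y hx hy
      change ⁅x, y⁆ ∈ Submodule.span E (D.j '' (b : Set h))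
      change x ∈ Submodule.span E (D.j '' (b : Set h)) at hx
      change y ∈ Submodule.span E (D.j '' (b : Set h)) at hy
      induction hx using Submodule.span_induction with
      | zero => rw [zero_lie]; exact zero_mem _
      | add a c _ _ ha hc => rw [add_lie]; exact add_mem ha hc
      | smul c a _ ha => rw [smul_lie]; exact Submodule.smul_mem _ _ ha
      | mem x hx =>
        obtain ⟨x, hx, rfl⟩ := hx
        induction hy using Submodule.span_induction with
        | zero => rw [lie_zero]; exact zero_mem _
        | add a c _ _ ha hc => rw [lie_add]; exact add_mem ha hc
        | smul c a _ ha => rw [lie_smul]; exact Submodule.smul_mem _ _ ha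
        | mem y hy =>
          obtain ⟨y, hy, rfl⟩ := hy
          rw [← D.j_lie]
          exact Submodule.subset_span ⟨_, b.lie_mem hx hy, rfl⟩ }

variable {b : LieSubalgebra k h} {f : h →ₗ[k] k} {fE : H →ₗ[E] E}

theorem mem_extendSub_iff {z : H} :
    z ∈ D.extendSub b ↔ z ∈ Submodule.span E (D.j '' (b : Set h)) := Iff.rfl

theorem j_mem_extendSub {y : h} (hy : y ∈ b) : D.j y ∈ D.extendSub b :=
  Submodule.subset_span ⟨y, hy, rfl⟩

/-- Expansion along a basis of `E` over `k`, so that conditions over `E` can be read off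
coefficientwise in `h`. -/
theorem exists_eq_sum {ι' : Type*} (B : Module.Basis ι' k E) (z : H) :
    ∃ y : ι' →₀ h, z = y.sum fun i y => B i • D.j y := by
  have hadd : ∀ y y' : ι' →₀ h, ((y + y').sum fun i y => B i • D.j y)
      = (y.sum fun i y => B i • D.j y) + y'.sum fun i y => B i • D.j y := fun y y' =>
    Finsupp.sum_add_index' (fun i => by rw [map_zero, smul_zero])
      (fun i a c => by rw [map_add, smul_add])
  have hz := D.span z
  induction hz using Submodule.closure_induction with
  | zero => exact ⟨0, by simp⟩
  | add x y _ _ hx hy =>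
    obtain ⟨y₁, rfl⟩ := hx
    obtain ⟨y₂, rfl⟩ := hy
    exact ⟨y₁ + y₂, (hadd _ _).symm⟩
  | smul_mem e z hz =>
    obtain ⟨x, rfl⟩ := hz
    refine ⟨(B.repr e).mapRange (fun c => c • x) (zero_smul _ _), ?_⟩
    rw [Finsupp.sum_mapRange_index fun i => by rw [map_zero, smul_zero]]
    conv_lhs => rw [← B.linearCombination_repr e, Finsupp.linearCombination_apply, Finsupp.sum,
      Finset.sum_smul]
    refine Finset.sum_congr rfl fun i _ => ?_
    change (B.repr e i • B i) • D.j x = B i • D.j (B.repr e i • x)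
    rw [D.j_smul, ← mul_smul, Algebra.smul_def, mul_comm]

/-- Orthogonality to `b` of `∑ Bᵢ j(yᵢ)` is a relation among the linearly independent `Bᵢ`, so every
`yᵢ` is orthogonal to `b`. -/
theorem isPolIn_extendSub (hb : IsPolIn ⊤ b f) (hfE : ∀ y, fE (D.j y) = algebraMap k E (f y)) :
    IsPolIn ⊤ (D.extendSub b) fE := by
  refine ⟨le_top, fun z hz₀ => ⟨fun hz => ?_, fun hz w hw => ?_⟩⟩
  · let B := Module.Basis.ofVectorSpace k E
    obtain ⟨y, rfl⟩ := D.exists_eq_sum B z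
    change y.sum _ ∈ Submodule.span E (D.j '' (b : Set h))
    refine sum_mem fun i _ => Submodule.smul_mem _ _ ?_
    refine D.j_mem_extendSub ((hb.mem_iff _ trivial).1 fun x hx => ?_)
    have h1 := hz _ (D.j_mem_extendSub hx)
    rw [Finsupp.sum, sum_lie, map_sum] at h1
    have h2 : ∑ i ∈ y.support, f ⁅y i, x⁆ • B i = 0 := by
      rw [← h1]
      refine Finset.sum_congr rfl fun i _ => ?_
      rw [smul_lie, ← D.j_lie, map_smul, hfE, smul_eq_mul, Algebra.smul_def, mul_comm]
    by_cases hi : i ∈ y.support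
    · exact linearIndependent_iff'.1 B.linearIndependent _ _ h2 i hi
    · rw [Finsupp.notMem_support_iff.1 hi, zero_lie, map_zero]
  · clear hz₀
    rw [mem_extendSub_iff] at hz hw
    induction hz using Submodule.span_induction with
    | zero => rw [zero_lie, map_zero]
    | add a c _ _ ha hc => rw [add_lie, map_add, ha, hc, add_zero]
    | smul c a _ ha => rw [smul_lie, map_smul, ha, smul_zero]
    | mem x hx =>
      obtain ⟨x, hx, rfl⟩ := hx
      induction hw using Submodule.span_induction with
      | zero => rw [lie_zero, map_zero]
      | add a c _ _ ha hc => rw [lie_add, map_add, ha, hc, add_zero]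
      | smul c a _ ha => rw [lie_smul, map_smul, ha, smul_zero]
      | mem y hy =>
        obtain ⟨y, hy, rfl⟩ := hy
        rw [← D.j_lie, hfE, hb.isotropic hx hy, map_zero]

variable {O : Subring k} {OE : Subring E} {v : AbsoluteValue k ℝ} {vE : AbsoluteValue E ℝ}
  {M : Submodule O h} {ME : Submodule OE H} {p : ℕ}

theorem τ_mem_lat (hO : ∀ c ∈ O, algebraMap k E c ∈ OE) (hM : ∀ y ∈ M, D.j y ∈ ME) {q : k}
    {w : UniversalEnvelopingAlgebra k h} (hw : w ∈ lat O q M) :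
    D.τ w ∈ lat OE (algebraMap k E q) ME := by
  induction hw using lat_induction with
  | hι y hy =>
    rw [D.τ_ι, D.j_smul]
    exact ι_smul_mem_lat (hM y hy)
  | hc c hc => rw [D.τ_algebraMap]; exact algebraMap_mem_lat (hO c hc)
  | hadd v w _ _ hv hw => rw [map_add]; exact add_mem hv hw
  | hmul v w _ _ hv hw => rw [map_mul]; exact mul_mem hv hw

/-- The map `T` expresses the lattice over `E` as combinations, with integral coefficients, of the
lattice over `k`; bounds for functionals pass to their `E`-linear extensions through it. -/
theorem T_mem_span (hME : ∀ z ∈ ME, z ∈ Submodule.span OE (D.j '' (M : Set h)))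
    {w : UniversalEnvelopingAlgebra E H} (hw : w ∈ lat OE 1 ME) :
    D.T w ∈ Submodule.span OE {z | ∃ u ∈ lat O 1 M, z = (1 : E) ⊗ₜ[k] u} := by
  induction hw using lat_induction with
  | hι y hy =>
    rw [one_smul]
    have hy' := hME y hy
    clear hy
    induction hy' using Submodule.span_induction with
    | zero => rw [map_zero, map_zero]; exact zero_mem _
    | add x y _ _ hx hy => rw [map_add, map_add]; exact add_mem hx hy
    | smul c x _ hx =>
      change D.T (ι E ((c : E) • x)) ∈ _
      rw [map_smul, map_smul]
      exact Submodule.smul_mem _ c hx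
    | mem y hy =>
      obtain ⟨y, hy, rfl⟩ := hy
      rw [← D.τ_ι, D.T_τ]
      exact Submodule.subset_span ⟨_, by simpa only [one_smul] using ι_smul_mem_lat (q := 1) hy, rfl⟩
  | hc c hc =>
    rw [AlgHom.commutes, Algebra.algebraMap_eq_smul_one]
    exact Submodule.smul_mem _ (⟨c, hc⟩ : OE) (Submodule.subset_span ⟨1, one_mem _, rfl⟩)
  | hadd v w _ _ hv hw => rw [map_add]; exact add_mem hv hw
  | hmul v w _ _ hv hw =>
    rw [map_mul]
    have h1 := Submodule.mul_mem_mul hv hw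
    rw [Submodule.span_mul_span] at h1
    refine Submodule.span_mono ?_ h1
    rintro _ ⟨_, ⟨a, ha, rfl⟩, _, ⟨c, hc, rfl⟩, rfl⟩
    exact ⟨a * c, mul_mem ha hc, by
      change (1 : E) ⊗ₜ[k] a * (1 : E) ⊗ₜ[k] c = _
      rw [Algebra.TensorProduct.tmul_mul_tmul, one_mul]⟩

/-- Upwards, a functional over `E` restricts to an `E`-valued functional on `U(h)`, to which the
`k`-valued dual basis applies. Downwards, a functional over `k` extends `E`-linearly through `T`
with the same bound. -/
theorem kill_extendSub_iff [FiniteDimensional k h] [LieRing.IsNilpotent h]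
    (Hg : IsGoodLattice v p M) (hvE : IsNonarchimedean vE)
    (hOE : ∀ x, x ∈ OE ↔ vE x ≤ 1) (hv : ∀ c, vE (algebraMap k E c) = v c)
    (hM : ∀ y ∈ M, D.j y ∈ ME) (hME : ∀ z ∈ ME, z ∈ Submodule.span OE (D.j '' (M : Set h)))
    {ℱ : Filter (UniversalEnvelopingAlgebra k h)} [NeBot ℱ] (hc : CauchyFor p ℱ (lat O 1 M : Set _))
    (hfM : ∀ m ∈ M, f m ∈ O)
    (hb : IsPolIn ⊤ b f) (hfE : ∀ y, fE (D.j y) = algebraMap k E (f y)) :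
    Kill v ℱ M b f ↔ Kill vE (map D.τ ℱ) ME (D.extendSub b) fE := by
  have hO : ∀ c ∈ O, algebraMap k E c ∈ OE := fun c hc => by
    rw [hOE, hv]; exact (Hg.mem_iff c).1 hc
  constructor
  · intro hK φ hφ hφb a
    have ha := D.mem_span_τ a
    induction ha using Submodule.span_induction with
    | zero => simpa using Null.zero
    | add a c _ _ ha hc => simpa only [mul_add, map_add] using ha.add hc
    | smul c a _ ha => simpa only [mul_smul_comm, map_smul, smul_eq_mul] using ha.const_mul c
    | mem a ha =>
      obtain ⟨a, rfl⟩ := ha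
      refine tendsto_map'_iff.2 ?_
      let ψ : UniversalEnvelopingAlgebra k h →ₗ[k] E :=
        { toFun := fun w => φ (D.τ w)
          map_add' := fun w w' => by rw [map_add, map_add]
          map_smul' := fun c w => by
            rw [D.τ_smul, map_smul, RingHom.id_apply, algebraMap_smul] }
      have hψ : IsInd b f ψ := by
        intro w y hy
        change φ (D.τ (w * ι k y)) = f y • φ (D.τ w)
        rw [map_mul, D.τ_ι, hφ _ _ (D.j_mem_extendSub hy), hfE, algebraMap_smul]
      have hψb : BddOn vE (lat O 1 M : Set _) ψ := by
        obtain ⟨C, hC⟩ := hφb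
        refine ⟨C, fun w hw => hC _ ?_⟩
        have := D.τ_mem_lat hO hM hw
        rwa [map_one] at this
      obtain ⟨R⟩ := exists_relBasis Hg.mem_or_inv_mem Hg.fg Hg.span Hg.lie b
      let B : DualBasis O M b f := RelBasis.dualBasis (j := b.incl) R
        (fun y => ⟨fun hy => ⟨⟨y, hy⟩, rfl⟩, fun ⟨a, ha⟩ => ha ▸ a.2⟩)
        (fun a c => hb.isotropic a.2 c.2) (fun a ha => hfM _ ha)
      obtain ⟨d, -, hd0, hd⟩ := Hg.exists_smul_mem_lat one_ne_zero a
      have key := B.null hvE hv Hg hc (AddMonoidHom.mulRight a) (one_mem O) hd0 (fun z hz => by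
        change d • (z * a) ∈ _
        rw [← mul_smul_comm]
        exact mul_mem hz hd) hψ hψb (fun i => hK _ (B.isInd i) ⟨1, fun w hw => by
          obtain ⟨c, hc, e⟩ := B.φ_mem 1 (one_mem O) w hw i
          rw [e, one_pow, one_mul]
          exact (Hg.mem_iff c).1 hc⟩ a)
      refine key.congr fun x => ?_
      change vE (φ (D.τ (x * a))) = vE (φ (D.τ x * D.τ a))
      rw [map_mul D.τ]
  · intro hK φ hφ hφb a
    let Φ : UniversalEnvelopingAlgebra E H →ₗ[E] E :=
      LinearMap.liftBaseChange E (Algebra.linearMap k E ∘ₗ φ) ∘ₗ D.T.toLinearMap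
    have hT : ∀ (e : E) w, LinearMap.liftBaseChange E (Algebra.linearMap k E ∘ₗ φ) (e ⊗ₜ w)
        = e * algebraMap k E (φ w) := fun e w => by
      rw [LinearMap.liftBaseChange_tmul]; rfl
    have hΦτ : ∀ w, Φ (D.τ w) = algebraMap k E (φ w) := fun w => by
      change LinearMap.liftBaseChange E (Algebra.linearMap k E ∘ₗ φ) (D.T (D.τ w)) = _
      rw [D.T_τ, hT, one_mul]
    have hΦ : IsInd (D.extendSub b) fE Φ := by
      intro w z hz
      rw [mem_extendSub_iff] at hz
      induction hz using Submodule.span_induction with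
      | zero => simp only [map_zero, mul_zero, zero_smul]
      | add x y _ _ hx hy => rw [map_add, mul_add, map_add, hx, hy, map_add, add_smul]
      | smul c x _ hx => rw [map_smul, mul_smul_comm, map_smul, hx, map_smul, smul_assoc]
      | mem y hy =>
        obtain ⟨y, hy, rfl⟩ := hy
        rw [hfE, ← D.τ_ι]
        change LinearMap.liftBaseChange E (Algebra.linearMap k E ∘ₗ φ) (D.T (w * D.τ (ι k y)))
          = algebraMap k E (f y) • LinearMap.liftBaseChange E (Algebra.linearMap k E ∘ₗ φ) (D.T w)
        rw [map_mul, D.T_τ]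
        generalize D.T w = t
        induction t using TensorProduct.induction_on with
        | zero => simp only [zero_mul, map_zero, smul_zero]
        | add t t' ht ht' => rw [add_mul, map_add, ht, ht', map_add, smul_add]
        | tmul e w =>
          rw [Algebra.TensorProduct.tmul_mul_tmul, hT, hT, hφ _ _ hy, mul_one, smul_eq_mul,
            smul_eq_mul, map_mul]
          ring
    have hΦb : BddOn vE (lat OE 1 ME : Set _) Φ := by
      obtain ⟨C, hC⟩ := hφb
      have hC0 : 0 ≤ C := (v.nonneg _).trans (hC 1 (one_mem (lat O 1 M)))
      refine ⟨C, fun w hw => ?_⟩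
      have hw' := D.T_mem_span hME hw
      change vE (LinearMap.liftBaseChange E (Algebra.linearMap k E ∘ₗ φ) (D.T w)) ≤ C
      generalize D.T w = t at hw' ⊢
      induction hw' using Submodule.span_induction with
      | zero => rw [map_zero, map_zero]; exact hC0
      | add x y _ _ hx hy => rw [map_add]; exact (hvE _ _).trans (max_le hx hy)
      | smul c x _ hx =>
        change vE (LinearMap.liftBaseChange E (Algebra.linearMap k E ∘ₗ φ) ((c : E) • x)) ≤ C
        rw [map_smul, smul_eq_mul, map_mul]
        exact (mul_le_of_le_one_left (vE.nonneg _) ((hOE _).1 c.2)).trans hx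
      | mem z hz =>
        obtain ⟨u, hu, rfl⟩ := hz
        rw [hT, one_mul, hv]
        exact hC u hu
    have key := tendsto_map'_iff.1 (hK Φ hΦ hΦb (D.τ a))
    refine key.congr fun x => ?_
    change vE (Φ (D.τ x * D.τ a)) = _
    rw [← map_mul, hΦτ, hv]

end LieBaseChange

end BaseChange

/-! ### Extension of scalars from `F ⊗ g` to `E ⊗ g`. -/

section TowerBaseChange

attribute [local instance 2000] LieRing.ofAssociativeRing
attribute [local instance 2000] LieAlgebra.ofAssociativeAlgebra

open UniversalEnvelopingAlgebra (ι lift)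

variable (K F E g : Type*) [Field K] [Field F] [Field E] [Algebra K F] [Algebra F E] [Algebra K E]
  [IsScalarTower K F E] [LieRing g] [LieAlgebra K g]

/-- The canonical map `F ⊗ g → E ⊗ g`. -/
def towerMap : F ⊗[K] g →ₗ[K] E ⊗[K] g :=
  TensorProduct.map (IsScalarTower.toAlgHom K F E).toLinearMap LinearMap.id

theorem towerMap_tmul (a : F) (x : g) :
    towerMap K F E g (a ⊗ₜ x) = algebraMap F E a ⊗ₜ x := rfl

theorem towerMap_smul (c : F) (y : F ⊗[K] g) :
    towerMap K F E g (c • y) = algebraMap F E c • towerMap K F E g y := by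
  induction y using TensorProduct.induction_on with
  | zero => rw [smul_zero, map_zero, smul_zero]
  | add y y' hy hy' => rw [smul_add, map_add, hy, hy', map_add, smul_add]
  | tmul a x =>
    rw [TensorProduct.smul_tmul', towerMap_tmul, towerMap_tmul, TensorProduct.smul_tmul',
      smul_eq_mul, smul_eq_mul, map_mul]

theorem towerMap_lie (y z : F ⊗[K] g) :
    towerMap K F E g ⁅y, z⁆ = ⁅towerMap K F E g y, towerMap K F E g z⁆ := by
  induction y using TensorProduct.induction_on with
  | zero => rw [zero_lie, map_zero, zero_lie]
  | add y y' hy hy' => rw [add_lie, map_add, hy, hy', map_add, add_lie]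
  | tmul a x =>
    induction z using TensorProduct.induction_on with
    | zero => rw [lie_zero, map_zero, lie_zero]
    | add z z' hz hz' => rw [lie_add, map_add, hz, hz', map_add, lie_add]
    | tmul b y =>
      rw [LieAlgebra.ExtendScalars.bracket_tmul, towerMap_tmul, towerMap_tmul, towerMap_tmul,
        LieAlgebra.ExtendScalars.bracket_tmul, map_mul]

/-- The canonical map `U(F ⊗ g) → U(E ⊗ g)`. -/
def towerEnvMap :
    UniversalEnvelopingAlgebra F (F ⊗[K] g) →+* UniversalEnvelopingAlgebra E (E ⊗[K] g) :=
  letI : Algebra F (UniversalEnvelopingAlgebra E (E ⊗[K] g)) :=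
    ((algebraMap E (UniversalEnvelopingAlgebra E (E ⊗[K] g))).comp (algebraMap F E)).toAlgebra'
      (fun c x => Algebra.commutes (algebraMap F E c) x)
  (lift F
    ({ toFun := fun y => ι E (towerMap K F E g y)
       map_add' := fun y z => by rw [map_add, map_add]
       map_smul' := fun c y => by
        rw [towerMap_smul, map_smul, Algebra.smul_def, RingHom.id_apply, Algebra.smul_def]
        rfl
       map_lie' := fun {y z} => by
        rw [towerMap_lie, LieHom.map_lie] } :
      F ⊗[K] g →ₗ⁅F⁆ UniversalEnvelopingAlgebra E (E ⊗[K] g))).toRingHom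

theorem towerEnvMap_ι (y : F ⊗[K] g) :
    towerEnvMap K F E g (ι F y) = ι E (towerMap K F E g y) := by
  let : Algebra F (UniversalEnvelopingAlgebra E (E ⊗[K] g)) :=
    ((algebraMap E (UniversalEnvelopingAlgebra E (E ⊗[K] g))).comp (algebraMap F E)).toAlgebra'
      (fun c x => Algebra.commutes (algebraMap F E c) x)
  exact lift_ι _ y

theorem towerEnvMap_algebraMap (c : F) :
    towerEnvMap K F E g (algebraMap F _ c) = algebraMap E _ (algebraMap F E c) := by
  let : Algebra F (UniversalEnvelopingAlgebra E (E ⊗[K] g)) :=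
    ((algebraMap E (UniversalEnvelopingAlgebra E (E ⊗[K] g))).comp (algebraMap F E)).toAlgebra'
      (fun c x => Algebra.commutes (algebraMap F E c) x)
  exact AlgHom.commutes (lift F _) c

/-- The map `E ⊗ g → E ⊗ U(F ⊗ g)`. -/
def tensorEnvLinear : E ⊗[K] g →ₗ[E] E ⊗[F] UniversalEnvelopingAlgebra F (F ⊗[K] g) :=
  LinearMap.liftBaseChange E
    { toFun := fun x => (1 : E) ⊗ₜ[F] ι F ((1 : F) ⊗ₜ[K] x)
      map_add' := fun x y => by
        rw [TensorProduct.tmul_add, map_add, TensorProduct.tmul_add]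
      map_smul' := fun c x => by
        rw [TensorProduct.tmul_smul, ← algebraMap_smul F c ((1 : F) ⊗ₜ[K] x), map_smul,
          TensorProduct.tmul_smul, algebraMap_smul, RingHom.id_apply] }

theorem tensorEnvLinear_tmul (e : E) (x : g) :
    tensorEnvLinear K F E g (e ⊗ₜ x) = e ⊗ₜ[F] ι F ((1 : F) ⊗ₜ[K] x) := by
  rw [tensorEnvLinear, LinearMap.liftBaseChange_tmul]
  change e • ((1 : E) ⊗ₜ[F] ι F ((1 : F) ⊗ₜ[K] x)) = _
  rw [TensorProduct.smul_tmul', smul_eq_mul, mul_one]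

theorem tensorEnvLinear_towerMap (y : F ⊗[K] g) :
    tensorEnvLinear K F E g (towerMap K F E g y) = (1 : E) ⊗ₜ[F] ι F y := by
  induction y using TensorProduct.induction_on with
  | zero => simp only [map_zero, TensorProduct.tmul_zero]
  | add y y' hy hy' => rw [map_add, map_add, hy, hy', map_add, TensorProduct.tmul_add]
  | tmul a x =>
    have e : a ⊗ₜ[K] x = a • ((1 : F) ⊗ₜ[K] x) := by
      rw [TensorProduct.smul_tmul', smul_eq_mul, mul_one]
    rw [towerMap_tmul, tensorEnvLinear_tmul, e, map_smul, ← TensorProduct.smul_tmul,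
      Algebra.smul_def, mul_one]

/-- The map `U(E ⊗ g) → E ⊗ U(F ⊗ g)`. -/
def tensorEnvMap :
    UniversalEnvelopingAlgebra E (E ⊗[K] g) →ₐ[E] E ⊗[F] UniversalEnvelopingAlgebra F (F ⊗[K] g) :=
  lift E
    { tensorEnvLinear K F E g with
      map_lie' := fun {y z} => by
        change tensorEnvLinear K F E g ⁅y, z⁆ = tensorEnvLinear K F E g y * tensorEnvLinear K F E g z
          - tensorEnvLinear K F E g z * tensorEnvLinear K F E g y
        induction y using TensorProduct.induction_on with
        | zero => rw [zero_lie, map_zero, zero_mul, mul_zero, sub_zero]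
        | add y y' hy hy' => rw [add_lie, map_add, hy, hy', map_add, add_mul, mul_add]; abel
        | tmul a x =>
          induction z using TensorProduct.induction_on with
          | zero => rw [lie_zero, map_zero, zero_mul, mul_zero, sub_zero]
          | add z z' hz hz' => rw [lie_add, map_add, hz, hz', map_add, add_mul, mul_add]; abel
          | tmul b y =>
            rw [LieAlgebra.ExtendScalars.bracket_tmul, tensorEnvLinear_tmul, tensorEnvLinear_tmul,
              tensorEnvLinear_tmul, Algebra.TensorProduct.tmul_mul_tmul,
              Algebra.TensorProduct.tmul_mul_tmul, mul_comm b a, ← TensorProduct.tmul_sub,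
              ← LieRing.of_associative_ring_bracket, ← LieHom.map_lie,
              LieAlgebra.ExtendScalars.bracket_tmul, one_mul] }

theorem tensorEnvMap_ι (y : E ⊗[K] g) :
    tensorEnvMap K F E g (ι E y) = tensorEnvLinear K F E g y := lift_ι _ y

/-- The extension of scalars from `F ⊗ g` to `E ⊗ g`. -/
def towerBaseChange : LieBaseChange F E (F ⊗[K] g) (E ⊗[K] g) where
  j := (towerMap K F E g).toAddMonoidHom
  τ := towerEnvMap K F E g
  T := tensorEnvMap K F E g
  j_smul := towerMap_smul K F E g
  j_lie := towerMap_lie K F E g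
  span z := by
    induction z using TensorProduct.induction_on with
    | zero => exact zero_mem _
    | add y y' hy hy' => exact add_mem hy hy'
    | tmul a x =>
      have e : a ⊗ₜ[K] x = a • ((1 : E) ⊗ₜ[K] x) := by
        rw [TensorProduct.smul_tmul', smul_eq_mul, mul_one]
      rw [e]
      refine Submodule.smul_mem _ _ (Submodule.subset_span ⟨(1 : F) ⊗ₜ x, ?_⟩)
      change towerMap K F E g ((1 : F) ⊗ₜ x) = _
      rw [towerMap_tmul, map_one]
  τ_ι := towerEnvMap_ι K F E g
  τ_algebraMap := towerEnvMap_algebraMap K F E g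
  T_τ w := by
    induction w using env_induction with
    | hι y => rw [towerEnvMap_ι, tensorEnvMap_ι, tensorEnvLinear_towerMap]
    | hc c =>
      rw [towerEnvMap_algebraMap, AlgHom.commutes, Algebra.TensorProduct.algebraMap_apply,
        Algebra.algebraMap_eq_smul_one (A := UniversalEnvelopingAlgebra F (F ⊗[K] g)),
        ← TensorProduct.smul_tmul, Algebra.smul_def (A := E), mul_one]
      rfl
    | hadd v w hv hw => rw [map_add, map_add, hv, hw, TensorProduct.tmul_add]
    | hmul v w hv hw =>
      rw [map_mul, map_mul, hv, hw, Algebra.TensorProduct.tmul_mul_tmul, one_mul]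

theorem towerEnvMap_envExtend (w : UniversalEnvelopingAlgebra K g) :
    towerEnvMap K F E g (envExtend F g w) = envExtend E g w := by
  induction w using env_induction with
  | hι y => rw [envExtend_ι, towerEnvMap_ι, towerMap_tmul, map_one, envExtend_ι]
  | hc c =>
    rw [envExtend_algebraMap, towerEnvMap_algebraMap, envExtend_algebraMap,
      ← IsScalarTower.algebraMap_apply K F E]
  | hadd v w hv hw => rw [map_add, map_add, hv, hw, map_add]
  | hmul v w hv hw => rw [map_mul, map_mul, hv, hw, map_mul]

end TowerBaseChange

/-! ### Comparison of Dixmier annihilators over the algebraic closure. -/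

section Comparison

attribute [local instance 100] LieRing.ofAssociativeRing

open UniversalEnvelopingAlgebra (ι lift)
open Filter Topology UniformSpace

variable {p : ℕ} [Fact p.Prime]

section

variable {k : Type*} [Field k] [Algebra ℚ_[p] k] [Algebra.IsAlgebraic ℚ_[p] k]
variable {h : Type*} [LieRing h] [LieAlgebra k h]
variable (E : Type*) [Field E] [Algebra ℚ_[p] E] [Algebra.IsAlgebraic ℚ_[p] E] [Algebra k E]
  [IsScalarTower ℚ_[p] k E] {L : LieSpan p k h}

theorem IsFast.envExtend {x : ℕ → UniversalEnvelopingAlgebra k h} (hx : IsFast L x) :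
    IsFast (L.extend E) fun n => envExtend E h (x n) := by
  intro n
  obtain ⟨y, hy, e⟩ := hx n
  refine ⟨AffinoidDixmier.envExtend E h y, envExtend_mem E L y hy, ?_⟩
  change (p ^ n) • AffinoidDixmier.envExtend E h y = _
  rw [← map_nsmul, ← map_sub]
  exact congrArg _ e

theorem envExtend_mem_lat {q : k} {w : UniversalEnvelopingAlgebra k h}
    (hw : w ∈ lat (valuationRing p k) q L.toSubmodule) :
    envExtend E h w ∈ lat (valuationRing p E) (algebraMap k E q) (L.extend E).toSubmodule := by
  induction hw using lat_induction with
  | hι y hy =>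
    rw [envExtend_ι, TensorProduct.tmul_smul, ← algebraMap_smul E]
    exact ι_smul_mem_lat (Submodule.subset_span ⟨y, hy, rfl⟩)
  | hc c hc =>
    rw [envExtend_algebraMap]
    exact algebraMap_mem_lat (algebraMap_mem_valuationRing E hc)
  | hadd v w _ _ hv hw => rw [map_add]; exact add_mem hv hw
  | hmul v w _ _ hv hw => rw [map_mul]; exact mul_mem hv hw

theorem tendsto_extendMap {x : ℕ → UniversalEnvelopingAlgebra k h} {w : AffinoidEnvelope L}
    (hw : Tendsto (fun n => toAffinoid L (x n)) atTop (𝓝 w)) :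
    Tendsto (fun n => toAffinoid (L.extend E) (envExtend E h (x n))) atTop
      (𝓝 (extendMap E L w)) := by
  have hcont : Continuous (extendMap E L) := Completion.continuous_map
  refine ((hcont.tendsto w).comp hw).congr fun n => ?_
  exact Completion.mapRingHom_coe _ (α := EnvTop L) (x n)

theorem tendsto_deformationMap {m : ℕ} {x : ℕ → UniversalEnvelopingAlgebra k h}
    {w : AffinoidEnvelope (L.scale m)}
    (hw : Tendsto (fun n => toAffinoid (L.scale m) (x n)) atTop (𝓝 w)) :
    Tendsto (fun n => toAffinoid L (x n)) atTop (𝓝 (deformationMap L m w)) := by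
  have hcont : Continuous (deformationMap L m) := Completion.continuous_map
  refine ((hcont.tendsto w).comp hw).congr fun n => ?_
  exact Completion.mapRingHom_coe _ (α := EnvTop (L.scale m)) (x n)

theorem IsFast.of_scale {m : ℕ} {x : ℕ → UniversalEnvelopingAlgebra k h}
    (hx : IsFast (L.scale m) x) : IsFast L x := by
  intro n
  obtain ⟨y, hy, e⟩ := hx n
  refine ⟨y, ?_, e⟩
  change y ∈ envLattice (L.scale m) at hy
  change y ∈ envLattice L
  rw [envLattice_scale] at hy
  rw [envLattice_eq_lat]
  exact lat_le_lat ⟨_, p_pow_mem p m, (mul_one _).symm⟩ hy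

omit [IsScalarTower ℚ_[p] k E] in
theorem liftBaseChange_mem_valuationRing {f : h →ₗ[k] E}
    (hf : ∀ x ∈ L.toSubmodule, f x ∈ valuationRing p E) {z : E ⊗[k] h}
    (hz : z ∈ (L.extend E).toSubmodule) : f.liftBaseChange E z ∈ valuationRing p E := by
  induction hz using Submodule.span_induction with
  | zero => rw [map_zero]; exact zero_mem _
  | add x y _ _ hx hy => rw [map_add]; exact add_mem hx hy
  | smul c x _ hx =>
    change f.liftBaseChange E ((c : E) • x) ∈ _
    rw [map_smul]
    exact mul_mem c.2 hx
  | mem z hz =>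
    obtain ⟨x, hx, rfl⟩ := hz
    rw [LinearMap.liftBaseChange_tmul, one_smul]
    exact hf x hx

end

section

variable {k : Type*} [Field k] [Algebra ℚ_[p] k] [Algebra.IsAlgebraic ℚ_[p] k]
variable {h : Type*} [LieRing h] [LieAlgebra k h]

/-- Since `pᴺ u` lies in the lattice, `p^(N i) ad(u)ⁱ` preserves it, and only `i < c` matters. The
bound `N c + v_p(c!)` covers both this power and the denominator `i!`. -/
theorem pow_smul_adDiv_mem (L : LieSpan p k h) {u : h} {N c n : ℕ}
    (hu : (p : k) ^ N • u ∈ L.toSubmodule) (hc : (LieAlgebra.ad k h u) ^ c = 0)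
    (hn : N * c + padicValNat p c.factorial ≤ n) {y : h} (hy : y ∈ L.toSubmodule) (i : ℕ) :
    (p : k) ^ n • adDiv (k := k) u i y ∈ L.toSubmodule := by
  rcases le_total c i with hi | hi
  · rw [adDiv, pow_eq_zero_of_le hi hc, smul_zero, LinearMap.zero_apply, smul_zero]
    exact zero_mem _
  have hp0 : (p : k) ^ (N * i) ≠ 0 := pow_ne_zero _ (p_ne_zero p k)
  have hmem : (p : k) ^ (N * i) • ((LieAlgebra.ad k h u) ^ i) y ∈ L.toSubmodule := by
    clear hp0 hi
    induction i with
    | zero => simpa using hy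
    | succ i ih =>
      rw [mul_add, mul_one, pow_add, mul_comm, mul_smul, pow_succ', Module.End.mul_apply,
        LieAlgebra.ad_apply, ← lie_smul, ← smul_lie]
      exact L.lie_mem _ hu _ ih
  have e : (p : k) ^ n • adDiv (k := k) u i y = ((p : k) ^ n * (i.factorial : k)⁻¹ *
      ((p : k) ^ (N * i))⁻¹) • (p : k) ^ (N * i) • ((LieAlgebra.ad k h u) ^ i) y := by
    rw [adDiv, LinearMap.smul_apply, ← mul_smul, ← mul_smul, inv_mul_cancel_right₀ hp0]
  rw [e]
  refine L.smul_mem (pow_mul_inv_factorial_mem hi (le_trans ?_ hn)) hmem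
  exact Nat.add_le_add_right (Nat.mul_le_mul_left N hi) _

end

variable {K : Type*} [Field K] [Algebra ℚ_[p] K] [FiniteDimensional ℚ_[p] K]
variable {g : Type*} [LieRing g] [LieAlgebra K g] [FiniteDimensional K g] [LieRing.IsNilpotent g]

/-- The field and the polarisation hidden in the annihilator are moved to the algebraic closure,
where annihilators computed over different fields become comparable. -/
theorem IsDixmierAnnihilator.exists_kill {L : LieSpan p K g} (hL : L.toSubmodule.FG)
    {lam : g →ₗ[K] AlgebraicClosure K} {I : Ideal (AffinoidEnvelope L)}
    (hI : IsDixmierAnnihilator L lam I) :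
    ∃ b : LieSubalgebra (AlgebraicClosure K) (AlgebraicClosure K ⊗[K] g),
      IsPolIn ⊤ b (lam.liftBaseChange (AlgebraicClosure K)) ∧
      ∀ x w, IsFast L x → Tendsto (fun n => toAffinoid L (x n)) atTop (𝓝 w) →
        (w ∈ I ↔ Kill (padicAbs p (AlgebraicClosure K))
          (map (fun n => envExtend (AlgebraicClosure K) g (x n)) atTop)
          (L.extend (AlgebraicClosure K)).toSubmodule b
          (lam.liftBaseChange (AlgebraicClosure K))) := by
  obtain ⟨F, hF, f, hfl, hf, b, hb, rfl⟩ := hI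
  have : FiniteDimensional ℚ_[p] F := FiniteDimensional.trans ℚ_[p] K F
  have : IsScalarTower ℚ_[p] F (AlgebraicClosure K) := IsScalarTower.of_algebraMap_eq fun x => by
    rw [IsScalarTower.algebraMap_apply ℚ_[p] K F, ← IsScalarTower.algebraMap_apply K F,
      ← IsScalarTower.algebraMap_apply ℚ_[p] K]
  let D := towerBaseChange K F (AlgebraicClosure K) g
  have hfE : ∀ y, lam.liftBaseChange (AlgebraicClosure K) (D.j y)
      = algebraMap F (AlgebraicClosure K) (f.liftBaseChange F y) := by
    intro y
    induction y using TensorProduct.induction_on with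
    | zero => simp only [map_zero]
    | add y y' hy hy' => rw [map_add, map_add, hy, hy', map_add, map_add]
    | tmul a x =>
      change lam.liftBaseChange (AlgebraicClosure K)
        (towerMap K F (AlgebraicClosure K) g (a ⊗ₜ x)) = _
      rw [towerMap_tmul, LinearMap.liftBaseChange_tmul, LinearMap.liftBaseChange_tmul, smul_eq_mul,
        smul_eq_mul, map_mul, ← hfl]
      rfl
  refine ⟨D.extendSub b, D.isPolIn_extendSub hb.isPolIn hfE, fun x w hx hw => ?_⟩
  have hLF : (L.extend F).toSubmodule.FG := L.fg_extend hL F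
  rw [Ideal.mem_comap, mem_annihilator_iff_kill hf hb hLF (tendsto_extendMap F hw),
    D.kill_extendSub_iff (OE := valuationRing p (AlgebraicClosure K))
      (vE := padicAbs p (AlgebraicClosure K)) (ME := (L.extend (AlgebraicClosure K)).toSubmodule)
      (fE := lam.liftBaseChange (AlgebraicClosure K))
      ((L.extend F).isGoodLattice hLF) isNonarchimedean_padicAbs (fun x => Iff.rfl)
      (padicAbs_tower (AlgebraicClosure K)) ?_ ?_ ?_ hf hb.isPolIn hfE, map_map]
  · have e : D.τ ∘ (fun n => envExtend F g (x n))
        = fun n => envExtend (AlgebraicClosure K) g (x n) :=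
      funext fun n => towerEnvMap_envExtend K F (AlgebraicClosure K) g (x n)
    rw [e]
  · intro y hy
    induction hy using Submodule.span_induction with
    | zero => rw [map_zero]; exact zero_mem _
    | add x y _ _ hx hy => rw [map_add]; exact add_mem hx hy
    | smul c x _ hx =>
      change D.j ((c : F) • x) ∈ _
      rw [D.j_smul]
      exact (L.extend (AlgebraicClosure K)).smul_mem
        (algebraMap_mem_valuationRing (AlgebraicClosure K) c.2) hx
    | mem z hz =>
      obtain ⟨x, hx, rfl⟩ := hz
      refine Submodule.subset_span ⟨x, hx, ?_⟩
      change _ = towerMap K F (AlgebraicClosure K) g ((1 : F) ⊗ₜ x)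
      rw [towerMap_tmul, map_one]
  · intro z hz
    refine Submodule.span_mono ?_ hz
    rintro _ ⟨x, hx, rfl⟩
    refine ⟨(1 : F) ⊗ₜ x, Submodule.subset_span ⟨x, hx, rfl⟩, ?_⟩
    change towerMap K F (AlgebraicClosure K) g ((1 : F) ⊗ₜ x) = _
    rw [towerMap_tmul, map_one]
  · rw [← envLattice_eq_lat]
    exact (hx.envExtend F).cauchyFor

/-- Intersecting with the image of the `2n`-th deformation, one Dixmier annihilator is contained in
the other. -/
theorem IsDixmierAnnihilator.inter_subset {L : LieSpan p K g} (hL : L.toSubmodule.FG)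
    {lam mu : g →ₗ[K] AlgebraicClosure K}
    (hlam : ∀ x ∈ L.toSubmodule, lam x ∈ valuationRing p (AlgebraicClosure K))
    (hmu : ∀ x ∈ L.toSubmodule, mu x ∈ valuationRing p (AlgebraicClosure K))
    {N : ℕ} {u : AlgebraicClosure K ⊗[K] g}
    (hu : (p : AlgebraicClosure K) ^ N • u ∈ (L.extend (AlgebraicClosure K)).toSubmodule)
    (hconj : IsCoadjointConj (AlgebraicClosure K) u
      (lam.liftBaseChange (AlgebraicClosure K)) (mu.liftBaseChange (AlgebraicClosure K)))
    {n : ℕ} (hn : N * LieModule.nilpotencyLength g g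
      + padicValNat p (LieModule.nilpotencyLength g g).factorial ≤ n)
    {I J : Ideal (AffinoidEnvelope L)}
    (hI : IsDixmierAnnihilator L lam I) (hJ : IsDixmierAnnihilator L mu J) :
    (I : Set (AffinoidEnvelope L)) ∩ Set.range (deformationMap L (2 * n)) ⊆ J := by
  obtain ⟨b₁, hb₁, h₁⟩ := hI.exists_kill hL
  obtain ⟨b₂, hb₂, h₂⟩ := hJ.exists_kill hL
  rintro _ ⟨hwI, w, rfl⟩
  obtain ⟨x, hx, hxw⟩ := exists_isFast_tendsto (L.scale (2 * n)) w
  have hlim := tendsto_deformationMap hxw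
  have : CharZero (AlgebraicClosure K) :=
    charZero_of_injective_algebraMap (algebraMap ℚ_[p] (AlgebraicClosure K)).injective
  -- The same sequence serves both annihilators: it is chosen Cauchy for `U(p²ⁿ L)`, which is the
  -- lattice for `q²` with `q = pⁿ`.
  refine (h₂ x _ hx.of_scale hlim).2 (Kill.conj (p := p)
    ((L.extend (AlgebraicClosure K)).isGoodLattice (L.fg_extend hL _))
    (q := (p : AlgebraicClosure K) ^ n) (p_pow_mem p n) (pow_ne_zero _ (p_ne_zero p _))
    (fun y hy i => pow_smul_adDiv_mem _ hu (ad_pow_nilpotencyLength _ u) hn hy i)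
    (ad_pow_nilpotencyLength _ u) ?_
    (fun m hm => liftBaseChange_mem_valuationRing _ hlam hm)
    (fun m hm => liftBaseChange_mem_valuationRing _ hmu hm) hconj hb₁ hb₂
    ((h₁ x _ hx.of_scale hlim).1 hwI))
  intro m
  have hc := hx.cauchyFor m
  simp only [eventually_map] at hc ⊢
  filter_upwards [hc] with a ha
  filter_upwards [ha] with c ⟨z, hz, e⟩
  refine ⟨envExtend (AlgebraicClosure K) g z, ?_, ?_⟩
  · rw [envLattice_scale] at hz
    have := envExtend_mem_lat (AlgebraicClosure K) hz
    rwa [map_pow, map_natCast, two_mul, pow_add] at this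
  · rw [← map_sub, e, map_nsmul]

end Comparison

end AffinoidDixmier

end

/-! ### The main theorem. -/

theorem mainTheorem10 (p : ℕ) [Fact p.Prime]
    (K : Type*) [Field K] [Algebra ℚ_[p] K] [FiniteDimensional ℚ_[p] K]
    (g : Type*) [LieRing g] [LieAlgebra K g] [FiniteDimensional K g] [LieRing.IsNilpotent g]
    (L : LieSpan p K g) (hL : L.IsSeparated)
    (lam mu : g →ₗ[K] AlgebraicClosure K)
    (hlam : ∀ x ∈ L.toSubmodule, lam x ∈ valuationRing p (AlgebraicClosure K))
    (hmu : ∀ x ∈ L.toSubmodule, mu x ∈ valuationRing p (AlgebraicClosure K))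
    (N : ℕ) (u : AlgebraicClosure K ⊗[K] g)
    (hu : (p : AlgebraicClosure K) ^ N • u ∈ L.extendSubmodule (AlgebraicClosure K))
    (hconj : IsCoadjointConj (AlgebraicClosure K) u
      (lam.liftBaseChange (AlgebraicClosure K))
      (mu.liftBaseChange (AlgebraicClosure K)))
    (n : ℕ)
    (hn : N * LieModule.nilpotencyLength g g
      + padicValNat p (LieModule.nilpotencyLength g g).factorial ≤ n)
    (I J : Ideal (AffinoidEnvelope L))
    (hI : IsDixmierAnnihilator L lam I) (hJ : IsDixmierAnnihilator L mu J) :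
    (I : Set (AffinoidEnvelope L)) ∩ Set.range (deformationMap L (2 * n))
      = (J : Set (AffinoidEnvelope L)) ∩ Set.range (deformationMap L (2 * n)) := by
  have hfg := L.fg_of_isSeparated hL
  have : CharZero (AlgebraicClosure K) :=
    charZero_of_injective_algebraMap (algebraMap ℚ_[p] (AlgebraicClosure K)).injective
  obtain ⟨σ, hσ, hσ'⟩ := exists_expAd_equiv (k := AlgebraicClosure K) (u := u)
    ⟨_, ad_pow_nilpotencyLength _ u⟩
  -- The situation is symmetric: `exp(ad(-u))` is the inverse of `exp(ad u)` and takes `μ` back to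
  -- `λ`, so one inclusion gives both.
  have hconj' : IsCoadjointConj (AlgebraicClosure K) (-u)
      (mu.liftBaseChange (AlgebraicClosure K)) (lam.liftBaseChange (AlgebraicClosure K)) := by
    intro x
    rw [← hσ', ← hconj, ← hσ, LieEquiv.apply_symm_apply]
  have hu' : (p : AlgebraicClosure K) ^ N • (-u) ∈ (L.extend (AlgebraicClosure K)).toSubmodule := by
    rw [smul_neg]
    exact neg_mem hu
  exact Set.Subset.antisymm
    (fun w hw => ⟨hI.inter_subset hfg hlam hmu hu hconj hn hJ hw, hw.2⟩)
    (fun w hw => ⟨hJ.inter_subset hfg hmu hlam hu' hconj' hn hI hw, hw.2⟩)
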